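/- Let $W$ be a white noise on $\mathbb{R}^2$, i.e. a centered Gaussian process indexed by $L^2(\mathbb{R}^2)$ with $\mathbb{E}[W(\varphi)W(\psi)]=\langle\varphi,\psi\rangle_{L^2}$. Let $q:\mathbb{R}^2\to\mathbb{R}$ satisfy the following for some $\beta>\frac52$: 1. $q$ is of class $C^4$, and $\partial^{a}q\in L^2(\mathbb{R}^2)$ for every multi-index $a\in\mathbb{N}^2$ with $|a|\le 4$; 2. $q(z)=q(-z)$ for all $z$; 3. there is $C>0$ with $|\partial^{a}q(z)|\le C\|z\|^{-\beta}$ for all $|a|\le 2$ and $\|z\|\ge 1$; 4. $(q*q)(0)>0$. Let $f$ be a version of the Gaussian field $q*W$, that is, for each $z\in\mathbb{R}^2$, $f(z)=W(q(\cdot-z))$ almost surely, and suppose that the sample paths of $f$ are almost surely of class $C^2$. With $e_1=(1,0)$, let $$\alpha(z)=\sup_{t>0}\frac{f(z+te_1)-f(z)}{t}\in(-\infty,+\infty],\qquad z\in\mathbb{R}^2 .$$ Fix $\ell>0$. Then, almost surely, for every $z_0\in\mathbb{R}^2$ with $\alpha(z_0)=\ell$ there exist $r_0>0$ and an injective continuous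 map $\gamma:(-1,1)\to\mathbb{R}^2$ with $\gamma(0)=z_0$ and $$\gamma\big((-1,1)\big)=\{z:\alpha(z)=\ell\}\cap\{z:\|z-z_0\|<r_0\},$$ such that the restrictions of $\gamma$ to $(-1,0]$ and to $[0,1)$ are of class $C^1$ with nowhere vanishing derivative (one-sided at the endpoint $0$). In particular $z_0$ is the only point at which the curve may fail to be smooth. -/

import Mathlib

open MeasureTheory ProbabilityTheory Set
open scoped ENNReal

noncomputable section

/-- The plane `ℝ²` with its Euclidean norm. -/
abbrev Plane : Type := EuclideanSpace ℝ (Fin 2)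

/-- The first vector `e₁ = (1, 0)` of the canonical basis. -/
def e₁ : Plane := EuclideanSpace.single 0 1

/-- The partial derivative of `g` in the `i`-th coordinate direction. -/
def partialD (i : Fin 2) (g : Plane → ℝ) : Plane → ℝ :=
  fun z => fderiv ℝ g z (EuclideanSpace.single i 1)

/-- The iterated partial derivative `∂^(a, b) g` for the multi-index `(a, b)`. -/
def multiD (a b : ℕ) (g : Plane → ℝ) : Plane → ℝ :=
  (partialD 0)^[a] ((partialD 1)^[b] g)

/-- The standing assumption on the convolution kernel `q`. -/
structure KernelAssumption (q : Plane → ℝ) : Prop where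
  contDiff : ContDiff ℝ 4 q
  memLp : ∀ a b : ℕ, a + b ≤ 4 → MemLp (multiD a b q) 2 volume
  symm : ∀ z, q z = q (-z)
  decay : ∃ β : ℝ, 5 / 2 < β ∧ ∃ C : ℝ, 0 < C ∧ ∀ a b : ℕ, a + b ≤ 2 →
    ∀ z : Plane, 1 ≤ ‖z‖ → |multiD a b q z| ≤ C / ‖z‖ ^ β
  conv_pos : 0 < convolution q q (ContinuousLinearMap.mul ℝ ℝ) volume 0

theorem KernelAssumption.memLp_translate {q : Plane → ℝ} (hq : KernelAssumption q) (z : Plane) :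
    MemLp (fun x => q (x - z)) 2 volume :=
  (hq.memLp 0 0 (by norm_num)).comp_measurePreserving (measurePreserving_sub_right volume z)

/-- The translate `q(· - z)` as an element of `L²(ℝ²)`. -/
def KernelAssumption.translate {q : Plane → ℝ} (hq : KernelAssumption q) (z : Plane) :
    Lp ℝ 2 (volume : Measure Plane) :=
  (hq.memLp_translate z).toLp (fun x => q (x - z))

/-- `W` is a white noise on `ℝ²`: a centered Gaussian process indexed by `L²(ℝ²)` whose covariance
is the `L²` scalar product. -/
structure IsWhiteNoise {Ω : Type*} [MeasurableSpace Ω] (P : Measure Ω)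
    (W : Lp ℝ 2 (volume : Measure Plane) → Ω → ℝ) : Prop where
  gaussian : IsGaussianProcess W P
  centered : ∀ φ, ∫ ω, W φ ω ∂P = 0
  covariance : ∀ φ ψ, ∫ ω, W φ ω * W ψ ω ∂P = inner ℝ φ ψ

/-- `f` is a version of the random field `q ∗ W`, that is `f(z) = W(q(· - z))` almost surely for
every `z`, whose sample paths are almost surely of class `C²`. -/
structure IsSmoothConvolutionField {Ω : Type*} [MeasurableSpace Ω] (P : Measure Ω)
    {q : Plane → ℝ} (hq : KernelAssumption q) (W : Lp ℝ 2 (volume : Measure Plane) → Ω → ℝ)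
    (f : Ω → Plane → ℝ) : Prop where
  eq_whiteNoise : ∀ z : Plane, ∀ᵐ ω ∂P, f ω z = W (hq.translate z) ω
  smooth : ∀ᵐ ω ∂P, ContDiff ℝ 2 (f ω)

/-- The slope field `α(z) = sup_{t > 0} (g(z + t e₁) - g(z)) / t` of a function `g`, as an extended
real number (so that the supremum always makes sense). -/
def slopeField (g : Plane → ℝ) (z : Plane) : EReal :=
  ⨆ t : ℝ, ⨆ _ : 0 < t, (((g (z + t • e₁) - g z) / t : ℝ) : EReal)

/-- The level set `{α = ℓ}` of the slope field of `g`. -/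
def slopeLevelSet (g : Plane → ℝ) (l : ℝ) : Set Plane :=
  {z | slopeField g z = (l : EReal)}

/-- `γ`, restricted to `(-1, 1)`, is an injective continuous parametrization of `S` passing through
`z₀` at time `0`, which is a piecewise `C¹` curve whose only possible non-smooth point is `z₀`: the
two pieces `(-1, 0]` and `[0, 1)` are `C¹` up to and including the time `0`, with non-vanishing
velocity (at `0` the velocity is the one-sided one). -/
structure IsPiecewiseC1Param (γ : ℝ → Plane) (S : Set Plane) (z₀ : Plane) : Prop where
  continuousOn : ContinuousOn γ (Ioo (-1) 1)
  injOn : InjOn γ (Ioo (-1) 1)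
  image_eq : γ '' Ioo (-1) 1 = S
  map_zero : γ 0 = z₀
  contDiffOn_left : ContDiffOn ℝ 1 γ (Ioc (-1) 0)
  contDiffOn_right : ContDiffOn ℝ 1 γ (Ico 0 1)
  velocity_left : ∀ t ∈ Ioc (-1 : ℝ) 0, derivWithin γ (Ioc (-1) 0) t ≠ 0
  velocity_right : ∀ t ∈ Ico (0 : ℝ) 1, derivWithin γ (Ico 0 1) t ≠ 0

end

/-! ### Scalar implicit functions and maxima depending on a parameter. -/

open Filter Topology

/-! Put g(x,y) = f(x,y) − ℓx. Then α(x,y) = ℓ says that x maximizes g(·,y) on [x,∞) and that slope 0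
of g is reached there, either in the limit t → 0 (x is critical) or at a later point of the same
height. This is `IsContact`, and the equivalence `slopeField_eq_iff` uses that g tends to −∞
linearly, uniformly for y in a bounded range, so that only a compact range of x matters.

Almost surely the horizontal critical points of g are generic (`SlopeData`). Degenerate ones have
∂₁∂₂f ≠ 0 and ∂₁³f ≠ 0; three critical points of one horizontal line never share a height; two that
do have different ∂₂f and are both nondegenerate. Each exceptional event consists of d + 1 Gaussian
equations in d unknowns, and is excluded by a Bulinskaya argument
(`IsWhiteNoise.ae_not_common_zero`). Its hypothesis is the linear independence in L² of translated
derivatives of q. On the Fourier side this becomes the independence of exponential polynomials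
(`KernelAssumption.jet_eq_zero_of_sum_eq_zero`); the third derivative is treated apart
(`linearIndependent_cusp`).

Sample paths are only C², while ∂₁³f is needed. Since q is C⁴ with L² derivatives, dyadic chaining
on fourth moments gives continuous versions of the required third derivatives
(`exists_continuous_version`, `IsVersion.ae_hasDerivAt`). The same chaining gives the bound O(√x) on
f that makes g decay (`IsVersion.ae_growth`).

The rest is deterministic. At a noncritical contact point the level set is g(x,y) = M(y), where M is
the maximum of one or two later peak values; it is a graph over y with at most one corner
(`exists_param_of_neg`). At a nondegenerate critical point it is the critical curve or, if there is
a later contact, half of this curve continued by a graph over x (`exists_param_of_peak`). At a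
degenerate critical point it is half of the fold curve continued by a graph whose slope tends to 0
(`fold_aux`). Each time two C¹ arcs leave z₀, and since the distance to z₀ increases along each of
them, a small disc cuts out exactly one curve (`HalfBranch.exists_isPiecewiseC1Param`). -/

/-- A `C¹` implicit function on a box, for a scalar equation that is increasing in the second
variable. -/
theorem exists_implicit_graph {F Fx Fy : ℝ → ℝ → ℝ} {a b c d : ℝ} (hcd : c < d)
    (hFx : ∀ x ∈ Ioo a b, ∀ y ∈ Icc c d, HasDerivAt (fun s => F s y) (Fx x y) x)
    (hFy : ∀ x ∈ Ioo a b, ∀ y ∈ Icc c d, HasDerivAt (F x) (Fy x y) y)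
    (cx : ContinuousOn (fun p : ℝ × ℝ => Fx p.1 p.2) (Ioo a b ×ˢ Icc c d))
    (cy : ContinuousOn (fun p : ℝ × ℝ => Fy p.1 p.2) (Ioo a b ×ˢ Icc c d))
    (hpos : ∀ x ∈ Ioo a b, ∀ y ∈ Icc c d, 0 < Fy x y)
    (hc : ∀ x ∈ Ioo a b, F x c < 0) (hd : ∀ x ∈ Ioo a b, 0 < F x d) :
    ∃ η : ℝ → ℝ, (∀ x ∈ Ioo a b, η x ∈ Ioo c d) ∧
      (∀ x ∈ Ioo a b, ∀ y ∈ Icc c d, (F x y = 0 ↔ y = η x) ∧ (F x y < 0 ↔ y < η x)) ∧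
      (∀ x ∈ Ioo a b, HasDerivAt η (-Fx x (η x) / Fy x (η x)) x) ∧ ContDiffOn ℝ 1 η (Ioo a b) := by
  have mono : ∀ x ∈ Ioo a b, StrictMonoOn (F x) (Icc c d) := fun x hx =>
    strictMonoOn_of_deriv_pos (convex_Icc c d)
      (fun y hy => (hFy x hx y hy).continuousAt.continuousWithinAt) (fun y hy => by
        have hy' := interior_subset hy
        rw [(hFy x hx y hy').deriv]; exact hpos x hx y hy')
  have ex : ∀ x ∈ Ioo a b, ∃ y ∈ Ioo c d, F x y = 0 := fun x hx => by
    have := intermediate_value_Ioo hcd.le (f := F x)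
      (fun y hy => (hFy x hx y hy).continuousAt.continuousWithinAt) ⟨hc x hx, hd x hx⟩
    simpa using this
  choose! η hη h0 using ex
  have key : ∀ x ∈ Ioo a b, ∀ y ∈ Icc c d, (F x y = 0 ↔ y = η x) ∧ (F x y < 0 ↔ y < η x) := by
    intro x hx y hy
    have hm := Ioo_subset_Icc_self (hη x hx)
    refine ⟨⟨fun h => (mono x hx).injOn hy hm (h.trans (h0 x hx).symm), fun h => h ▸ h0 x hx⟩, ?_⟩
    rw [← h0 x hx]; exact (mono x hx).lt_iff_lt hy hm
  -- Continuity comes from monotonicity alone: the sign of F at a fixed height w above or below η(x)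
  -- persists for nearby x. The height is clipped to [c, d], where F is controlled.
  have hcont : ∀ x ∈ Ioo a b, ContinuousAt η x := by
    intro x hx
    have hIoo : ∀ᶠ x' in 𝓝 x, x' ∈ Ioo a b := Ioo_mem_nhds hx.1 hx.2
    rw [ContinuousAt, tendsto_order]
    constructor
    · intro u hu
      set w := max u c
      have hw : w ∈ Icc c d := ⟨le_max_right _ _, max_le (hu.le.trans (hη x hx).2.le) hcd.le⟩
      have hw' : w < η x := max_lt hu (hη x hx).1
      have h1 : F x w < 0 := ((key x hx w hw).2).2 hw'
      filter_upwards [hIoo, (hFx x hx w hw).continuousAt.eventually_lt_const h1] with x' hx' h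
      exact (le_max_left u c).trans_lt (((key x' hx' w hw).2).1 h)
    · intro u hu
      set w := min u d
      have hw : w ∈ Icc c d := ⟨le_min ((hη x hx).1.le.trans hu.le) hcd.le, min_le_right _ _⟩
      have hw' : η x < w := lt_min hu (hη x hx).2
      have h1 : 0 < F x w := by
        rw [← h0 x hx]; exact mono x hx (Ioo_subset_Icc_self (hη x hx)) hw hw'
      filter_upwards [hIoo, (hFx x hx w hw).continuousAt.eventually_const_lt h1] with x' hx' h
      refine lt_of_lt_of_le ?_ (min_le_left u d)
      rw [← h0 x' hx'] at h
      exact ((mono x' hx').lt_iff_lt (Ioo_subset_Icc_self (hη x' hx')) hw).1 h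
  have hder : ∀ x ∈ Ioo a b, HasDerivAt η (-Fx x (η x) / Fy x (η x)) x := by
    intro x hx
    have hO : ∀ᶠ v in 𝓝 ((x, η x) : ℝ × ℝ), v ∈ Ioo a b ×ˢ Ioo c d :=
      (isOpen_Ioo.prod isOpen_Ioo).mem_nhds ⟨hx, hη x hx⟩
    have hN : Ioo a b ×ˢ Icc c d ∈ 𝓝 ((x, η x) : ℝ × ℝ) := by
      filter_upwards [hO] with v hv using ⟨hv.1, Ioo_subset_Icc_self hv.2⟩
    have hne := (hpos x hx _ (Ioo_subset_Icc_self (hη x hx))).ne'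
    let L : ℝ → ℝ →L[ℝ] ℝ := fun t => ContinuousLinearMap.toSpanSingleton ℝ t
    have hL : Continuous L := (ContinuousLinearMap.toSpanSingletonCLE (𝕜 := ℝ) (E := ℝ)).continuous
    have df₁ : ∀ᶠ v in 𝓝 ((x, η x) : ℝ × ℝ), HasFDerivAt (F · v.2) (L (Fx v.1 v.2)) v.1 := by
      filter_upwards [hN] with v hv using (hFx v.1 hv.1 v.2 hv.2).hasFDerivAt
    have df₂ : ∀ᶠ v in 𝓝 ((x, η x) : ℝ × ℝ), HasFDerivAt (F v.1 ·) (L (Fy v.1 v.2)) v.2 := by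
      filter_upwards [hN] with v hv using (hFy v.1 hv.1 v.2 hv.2).hasFDerivAt
    have cf₁ : ContinuousAt (fun v : ℝ × ℝ => L (Fx v.1 v.2)) (x, η x) :=
      hL.continuousAt.comp (cx.continuousAt hN)
    have cf₂ : ContinuousAt (fun v : ℝ × ℝ => L (Fy v.1 v.2)) (x, η x) :=
      hL.continuousAt.comp (cy.continuousAt hN)
    let e : ℝ ≃L[ℝ] ℝ := ContinuousLinearEquiv.unitsEquivAut ℝ (Units.mk0 _ hne)
    have he : (e : ℝ →L[ℝ] ℝ) = L (Fy x (η x)) := by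
      ext; simp [e, L]
    have inv : (L (Fy x (η x))).IsInvertible := ⟨e, he⟩
    have D := hasStrictFDerivAt_implicitFunctionOfBivariate (u := (x, η x)) (f := F)
      (f₁ := fun s t => L (Fx s t)) (f₂ := fun s t => L (Fy s t)) df₁ df₂ cf₁ cf₂ inv
    have E := eventually_apply_eq_iff_implicitFunctionOfBivariate (u := (x, η x)) (f := F)
      (f₁ := fun s t => L (Fx s t)) (f₂ := fun s t => L (Fy s t)) df₁ df₂ cf₁ cf₂ inv
    set ψ := implicitFunctionOfBivariate (u := (x, η x)) (f := F)
      (f₁ := fun s t => L (Fx s t)) (f₂ := fun s t => L (Fy s t)) df₁ df₂ cf₁ cf₂ inv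
    -- By continuity of η the points (x', η x') enter the neighbourhood where the implicit function
    -- theorem asserts uniqueness, so η inherits the derivative of ψ.
    have hEq : η =ᶠ[𝓝 x] ψ := by
      have ht : Tendsto (fun x' => (x', η x')) (𝓝 x) (𝓝 (x, η x)) :=
        (continuousAt_id.prodMk (hcont x hx))
      filter_upwards [ht.eventually E, Ioo_mem_nhds hx.1 hx.2] with x' h hx'
      exact (h.1 (by simp [h0 x' hx', h0 x hx])).symm
    have D2 := D.hasFDerivAt.hasDerivAt.congr_of_eventuallyEq hEq
    refine D2.congr_deriv ?_
    have : (L (Fy x (η x))).inverse = (e.symm : ℝ →L[ℝ] ℝ) := by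
      rw [← he, ContinuousLinearMap.inverse_equiv]
    simp [this, e, L, div_eq_mul_inv, mul_comm]
  refine ⟨η, hη, key, hder, ?_⟩
  have hco : ContinuousOn η (Ioo a b) := fun x hx => (hcont x hx).continuousWithinAt
  rw [show (1 : WithTop ℕ∞) = 0 + 1 from rfl, contDiffOn_succ_iff_deriv_of_isOpen isOpen_Ioo]
  refine ⟨fun x hx => (hder x hx).differentiableAt.differentiableWithinAt, by simp, ?_⟩
  rw [contDiffOn_zero]
  have hm : MapsTo (fun x => (x, η x)) (Ioo a b) (Ioo a b ×ˢ Icc c d) :=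
    fun x hx => ⟨hx, Ioo_subset_Icc_self (hη x hx)⟩
  have h2 := (cx.comp (continuousOn_id.prodMk hco) hm).neg.div
    (cy.comp (continuousOn_id.prodMk hco) hm)
    (fun x hx => (hpos x hx _ (Ioo_subset_Icc_self (hη x hx))).ne')
  exact h2.congr fun x hx => (hder x hx).deriv

/-- Local form of `exists_implicit_graph`. -/
theorem exists_implicit_graph_local {F Fx Fy : ℝ → ℝ → ℝ} {x₀ y₀ : ℝ} {O : Set (ℝ × ℝ)}
    (hO : O ∈ 𝓝 (x₀, y₀))
    (hFx : ∀ p ∈ O, HasDerivAt (fun s => F s p.2) (Fx p.1 p.2) p.1)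
    (hFy : ∀ p ∈ O, HasDerivAt (F p.1) (Fy p.1 p.2) p.2)
    (cx : ContinuousOn (fun p : ℝ × ℝ => Fx p.1 p.2) O)
    (cy : ContinuousOn (fun p : ℝ × ℝ => Fy p.1 p.2) O)
    (h0 : F x₀ y₀ = 0) (hpos : 0 < Fy x₀ y₀) {ε : ℝ} (hε : 0 < ε) :
    ∃ r ∈ Ioc 0 ε, ∃ ρ ∈ Ioc 0 ε, ∃ η : ℝ → ℝ, η x₀ = y₀ ∧
      Ioo (x₀ - ρ) (x₀ + ρ) ×ˢ Icc (y₀ - r) (y₀ + r) ⊆ O ∧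
      (∀ x ∈ Ioo (x₀ - ρ) (x₀ + ρ), ∀ y ∈ Icc (y₀ - r) (y₀ + r), 0 < Fy x y) ∧
      (∀ x ∈ Ioo (x₀ - ρ) (x₀ + ρ), η x ∈ Ioo (y₀ - r) (y₀ + r)) ∧
      (∀ x ∈ Ioo (x₀ - ρ) (x₀ + ρ), ∀ y ∈ Icc (y₀ - r) (y₀ + r),
        (F x y = 0 ↔ y = η x) ∧ (F x y < 0 ↔ y < η x)) ∧
      (∀ x ∈ Ioo (x₀ - ρ) (x₀ + ρ), HasDerivAt η (-Fx x (η x) / Fy x (η x)) x) ∧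
      ContDiffOn ℝ 1 η (Ioo (x₀ - ρ) (x₀ + ρ)) := by
  have hev : ∀ᶠ p : ℝ × ℝ in 𝓝 (x₀, y₀), p ∈ O ∧ 0 < Fy p.1 p.2 :=
    (eventually_mem_set.2 hO).and ((cy.continuousAt hO).eventually_const_lt hpos)
  obtain ⟨δ, hδ, hball⟩ := Metric.eventually_nhds_iff.1 hev
  have hbox : ∀ x y, |x - x₀| < δ → |y - y₀| < δ → (x, y) ∈ O ∧ 0 < Fy x y := fun x y hx hy =>
    @hball (x, y) (by rw [Prod.dist_eq]; exact max_lt hx hy)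
  set r := min ε (δ / 2)
  have hr0 : 0 < r := lt_min hε (by positivity)
  have hrδ : r < δ := (min_le_right _ _).trans_lt (by linarith)
  have hy : ∀ y ∈ Icc (y₀ - r) (y₀ + r), |y - y₀| < δ := fun y hy => by
    rw [abs_lt]; constructor <;> linarith [hy.1, hy.2]
  have mono : StrictMonoOn (F x₀) (Icc (y₀ - r) (y₀ + r)) :=
    strictMonoOn_of_deriv_pos (convex_Icc _ _)
      (fun y h => (hFy _ (hbox x₀ y (by simpa) (hy y h)).1).continuousAt.continuousWithinAt)
      (fun y h => by
        have h' := hbox x₀ y (by simpa) (hy y (interior_subset h))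
        rw [(hFy _ h'.1).deriv]; exact h'.2)
  have hl : y₀ - r ∈ Icc (y₀ - r) (y₀ + r) := ⟨le_rfl, by linarith⟩
  have hu : y₀ + r ∈ Icc (y₀ - r) (y₀ + r) := ⟨by linarith, le_rfl⟩
  have hmid : y₀ ∈ Icc (y₀ - r) (y₀ + r) := ⟨by linarith, by linarith⟩
  have h1 : F x₀ (y₀ - r) < 0 := h0 ▸ mono hl hmid (by linarith)
  have h2 : 0 < F x₀ (y₀ + r) := h0 ▸ mono hmid hu (by linarith)
  -- The height r is fixed first; the strict signs on the two horizontal sides then persist for x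
  -- near x₀ and determine the width ρ.
  have c1 := (hFx _ (hbox x₀ _ (by simpa) (hy _ hl)).1).continuousAt.eventually_lt_const h1
  have c2 := (hFx _ (hbox x₀ _ (by simpa) (hy _ hu)).1).continuousAt.eventually_const_lt h2
  obtain ⟨ρ', hρ', hb⟩ := Metric.eventually_nhds_iff.1 (c1.and c2)
  set ρ := min ε (min ρ' δ)
  have hρ0 : 0 < ρ := lt_min hε (lt_min hρ' hδ)
  have hx : ∀ x ∈ Ioo (x₀ - ρ) (x₀ + ρ), |x - x₀| < ρ := fun x hx => by
    rw [abs_lt]; constructor <;> linarith [hx.1, hx.2]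
  have hxδ : ∀ x ∈ Ioo (x₀ - ρ) (x₀ + ρ), |x - x₀| < δ := fun x h =>
    (hx x h).trans_le ((min_le_right _ _).trans (min_le_right _ _))
  have hxρ : ∀ x ∈ Ioo (x₀ - ρ) (x₀ + ρ), dist x x₀ < ρ' := fun x h =>
    (hx x h).trans_le ((min_le_right _ _).trans (min_le_left _ _))
  have hsub : Ioo (x₀ - ρ) (x₀ + ρ) ×ˢ Icc (y₀ - r) (y₀ + r) ⊆ O := fun p hp =>
    (hbox p.1 p.2 (hxδ _ hp.1) (hy _ hp.2)).1
  have hp : ∀ x ∈ Ioo (x₀ - ρ) (x₀ + ρ), ∀ y ∈ Icc (y₀ - r) (y₀ + r), 0 < Fy x y :=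
    fun x h y h' => (hbox x y (hxδ _ h) (hy _ h')).2
  obtain ⟨η, e1, e2, e3, e4⟩ := exists_implicit_graph (by linarith : y₀ - r < y₀ + r)
    (fun x h y h' => hFx _ (hsub (mk_mem_prod h h'))) (fun x h y h' => hFy _ (hsub (mk_mem_prod h h')))
    (cx.mono hsub) (cy.mono hsub) hp (fun x h => (hb (hxρ x h)).1) (fun x h => (hb (hxρ x h)).2)
  have hx₀ : x₀ ∈ Ioo (x₀ - ρ) (x₀ + ρ) := ⟨by linarith, by linarith⟩
  exact ⟨r, ⟨hr0, min_le_left _ _⟩, ρ, ⟨hρ0, min_le_left _ _⟩, η,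
    (((e2 x₀ hx₀ y₀ hmid).1).1 h0).symm, hsub, hp, e1, e2, e3, e4⟩

/-- The maximum over a compact interval of a `C¹` family of functions is `C¹` where the maximizer
is unique. -/
theorem hasDerivAt_max_of_unique {g gy : ℝ → ℝ → ℝ}
    (cg : Continuous fun p : ℝ × ℝ => g p.1 p.2) (cgy : Continuous fun p : ℝ × ℝ => gy p.1 p.2)
    (dgy : ∀ x y, HasDerivAt (g x) (gy x y) y) {a b : ℝ} {J : Set ℝ} (hJ : IsOpen J) {α : ℝ → ℝ}
    (hα : ∀ y ∈ J, α y ∈ Icc a b) (hmax : ∀ y ∈ J, ∀ x ∈ Icc a b, x ≠ α y → g x y < g (α y) y) :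
    (∀ y ∈ J, ContinuousAt α y) ∧
      ∀ y ∈ J, HasDerivAt (fun y => g (α y) y) (gy (α y) y) y := by
  have hle : ∀ y ∈ J, ∀ x ∈ Icc a b, g x y ≤ g (α y) y := fun y hy x hx => by
    by_cases h : x = α y
    · rw [h]
    · exact (hmax y hy x hx h).le
  -- Away from a ball around α(y) the strict inequality holds on a compact set, so it persists for
  -- nearby y' and traps α(y') in the ball.
  have hcont : ∀ y ∈ J, ContinuousAt α y := by
    intro y hy
    rw [ContinuousAt, Metric.tendsto_nhds]
    intro ε hε
    have hK : IsCompact (Icc a b \ Metric.ball (α y) ε) := isCompact_Icc.diff Metric.isOpen_ball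
    have : ∀ᶠ y' in 𝓝 y, ∀ x ∈ Icc a b \ Metric.ball (α y) ε, g x y' < g (α y) y' := by
      refine hK.eventually_forall_of_forall_eventually fun x hx => ?_
      have c1 : Continuous fun p : ℝ × ℝ => g p.2 p.1 := cg.comp continuous_swap
      have c2 : Continuous fun p : ℝ × ℝ => g (α y) p.1 := cg.comp
        (by fun_prop : Continuous fun p : ℝ × ℝ => (α y, p.1))
      refine c1.continuousAt.eventually_lt c2.continuousAt (hmax y hy x hx.1 ?_)
      rintro rfl
      exact hx.2 (Metric.mem_ball_self hε)
    filter_upwards [this, hJ.mem_nhds hy] with y' h hy'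
    by_contra hcon
    exact absurd (h (α y') ⟨hα y' hy', hcon⟩) (not_lt.2 (hle y' hy' _ (hα y hy)))
  refine ⟨hcont, fun y hy => ?_⟩
  rw [hasDerivAt_iff_isLittleO, Asymptotics.isLittleO_iff]
  intro ε hε
  have hcy : ∀ᶠ p : ℝ × ℝ in 𝓝 (α y, y), |gy p.1 p.2 - gy (α y) y| < ε :=
    Metric.tendsto_nhds.1 cgy.continuousAt ε hε
  obtain ⟨δ, hδ, hb⟩ := Metric.eventually_nhds_iff.1 hcy
  have mvt : ∀ x y', |x - α y| < δ → |y' - y| < δ →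
      |g x y' - g x y - (y' - y) * gy (α y) y| ≤ ε * |y' - y| := by
    intro x y' hx hy'
    have hc : Convex ℝ (Metric.ball y δ) := convex_ball y δ
    have := hc.norm_image_sub_le_of_norm_hasDerivWithin_le (f := fun t => g x t - t * gy (α y) y)
      (f' := fun t => gy x t - gy (α y) y) (C := ε) (x := y) (y := y')
      (fun t _ => by
        have := ((dgy x t).fun_sub ((hasDerivAt_id' t).mul_const (gy (α y) y))).hasDerivWithinAt
          (s := Metric.ball y δ)
        simpa using this)
      (fun t ht => (@hb (x, t) (by rw [Prod.dist_eq]; exact max_lt hx ht)).le)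
      (Metric.mem_ball_self hδ) hy'
    simp only [Real.norm_eq_abs] at this
    convert this using 2; ring
  -- Sandwich for P(y) = g(α y, y): by maximality P(y') − P(y) lies between the increments of g(α y,
  -- ·) and of g(α y', ·) from y to y', and both equal (y' − y)·gy(α y, y) up to ε|y' − y|.
  filter_upwards [hJ.mem_nhds hy, Metric.ball_mem_nhds y hδ,
    Metric.tendsto_nhds.1 (hcont y hy) δ hδ] with y' hy' hyb hαb
  have m1 := mvt (α y) y' (by simpa) hyb
  have m2 := mvt (α y') y' hαb hyb
  have l1 := hle y' hy' _ (hα y hy)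
  have l2 := hle y hy _ (hα y' hy')
  simp only [smul_eq_mul, Real.norm_eq_abs]
  rw [abs_le] at m1 m2 ⊢
  constructor <;> linarith [m1.1, m1.2, m2.1, m2.2]

/-! ### Arcs issued from a point and their assembly into one curve. -/

theorem derivWithin_ne_zero_of_leftInverse {γ : ℝ → Plane} {u : Plane → ℝ} {s : Set ℝ} {k t : ℝ}
    (hk : k ≠ 0) (hs : UniqueDiffWithinAt ℝ s t) (ht : t ∈ s)
    (hγ : DifferentiableWithinAt ℝ γ s t) (hu : Differentiable ℝ u)
    (h : ∀ r ∈ s, u (γ r) = k * r) : derivWithin γ s t ≠ 0 := by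
  intro h0
  have h1 : HasDerivWithinAt γ 0 s t := h0 ▸ hγ.hasDerivWithinAt
  have h2 : HasDerivWithinAt (u ∘ γ) 0 s t := by
    simpa using (hu (γ t)).hasFDerivAt.comp_hasDerivWithinAt t h1
  have h3 : HasDerivWithinAt (u ∘ γ) k s t :=
    (((hasDerivAt_id' t).const_mul k).hasDerivWithinAt.congr h (h t ht)).congr_deriv (mul_one k)
  exact hk (hs.eq_deriv _ h3 h2)

/-- A `C¹` arc issued from `z₀`, whose parameter is recovered by the coordinate `u`. -/
structure HalfBranch (c : ℝ → Plane) (u : Plane → ℝ) (z₀ : Plane) (δ : ℝ) : Prop where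
  pos : 0 < δ
  map_zero : c 0 = z₀
  contDiffOn : ContDiffOn ℝ 1 c (Ico 0 δ)
  leftInverse : ∀ s ∈ Ico 0 δ, u (c s) = s
  differentiable : Differentiable ℝ u

/-- With relative errors 1/4, the inner product is at least ab‖w‖²(1 − 1/4 − 1/4 − 1/16). -/
theorem inner_nonneg_of_near {A C w : Plane} {a b : ℝ} (ha : 0 ≤ a) (hb : 0 ≤ b)
    (hA : ‖A - a • w‖ ≤ ‖w‖ / 4 * a) (hC : ‖C - b • w‖ ≤ ‖w‖ / 4 * b) : 0 ≤ inner ℝ C A := by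
  obtain ⟨e, rfl⟩ : ∃ e, A = a • w + e := ⟨A - a • w, by abel⟩
  obtain ⟨e', rfl⟩ : ∃ e', C = b • w + e' := ⟨C - b • w, by abel⟩
  simp only [add_sub_cancel_left] at hA hC
  simp only [inner_add_left, inner_add_right, real_inner_smul_left, real_inner_smul_right,
    real_inner_self_eq_norm_sq]
  have h1 := (abs_le.1 (abs_real_inner_le_norm w e)).1
  have h2 := (abs_le.1 (abs_real_inner_le_norm e' w)).1
  have h3 := (abs_le.1 (abs_real_inner_le_norm e' e)).1
  have hw := norm_nonneg w
  have k1 : ‖w‖ * ‖e‖ ≤ ‖w‖ * (‖w‖ / 4 * a) := by gcongr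
  have k2 : ‖e'‖ * ‖w‖ ≤ (‖w‖ / 4 * b) * ‖w‖ := by gcongr
  have k3 : ‖e'‖ * ‖e‖ ≤ (‖w‖ / 4 * b) * (‖w‖ / 4 * a) := by gcongr
  have m1 := mul_le_mul_of_nonneg_left (k1.trans' (neg_le.1 h1)) hb
  have m2 := mul_le_mul_of_nonneg_left (k2.trans' (neg_le.1 h2)) ha
  have hab : 0 ≤ a * b * ‖w‖ ^ 2 := by positivity
  nlinarith

namespace HalfBranch

variable {c : ℝ → Plane} {u : Plane → ℝ} {z₀ : Plane} {δ : ℝ}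

theorem derivWithin_ne_zero (h : HalfBranch c u z₀ δ) {s : ℝ} (hs : s ∈ Ico 0 δ) :
    derivWithin c (Ico 0 δ) s ≠ 0 :=
  derivWithin_ne_zero_of_leftInverse one_ne_zero (uniqueDiffOn_Ico 0 δ s hs) hs
    (h.contDiffOn.differentiableOn one_ne_zero s hs) h.differentiable
    (fun r hr => by rw [h.leftInverse r hr, one_mul])

/-- Increments of c near 0 are close to multiples of c'(0) ≠ 0. Each new increment therefore has a
nonnegative inner product with the displacement c(s) − z₀, and the squared distance grows. -/
theorem exists_strictMonoOn_norm (h : HalfBranch c u z₀ δ) :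
    ∃ δ₁ ∈ Ioo 0 δ, StrictMonoOn (fun s => ‖c s - z₀‖) (Icc 0 δ₁) := by
  set w := derivWithin c (Ico 0 δ) 0 with hw
  have h0 : (0 : ℝ) ∈ Ico 0 δ := ⟨le_rfl, h.pos⟩
  have hwpos : 0 < ‖w‖ := norm_pos_iff.2 (h.derivWithin_ne_zero h0)
  have hc : ContinuousWithinAt (derivWithin c (Ico 0 δ)) (Ico 0 δ) 0 :=
    (h.contDiffOn.continuousOn_derivWithin (uniqueDiffOn_Ico 0 δ) le_rfl) 0 h0
  obtain ⟨ε, hε, hb⟩ := Metric.continuousWithinAt_iff.1 hc (‖w‖ / 4) (by positivity)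
  set δ₁ := min (δ / 2) (ε / 2)
  have hp := h.pos
  have hδ₁ : 0 < δ₁ := lt_min (by linarith) (by linarith)
  have hδ₁δ : δ₁ < δ := (min_le_left _ _).trans_lt (by linarith)
  have hδ₁ε : δ₁ < ε := (min_le_right _ _).trans_lt (by linarith)
  have hsub : Icc 0 δ₁ ⊆ Ico 0 δ := fun s hs => ⟨hs.1, hs.2.trans_lt hδ₁δ⟩
  have mvt : ∀ s ∈ Icc 0 δ₁, ∀ t ∈ Icc 0 δ₁, s ≤ t →
      ‖(c t - c s) - (t - s) • w‖ ≤ ‖w‖ / 4 * (t - s) := by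
    intro s hs t ht hst
    have := (convex_Icc 0 δ₁).norm_image_sub_le_of_norm_hasDerivWithin_le
      (f := fun r => c r - r • w) (f' := fun r => derivWithin c (Ico 0 δ) r - w) (C := ‖w‖ / 4)
      (fun r hr => by
        have h1 := ((h.contDiffOn.differentiableOn one_ne_zero r (hsub hr)).hasDerivWithinAt).mono
          hsub
        simpa using h1.fun_sub ((hasDerivAt_id' r).smul_const w).hasDerivWithinAt)
      (fun r hr => by
        have := hb (hsub hr) (by
          rw [Real.dist_eq, sub_zero, abs_of_nonneg hr.1]; exact hr.2.trans_lt hδ₁ε)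
        rw [dist_eq_norm] at this
        exact this.le) hs ht
    rw [Real.norm_eq_abs, abs_of_nonneg (sub_nonneg.2 hst)] at this
    rwa [show c t - c s - (t - s) • w = c t - t • w - (c s - s • w) by rw [sub_smul]; abel]
  refine ⟨δ₁, ⟨hδ₁, hδ₁δ⟩, fun s hs t ht hst => ?_⟩
  have hz : (0 : ℝ) ∈ Icc 0 δ₁ := ⟨le_rfl, hδ₁.le⟩
  have m1 := mvt s hs t ht hst.le
  have m2 := mvt 0 hz s hs hs.1
  rw [h.map_zero, sub_zero] at m2
  have hin := inner_nonneg_of_near (sub_nonneg.2 hst.le) hs.1 m1 m2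
  have hne : 0 < ‖c t - c s‖ := by
    rw [norm_pos_iff, sub_ne_zero]
    intro heq
    have := h.leftInverse t (hsub ht)
    rw [heq, h.leftInverse s (hsub hs)] at this
    exact hst.ne this
  have hsq : ‖c t - z₀‖ ^ 2 = ‖c s - z₀‖ ^ 2 + 2 * inner ℝ (c s - z₀) (c t - c s)
      + ‖c t - c s‖ ^ 2 := by
    rw [← norm_add_sq_real]; congr 2; abel
  refine lt_of_pow_lt_pow_left₀ 2 (norm_nonneg _) ?_
  nlinarith [pow_pos hne 2]

/-- The distance is monotone, so radius r is reached at a single time τ and the arc does not come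
back into the ball. Continuity of `u` keeps the parameters of the points of a small ball in the
range where monotonicity is known. -/
theorem exists_exit (h : HalfBranch c u z₀ δ) :
    ∃ r₁ > 0, ∀ r ∈ Ioc 0 r₁, ∃ τ ∈ Ioo 0 δ, (∀ s ∈ Ico 0 τ, ‖c s - z₀‖ < r) ∧
      ∀ z ∈ Metric.ball z₀ r, 0 ≤ u z → c (u z) = z → u z < τ := by
  obtain ⟨δ₁, hδ₁, hm⟩ := h.exists_strictMonoOn_norm
  have hz : (0 : ℝ) ∈ Icc 0 δ₁ := ⟨le_rfl, hδ₁.1.le⟩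
  have he : δ₁ ∈ Icc 0 δ₁ := ⟨hδ₁.1.le, le_rfl⟩
  have hN0 : ‖c 0 - z₀‖ = 0 := by simp [h.map_zero]
  have hNpos : 0 < ‖c δ₁ - z₀‖ := hN0 ▸ hm hz he hδ₁.1
  have hu0 : u z₀ = 0 := by rw [← h.map_zero, h.leftInverse 0 ⟨le_rfl, h.pos⟩]
  have hu : ∀ᶠ z in 𝓝 z₀, u z < δ₁ :=
    (h.differentiable z₀).continuousAt.eventually_lt_const (hu0 ▸ hδ₁.1)
  obtain ⟨ε, hε, hb⟩ := Metric.eventually_nhds_iff_ball.1 hu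
  have hcont : ContinuousOn (fun s => ‖c s - z₀‖) (Icc 0 δ₁) :=
    ((h.contDiffOn.continuousOn.mono fun s hs => ⟨hs.1, hs.2.trans_lt hδ₁.2⟩).sub
      continuousOn_const).norm
  refine ⟨min ‖c δ₁ - z₀‖ ε, lt_min hNpos hε, fun r hr => ?_⟩
  obtain ⟨τ, hτ, hτr⟩ := intermediate_value_Icc hδ₁.1.le hcont
    (⟨hN0.le.trans hr.1.le, hr.2.trans (min_le_left _ _)⟩ : r ∈ Icc ‖c 0 - z₀‖ ‖c δ₁ - z₀‖)
  have hτ0 : 0 < τ := by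
    rcases hτ.1.eq_or_lt with h' | h'
    · rw [← h'] at hτr
      exact absurd (hτr.symm.trans hN0) hr.1.ne'
    · exact h'
  refine ⟨τ, ⟨hτ0, hτ.2.trans_lt hδ₁.2⟩, fun s hs => ?_, fun z hz h0 hcz => ?_⟩
  · rw [← hτr]; exact hm ⟨hs.1, hs.2.le.trans hτ.2⟩ hτ hs.2
  · have h1 : u z < δ₁ := hb z (Metric.ball_subset_ball (hr.2.trans (min_le_right _ _)) hz)
    refine (hm.lt_iff_lt ⟨h0, h1.le⟩ hτ).1 ?_
    simp only [hcz, hτr]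
    exact mem_ball_iff_norm.1 hz

/-- Two `C¹` arcs issued from `z₀` and otherwise disjoint, which make up `S` near `z₀`, give a
piecewise `C¹` parametrization of `S` in a small ball. -/
theorem exists_isPiecewiseC1Param {d : ℝ → Plane} {v : Plane → ℝ} {δ' : ℝ} {S : Set Plane}
    (hc : HalfBranch c u z₀ δ) (hd : HalfBranch d v z₀ δ')
    (hS : ∀ᶠ z in 𝓝 z₀, z ∈ S ↔ (0 ≤ u z ∧ c (u z) = z) ∨ (0 ≤ v z ∧ d (v z) = z))
    (hdisj : ∀ s ∈ Ico 0 δ, ∀ t ∈ Ico 0 δ', c s = d t → s = 0) :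
    ∃ r₀ : ℝ, 0 < r₀ ∧ ∃ γ : ℝ → Plane, IsPiecewiseC1Param γ (S ∩ Metric.ball z₀ r₀) z₀ := by
  obtain ⟨r₁, hr₁, H₁⟩ := hc.exists_exit
  obtain ⟨r₂, hr₂, H₂⟩ := hd.exists_exit
  obtain ⟨r₃, hr₃, H₃⟩ := Metric.eventually_nhds_iff_ball.1 hS
  set r := min r₁ (min r₂ r₃)
  have hr : 0 < r := lt_min hr₁ (lt_min hr₂ hr₃)
  obtain ⟨τ, hτ, C1, C2⟩ := H₁ r ⟨hr, min_le_left _ _⟩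
  obtain ⟨κ, hκ, D1, D2⟩ := H₂ r ⟨hr, (min_le_right _ _).trans (min_le_left _ _)⟩
  have H₃' : ∀ z ∈ Metric.ball z₀ r, _ := fun z hz =>
    H₃ z (Metric.ball_subset_ball ((min_le_right _ _).trans (min_le_right _ _)) hz)
  -- The factors τ and κ make the two arcs reach the boundary of the ball at times 1 and −1.
  set γ : ℝ → Plane := fun t => if 0 ≤ t then c (τ * t) else d (-κ * t)
  have γr : ∀ t, 0 ≤ t → γ t = c (τ * t) := fun t ht => if_pos ht
  have γl : ∀ t, t ≤ 0 → γ t = d (-κ * t) := fun t ht => by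
    rcases ht.eq_or_lt with rfl | h
    · simp [γ, hc.map_zero, hd.map_zero]
    · exact if_neg (not_le.2 h)
  have mr : ∀ t ∈ Ico (0 : ℝ) 1, τ * t ∈ Ico 0 τ := fun t ht =>
    ⟨mul_nonneg hτ.1.le ht.1, by nlinarith [hτ.1, ht.2]⟩
  have ml : ∀ t ∈ Ioc (-1 : ℝ) 0, -κ * t ∈ Ico 0 κ := fun t ht =>
    ⟨by nlinarith [hκ.1, ht.2], by nlinarith [hκ.1, ht.1]⟩
  have mr' : ∀ t ∈ Ico (0 : ℝ) 1, τ * t ∈ Ico 0 δ := fun t ht =>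
    ⟨(mr t ht).1, (mr t ht).2.trans hτ.2⟩
  have ml' : ∀ t ∈ Ioc (-1 : ℝ) 0, -κ * t ∈ Ico 0 δ' := fun t ht =>
    ⟨(ml t ht).1, (ml t ht).2.trans hκ.2⟩
  have sr : ContDiffOn ℝ 1 γ (Ico 0 1) :=
    (hc.contDiffOn.comp (by fun_prop : ContDiff ℝ 1 fun t : ℝ => τ * t).contDiffOn mr').congr
      fun t ht => γr t ht.1
  have sl : ContDiffOn ℝ 1 γ (Ioc (-1) 0) :=
    (hd.contDiffOn.comp (by fun_prop : ContDiff ℝ 1 fun t : ℝ => -κ * t).contDiffOn ml').congr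
      fun t ht => γl t ht.2
  have hdu : ∀ s ∈ Ico 0 δ, ∀ t ∈ Ico 0 δ', c s = d t → s = 0 ∧ t = 0 := fun s hs t ht h => by
    have h0 := hdisj s hs t ht h
    refine ⟨h0, ?_⟩
    rw [← hd.leftInverse t ht, ← h, h0, hc.map_zero, ← hd.map_zero,
      hd.leftInverse 0 ⟨le_rfl, hd.pos⟩]
  refine ⟨r, hr, γ, ?_, ?_, ?_, ?_, sl, sr, ?_, ?_⟩
  · have e : Ioo (-1 : ℝ) 1 = Ioc (-1) 0 ∪ Ico 0 1 := by
      rw [Ioc_union_Ico_eq_Ioo] <;> norm_num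
    intro t ht
    rcases lt_trichotomy t 0 with h | h | h
    · exact ((sl.continuousOn t ⟨ht.1, h.le⟩).continuousAt
        (Ioc_mem_nhds ht.1 h)).continuousWithinAt
    · rw [e]
      exact (sl.continuousOn t ⟨ht.1, h.le⟩).union (sr.continuousOn t ⟨h.ge, ht.2⟩)
    · exact ((sr.continuousOn t ⟨h.le, ht.2⟩).continuousAt
        (Ico_mem_nhds h ht.2)).continuousWithinAt
  · have cross : ∀ s ∈ Ioo (-1 : ℝ) 1, ∀ t ∈ Ioo (-1 : ℝ) 1, 0 ≤ s → t ≤ 0 → γ s = γ t →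
        s = t := by
      intro s hs t ht h1 h2 heq
      rw [γr s h1, γl t h2] at heq
      obtain ⟨a, b⟩ := hdu _ (mr' s ⟨h1, hs.2⟩) _ (ml' t ⟨ht.1, h2⟩) heq
      have a' : s = 0 := by simpa [hτ.1.ne'] using a
      have b' : t = 0 := by simpa [hκ.1.ne'] using b
      rw [a', b']
    intro s hs t ht heq
    rcases le_total 0 s with h1 | h1 <;> rcases le_total 0 t with h2 | h2
    · rw [γr s h1, γr t h2] at heq
      have := congrArg u heq
      rw [hc.leftInverse _ (mr' s ⟨h1, hs.2⟩), hc.leftInverse _ (mr' t ⟨h2, ht.2⟩)] at this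
      exact mul_left_cancel₀ hτ.1.ne' this
    · exact cross s hs t ht h1 h2 heq
    · exact (cross t ht s hs h2 h1 heq.symm).symm
    · rw [γl s h1, γl t h2] at heq
      have := congrArg v heq
      rw [hd.leftInverse _ (ml' s ⟨hs.1, h1⟩), hd.leftInverse _ (ml' t ⟨ht.1, h2⟩)] at this
      exact mul_left_cancel₀ (neg_ne_zero.2 hκ.1.ne') this
  · ext z
    constructor
    · rintro ⟨t, ht, rfl⟩
      rcases le_total 0 t with h | h
      · have h1 := mr t ⟨h, ht.2⟩
        have hb : γ t ∈ Metric.ball z₀ r := by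
          rw [γr t h, mem_ball_iff_norm]; exact C1 _ h1
        refine ⟨(H₃' _ hb).2 (Or.inl ?_), hb⟩
        rw [γr t h, hc.leftInverse _ (mr' t ⟨h, ht.2⟩)]
        exact ⟨h1.1, rfl⟩
      · have h1 := ml t ⟨ht.1, h⟩
        have hb : γ t ∈ Metric.ball z₀ r := by
          rw [γl t h, mem_ball_iff_norm]; exact D1 _ h1
        refine ⟨(H₃' _ hb).2 (Or.inr ?_), hb⟩
        rw [γl t h, hd.leftInverse _ (ml' t ⟨ht.1, h⟩)]
        exact ⟨h1.1, rfl⟩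
    · rintro ⟨hzS, hzb⟩
      rcases (H₃' z hzb).1 hzS with ⟨h0, h1⟩ | ⟨h0, h1⟩
      · have h2 := C2 z hzb h0 h1
        have h3 : 0 ≤ u z / τ := div_nonneg h0 hτ.1.le
        refine ⟨u z / τ, ⟨by linarith, (div_lt_one hτ.1).2 h2⟩, ?_⟩
        rw [γr _ h3, mul_div_cancel₀ _ hτ.1.ne', h1]
      · have h2 := D2 z hzb h0 h1
        have h3 : 0 ≤ v z / κ := div_nonneg h0 hκ.1.le
        have h4 : v z / κ < 1 := (div_lt_one hκ.1).2 h2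
        refine ⟨-(v z / κ), ⟨by linarith, by linarith⟩, ?_⟩
        rw [γl _ (by linarith), neg_mul_neg, mul_div_cancel₀ _ hκ.1.ne', h1]
  · rw [γr 0 le_rfl, mul_zero, hc.map_zero]
  · intro t ht
    refine derivWithin_ne_zero_of_leftInverse (u := v) (neg_ne_zero.2 hκ.1.ne')
      (uniqueDiffOn_Ioc _ _ t ht) ht (sl.differentiableOn one_ne_zero t ht) hd.differentiable
      fun s hs => ?_
    rw [γl s hs.2, hd.leftInverse _ (ml' s hs)]
  · intro t ht
    refine derivWithin_ne_zero_of_leftInverse (u := u) hτ.1.ne'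
      (uniqueDiffOn_Ico _ _ t ht) ht (sr.differentiableOn one_ne_zero t ht) hc.differentiable
      fun s hs => ?_
    rw [γr s hs.1, hc.leftInverse _ (mr' s hs)]

end HalfBranch

/-! ### Coordinates, and arcs that are graphs. -/

/-- The point of the plane with given coordinates. -/
noncomputable def pt (x y : ℝ) : Plane := !₂[x, y]

@[simp] theorem pt_zero (x y : ℝ) : pt x y 0 = x := rfl

@[simp] theorem pt_one (x y : ℝ) : pt x y 1 = y := rfl

theorem pt_eta (z : Plane) : pt (z 0) (z 1) = z := by
  ext i; fin_cases i <;> rfl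

theorem pt_inj {x y x' y' : ℝ} : pt x y = pt x' y' ↔ x = x' ∧ y = y' := by
  refine ⟨fun h => ⟨by simpa using congrArg (fun z : Plane => z 0) h,
    by simpa using congrArg (fun z : Plane => z 1) h⟩, ?_⟩
  rintro ⟨rfl, rfl⟩; rfl

theorem contDiffOn_pt {a b : ℝ → ℝ} {s : Set ℝ} {n : WithTop ℕ∞} (ha : ContDiffOn ℝ n a s)
    (hb : ContDiffOn ℝ n b s) : ContDiffOn ℝ n (fun t => pt (a t) (b t)) s := by
  rw [contDiffOn_euclidean]
  intro i; fin_cases i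
  · exact ha
  · exact hb

theorem eventually_nhds_pt {x₀ y₀ : ℝ} {p : ℝ → ℝ → Prop}
    (h : ∀ᶠ q : ℝ × ℝ in 𝓝 (x₀, y₀), p q.1 q.2) : ∀ᶠ z in 𝓝 (pt x₀ y₀), p (z 0) (z 1) := by
  have hc : Continuous fun z : Plane => (z 0, z 1) := by fun_prop
  exact (hc.tendsto (pt x₀ y₀)).eventually h

/-- The sign σ = ±1 is the direction in which the graph is run; the parameter is read off the second
coordinate. -/
theorem HalfBranch.graph_snd {φ : ℝ → ℝ} {x₀ y₀ σ δ : ℝ} (hσ : σ * σ = 1) (hδ : 0 < δ)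
    (h0 : φ y₀ = x₀) (hφ : ContDiffOn ℝ 1 (fun s => φ (y₀ + σ * s)) (Ico 0 δ)) :
    HalfBranch (fun s => pt (φ (y₀ + σ * s)) (y₀ + σ * s)) (fun z => σ * (z 1 - y₀))
      (pt x₀ y₀) δ where
  pos := hδ
  map_zero := by simp [h0]
  contDiffOn := contDiffOn_pt hφ (by fun_prop)
  leftInverse s _ := by simp [← mul_assoc, hσ]
  differentiable := by fun_prop

theorem HalfBranch.graph_fst {φ : ℝ → ℝ} {x₀ y₀ σ δ : ℝ} (hσ : σ * σ = 1) (hδ : 0 < δ)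
    (h0 : φ x₀ = y₀) (hφ : ContDiffOn ℝ 1 (fun s => φ (x₀ + σ * s)) (Ico 0 δ)) :
    HalfBranch (fun s => pt (x₀ + σ * s) (φ (x₀ + σ * s))) (fun z => σ * (z 0 - x₀))
      (pt x₀ y₀) δ where
  pos := hδ
  map_zero := by simp [h0]
  contDiffOn := contDiffOn_pt (by fun_prop) hφ
  leftInverse s _ := by simp [← mul_assoc, hσ]
  differentiable := by fun_prop

theorem graph_snd_eq_iff {φ : ℝ → ℝ} {y₀ σ : ℝ} (hσ : σ * σ = 1) (z : Plane) :
    pt (φ (y₀ + σ * (σ * (z 1 - y₀)))) (y₀ + σ * (σ * (z 1 - y₀))) = z ↔ z 0 = φ (z 1) := by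
  have : y₀ + σ * (σ * (z 1 - y₀)) = z 1 := by rw [← mul_assoc, hσ]; ring
  rw [this, ← pt_eta z, pt_inj]
  simp [eq_comm]

theorem graph_fst_eq_iff {φ : ℝ → ℝ} {x₀ σ : ℝ} (hσ : σ * σ = 1) (z : Plane) :
    pt (x₀ + σ * (σ * (z 0 - x₀))) (φ (x₀ + σ * (σ * (z 0 - x₀)))) = z ↔ z 1 = φ (z 0) := by
  have : x₀ + σ * (σ * (z 0 - x₀)) = z 0 := by rw [← mul_assoc, hσ]; ring
  rw [this, ← pt_eta z, pt_inj]
  simp [eq_comm]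

section Assemble

variable {S : Set Plane} {x₀ y₀ δ δ' : ℝ} {φ χ : ℝ → ℝ}

theorem exists_param_of_graphs_snd (hδ : 0 < δ) (hδ' : 0 < δ') (hφ0 : φ y₀ = x₀) (hχ0 : χ y₀ = x₀)
    (hφ : ContDiffOn ℝ 1 φ (Ioo (y₀ - δ) (y₀ + δ))) (hχ : ContDiffOn ℝ 1 χ (Ioo (y₀ - δ') (y₀ + δ')))
    (hS : ∀ᶠ q : ℝ × ℝ in 𝓝 (x₀, y₀), pt q.1 q.2 ∈ S ↔
      (y₀ ≤ q.2 ∧ q.1 = φ q.2) ∨ (q.2 ≤ y₀ ∧ q.1 = χ q.2)) :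
    ∃ r₀ : ℝ, 0 < r₀ ∧ ∃ γ : ℝ → Plane,
      IsPiecewiseC1Param γ (S ∩ Metric.ball (pt x₀ y₀) r₀) (pt x₀ y₀) := by
  have h1 : (1 : ℝ) * 1 = 1 := by norm_num
  have h2 : (-1 : ℝ) * (-1) = 1 := by norm_num
  refine (HalfBranch.graph_snd h1 hδ hφ0 (hφ.comp (by fun_prop) fun s hs => ?_)).exists_isPiecewiseC1Param
    (HalfBranch.graph_snd h2 hδ' hχ0 (hχ.comp (by fun_prop) fun s hs => ?_)) ?_ ?_
  · exact ⟨by linarith [hs.1], by linarith [hs.2]⟩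
  · exact ⟨by linarith [hs.2], by linarith [hs.1]⟩
  · filter_upwards [eventually_nhds_pt (p := fun x y => pt x y ∈ S ↔
      (y₀ ≤ y ∧ x = φ y) ∨ (y ≤ y₀ ∧ x = χ y)) hS] with z hz
    rw [pt_eta] at hz
    simp only [graph_snd_eq_iff h1, graph_snd_eq_iff h2]
    rw [hz]
    simp
  · intro s hs t ht h
    have := (pt_inj.1 h).2
    linarith [hs.1, ht.1]

/-- Only one-sided regularity at x₀ is asked for: at a fold the left branch is known to be C¹ up to
x₀, but not beyond. -/
theorem exists_param_of_graphs_fst (hδ : 0 < δ) (hδ' : 0 < δ') (hφ0 : φ x₀ = y₀) (hχ0 : χ x₀ = y₀)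
    (hφ : ContDiffOn ℝ 1 φ (Ico x₀ (x₀ + δ))) (hχ : ContDiffOn ℝ 1 χ (Ioc (x₀ - δ') x₀))
    (hS : ∀ᶠ q : ℝ × ℝ in 𝓝 (x₀, y₀), pt q.1 q.2 ∈ S ↔
      (x₀ ≤ q.1 ∧ q.2 = φ q.1) ∨ (q.1 ≤ x₀ ∧ q.2 = χ q.1)) :
    ∃ r₀ : ℝ, 0 < r₀ ∧ ∃ γ : ℝ → Plane,
      IsPiecewiseC1Param γ (S ∩ Metric.ball (pt x₀ y₀) r₀) (pt x₀ y₀) := by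
  have h1 : (1 : ℝ) * 1 = 1 := by norm_num
  have h2 : (-1 : ℝ) * (-1) = 1 := by norm_num
  refine (HalfBranch.graph_fst h1 hδ hφ0 (hφ.comp (by fun_prop) fun s hs => ?_)).exists_isPiecewiseC1Param
    (HalfBranch.graph_fst h2 hδ' hχ0 (hχ.comp (by fun_prop) fun s hs => ?_)) ?_ ?_
  · exact ⟨by linarith [hs.1], by linarith [hs.2]⟩
  · exact ⟨by linarith [hs.2], by linarith [hs.1]⟩
  · filter_upwards [eventually_nhds_pt (p := fun x y => pt x y ∈ S ↔
      (x₀ ≤ x ∧ y = φ x) ∨ (x ≤ x₀ ∧ y = χ x)) hS] with z hz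
    rw [pt_eta] at hz
    simp only [graph_fst_eq_iff h1, graph_fst_eq_iff h2]
    rw [hz]
    simp
  · intro s hs t ht h
    have := (pt_inj.1 h).1
    linarith [hs.1, ht.1]

/-- Meant for the passage from the critical curve, a graph over y, to a graph over x. The condition
`hlt` puts the second graph strictly to the right of the first, so the arcs meet only at the base
point. -/
theorem exists_param_of_graph_snd_fst {σ : ℝ} (hσ : σ * σ = 1) (hδ : 0 < δ) (hδ' : 0 < δ')
    (hφ0 : φ y₀ = x₀) (hχ0 : χ x₀ = y₀)
    (hφ : ContDiffOn ℝ 1 φ (Ioo (y₀ - δ) (y₀ + δ))) (hχ : ContDiffOn ℝ 1 χ (Ioo (x₀ - δ') (x₀ + δ')))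
    (hlt : ∀ x ∈ Ioo x₀ (x₀ + δ'), φ (χ x) < x)
    (hS : ∀ᶠ q : ℝ × ℝ in 𝓝 (x₀, y₀), pt q.1 q.2 ∈ S ↔
      (0 ≤ σ * (q.2 - y₀) ∧ q.1 = φ q.2) ∨ (x₀ ≤ q.1 ∧ q.2 = χ q.1)) :
    ∃ r₀ : ℝ, 0 < r₀ ∧ ∃ γ : ℝ → Plane,
      IsPiecewiseC1Param γ (S ∩ Metric.ball (pt x₀ y₀) r₀) (pt x₀ y₀) := by
  have h1 : (1 : ℝ) * 1 = 1 := by norm_num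
  have hσ' : σ = 1 ∨ σ = -1 := mul_self_eq_one_iff.1 hσ
  refine (HalfBranch.graph_snd hσ hδ hφ0 (hφ.comp (by fun_prop) fun s hs => ?_)).exists_isPiecewiseC1Param
    (HalfBranch.graph_fst h1 hδ' hχ0 (hχ.comp (by fun_prop) fun s hs => ?_)) ?_ ?_
  · rcases hσ' with rfl | rfl <;> constructor <;> linarith [hs.1, hs.2]
  · exact ⟨by linarith [hs.1], by linarith [hs.2]⟩
  · filter_upwards [eventually_nhds_pt (p := fun x y => pt x y ∈ S ↔
      (0 ≤ σ * (y - y₀) ∧ x = φ y) ∨ (x₀ ≤ x ∧ y = χ x)) hS] with z hz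
    rw [pt_eta] at hz
    simp only [graph_fst_eq_iff h1, graph_snd_eq_iff hσ]
    rw [hz]
    simp
  · intro s hs t ht h
    obtain ⟨e1, e2⟩ := pt_inj.1 h
    rw [e2, one_mul] at e1
    rcases ht.1.eq_or_lt with h0 | h0
    · rw [← h0, mul_zero, add_zero, hχ0] at e2
      have : σ * s = 0 := by linarith
      rcases hσ' with rfl | rfl <;> linarith
    · exact absurd e1 (hlt _ ⟨by linarith, by linarith [ht.2]⟩).ne

end Assemble

/-! ### Contact points, generic data and moving peaks. -/

/-- The point `(x, y)` is a global maximum of `g(·, y)` on `[x, ∞)`, and is either critical or not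
the only maximum. -/
def IsContact (g h : ℝ → ℝ → ℝ) (x y : ℝ) : Prop :=
  (∀ x', x ≤ x' → g x' y ≤ g x y) ∧ (h x y = 0 ∨ ∃ x', x < x' ∧ g x' y = g x y)

/-- A smooth function `g` with its partial derivatives `gx = h`, `gy`, `gxx = h1`, `gxy = h2`,
`gxxx = h11`, which tends to `-∞` at `x → ∞` and whose horizontal critical points are generic. -/
structure SlopeData (g gy h h1 h2 h11 : ℝ → ℝ → ℝ) : Prop where
  cg : Continuous fun p : ℝ × ℝ => g p.1 p.2
  cgy : Continuous fun p : ℝ × ℝ => gy p.1 p.2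
  ch : Continuous fun p : ℝ × ℝ => h p.1 p.2
  ch1 : Continuous fun p : ℝ × ℝ => h1 p.1 p.2
  ch2 : Continuous fun p : ℝ × ℝ => h2 p.1 p.2
  ch11 : Continuous fun p : ℝ × ℝ => h11 p.1 p.2
  dgx : ∀ x y, HasDerivAt (fun x => g x y) (h x y) x
  dgy : ∀ x y, HasDerivAt (g x) (gy x y) y
  dhx : ∀ x y, HasDerivAt (fun x => h x y) (h1 x y) x
  dhy : ∀ x y, HasDerivAt (h x) (h2 x y) y
  dgyx : ∀ x y, HasDerivAt (fun x => gy x y) (h2 x y) x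
  dh1x : ∀ x y, HasDerivAt (fun x => h1 x y) (h11 x y) x
  decay : ∀ K : ℝ, ∃ c > 0, ∃ R : ℝ, ∀ x ≥ R, ∀ y, |y| ≤ K → g x y ≤ -c * x
  ne_fold : ∀ x y, h x y = 0 → h1 x y = 0 → h2 x y ≠ 0
  ne_cusp : ∀ x y, h x y = 0 → h1 x y = 0 → h11 x y ≠ 0
  ne_triple : ∀ x₁ x₂ x₃ y, x₁ ≠ x₂ → x₁ ≠ x₃ → x₂ ≠ x₃ → h x₁ y = 0 → h x₂ y = 0 → h x₃ y = 0 →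
    g x₁ y = g x₂ y → g x₂ y ≠ g x₃ y
  ne_tangent : ∀ x₁ x₂ y, x₁ ≠ x₂ → h x₁ y = 0 → h x₂ y = 0 → g x₁ y = g x₂ y → gy x₁ y ≠ gy x₂ y
  ne_double : ∀ x₁ x₂ y, x₁ ≠ x₂ → h x₁ y = 0 → h x₂ y = 0 → g x₁ y = g x₂ y → h1 x₁ y ≠ 0

/-- A nondegenerate maximum of `g(·, y)` over an interval around `x₁`, followed for `y` near `y₀`. -/
structure IsPeak (g gy h : ℝ → ℝ → ℝ) (x₁ y₀ ρ r : ℝ) (φ : ℝ → ℝ) : Prop where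
  ρ_pos : 0 < ρ
  r_pos : 0 < r
  map : φ y₀ = x₁
  mem : ∀ y ∈ Ioo (y₀ - r) (y₀ + r), φ y ∈ Ioo (x₁ - ρ) (x₁ + ρ)
  eq_iff : ∀ y ∈ Ioo (y₀ - r) (y₀ + r), ∀ x ∈ Icc (x₁ - ρ) (x₁ + ρ), h x y = 0 ↔ x = φ y
  pos_iff : ∀ y ∈ Ioo (y₀ - r) (y₀ + r), ∀ x ∈ Icc (x₁ - ρ) (x₁ + ρ), 0 < h x y ↔ x < φ y
  anti : ∀ y ∈ Ioo (y₀ - r) (y₀ + r), StrictAntiOn (fun x => g x y) (Icc (φ y) (x₁ + ρ))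
  le_max : ∀ y ∈ Ioo (y₀ - r) (y₀ + r), ∀ x ∈ Icc (x₁ - ρ) (x₁ + ρ), g x y ≤ g (φ y) y
  contDiffOn : ContDiffOn ℝ 1 φ (Ioo (y₀ - r) (y₀ + r))
  hasDerivAt : ∀ y ∈ Ioo (y₀ - r) (y₀ + r), HasDerivAt (fun y => g (φ y) y) (gy (φ y) y) y

namespace SlopeData

variable {g gy h h1 h2 h11 : ℝ → ℝ → ℝ}

theorem strictAntiOn (H : SlopeData g gy h h1 h2 h11) {a b y : ℝ}
    (hneg : ∀ x ∈ Ioo a b, h x y < 0) : StrictAntiOn (fun x => g x y) (Icc a b) :=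
  strictAntiOn_of_deriv_neg (convex_Icc a b) (fun x _ => (H.dgx x y).continuousAt.continuousWithinAt)
    fun x hx => by rw [(H.dgx x y).deriv]; exact hneg x (by simpa using hx)

theorem strictMonoOn (H : SlopeData g gy h h1 h2 h11) {a b y : ℝ}
    (hpos : ∀ x ∈ Ioo a b, 0 < h x y) : StrictMonoOn (fun x => g x y) (Icc a b) :=
  strictMonoOn_of_deriv_pos (convex_Icc a b) (fun x _ => (H.dgx x y).continuousAt.continuousWithinAt)
    fun x hx => by rw [(H.dgx x y).deriv]; exact hpos x (by simpa using hx)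

/-- At x₁ the function h(·,y₀) crosses 0 downwards, so −h = 0 can be solved for x as a function of
y. The signs of h on both sides make the solution the strict maximum over the window, and the peak
value is differentiated by the envelope formula. -/
theorem exists_isPeak (H : SlopeData g gy h h1 h2 h11) {x₁ y₀ : ℝ} (h0 : h x₁ y₀ = 0)
    (hneg : h1 x₁ y₀ < 0) {ε : ℝ} (hε : 0 < ε) :
    ∃ ρ ≤ ε, ∃ r, ∃ φ, IsPeak g gy h x₁ y₀ ρ r φ := by
  obtain ⟨ρ, hρ, r, hr, φ, φ0, -, hpos, hmem, hkey, -, hC⟩ :=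
    exists_implicit_graph_local (F := fun y x => -h x y) (Fx := fun y x => -h2 x y)
    (Fy := fun y x => -h1 x y) (x₀ := y₀) (y₀ := x₁) (O := univ) univ_mem
    (fun p _ => (H.dhy p.2 p.1).neg) (fun p _ => (H.dhx p.2 p.1).neg)
    (H.ch2.comp continuous_swap).neg.continuousOn (H.ch1.comp continuous_swap).neg.continuousOn
    (by simp [h0]) (by simpa using hneg) hε
  have mem' : ∀ y ∈ Ioo (y₀ - r) (y₀ + r), φ y ∈ Icc (x₁ - ρ) (x₁ + ρ) := fun y hy =>
    Ioo_subset_Icc_self (hmem y hy)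
  have hp : ∀ y ∈ Ioo (y₀ - r) (y₀ + r), ∀ x ∈ Icc (x₁ - ρ) (x₁ + ρ), 0 < h x y ↔ x < φ y :=
    fun y hy x hx => by rw [← (hkey y hy x hx).2]; simp
  have he : ∀ y ∈ Ioo (y₀ - r) (y₀ + r), ∀ x ∈ Icc (x₁ - ρ) (x₁ + ρ), h x y = 0 ↔ x = φ y :=
    fun y hy x hx => by rw [← (hkey y hy x hx).1]; simp
  have hanti : ∀ y ∈ Ioo (y₀ - r) (y₀ + r), StrictAntiOn (fun x => g x y) (Icc (φ y) (x₁ + ρ)) :=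
    fun y hy => H.strictAntiOn fun x hx => by
      have hx' : x ∈ Icc (x₁ - ρ) (x₁ + ρ) := ⟨(mem' y hy).1.trans hx.1.le, hx.2.le⟩
      refine lt_of_le_of_ne (not_lt.1 fun h' => ?_) fun h' => ?_
      · exact absurd ((hp y hy x hx').1 h') (not_lt.2 hx.1.le)
      · exact hx.1.ne' ((he y hy x hx').1 h')
  have hmono : ∀ y ∈ Ioo (y₀ - r) (y₀ + r), StrictMonoOn (fun x => g x y) (Icc (x₁ - ρ) (φ y)) :=
    fun y hy => H.strictMonoOn fun x hx =>
      (hp y hy x ⟨hx.1.le, hx.2.le.trans (mem' y hy).2⟩).2 hx.2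
  have hlt : ∀ y ∈ Ioo (y₀ - r) (y₀ + r), ∀ x ∈ Icc (x₁ - ρ) (x₁ + ρ), x ≠ φ y →
      g x y < g (φ y) y := fun y hy x hx hne => by
    have hm := mem' y hy
    rcases lt_or_gt_of_ne hne with h' | h'
    · exact hmono y hy ⟨hx.1, h'.le⟩ ⟨hm.1, le_rfl⟩ h'
    · exact hanti y hy ⟨le_rfl, hm.2⟩ ⟨h'.le, hx.2⟩ h'
  refine ⟨ρ, hρ.2, r, φ, hρ.1, hr.1, φ0, hmem, he, hp, hanti, fun y hy x hx => ?_, hC, ?_⟩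
  · by_cases hne : x = φ y
    · rw [hne]
    · exact (hlt y hy x hx hne).le
  · exact (hasDerivAt_max_of_unique H.cg H.cgy H.dgy isOpen_Ioo mem' hlt).2

/-- Decay handles all large x' at once for y near y₀; on the remaining compact part of [a,∞) outside
`U` the strict inequality is an open condition. -/
theorem far_lt (H : SlopeData g gy h h1 h2 h11) {x₀ y₀ a : ℝ} {U : Set ℝ} (hU : IsOpen U)
    (hlt : ∀ x' ≥ a, x' ∉ U → g x' y₀ < g x₀ y₀) :
    ∀ᶠ q : ℝ × ℝ in 𝓝 (x₀, y₀), ∀ x' ≥ a, x' ∉ U → g x' q.2 < g q.1 q.2 := by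
  obtain ⟨c, hc, R, hR⟩ := H.decay (|y₀| + 1)
  set v := g x₀ y₀ - 1
  set R' := max R (-v / c)
  have hfar : ∀ x ≥ R', ∀ y, |y| ≤ |y₀| + 1 → g x y ≤ v := fun x hx y hy => by
    have h1 := hR x ((le_max_left _ _).trans hx) y hy
    have h2 : -v ≤ c * x := (div_le_iff₀' hc).1 ((le_max_right R (-v / c)).trans hx)
    linarith
  have hK : IsCompact (Icc a R' \ U) := isCompact_Icc.diff hU
  have e1 : ∀ᶠ q : ℝ × ℝ in 𝓝 (x₀, y₀), ∀ x' ∈ Icc a R' \ U, g x' q.2 < g q.1 q.2 := by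
    refine hK.eventually_forall_of_forall_eventually fun x' hx' => ?_
    have c1 : Continuous fun p : (ℝ × ℝ) × ℝ => g p.2 p.1.2 :=
      H.cg.comp (by fun_prop : Continuous fun p : (ℝ × ℝ) × ℝ => (p.2, p.1.2))
    have c2 : Continuous fun p : (ℝ × ℝ) × ℝ => g p.1.1 p.1.2 :=
      H.cg.comp (by fun_prop : Continuous fun p : (ℝ × ℝ) × ℝ => (p.1.1, p.1.2))
    exact c1.continuousAt.eventually_lt c2.continuousAt (hlt x' hx'.1.1 hx'.2)
  have e2 : ∀ᶠ q : ℝ × ℝ in 𝓝 (x₀, y₀), v < g q.1 q.2 :=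
    H.cg.continuousAt.eventually_const_lt (show v < g x₀ y₀ by simp [v])
  have e3 : ∀ᶠ q : ℝ × ℝ in 𝓝 (x₀, y₀), |q.2| < |y₀| + 1 :=
    (by fun_prop : Continuous fun q : ℝ × ℝ => |q.2|).continuousAt.eventually_lt_const
      (by simp)
  filter_upwards [e1, e2, e3] with q q1 q2 q3 x' hx' hU'
  rcases le_total x' R' with h | h
  · exact q1 x' ⟨⟨hx', h⟩, hU'⟩
  · exact (hfar x' h _ q3.le).trans_lt q2

/-- The maximum of `g(·, y)` over `[a, ∞)` near a line where it is reached at two peaks only. -/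
theorem far_max (H : SlopeData g gy h h1 h2 h11) {x₀ y₀ a x₁ x₂ ρ₁ ρ₂ r₁ r₂ : ℝ} {φ₁ φ₂ : ℝ → ℝ}
    (p₁ : IsPeak g gy h x₁ y₀ ρ₁ r₁ φ₁) (p₂ : IsPeak g gy h x₂ y₀ ρ₂ r₂ φ₂)
    (ha₁ : a ≤ x₁ - ρ₁) (ha₂ : a ≤ x₂ - ρ₂)
    (hlt : ∀ x' ≥ a, x' ≠ x₁ → x' ≠ x₂ → g x' y₀ < g x₀ y₀) :
    ∀ᶠ q : ℝ × ℝ in 𝓝 (x₀, y₀),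
      (∃ x' ≥ a, g x' q.2 = max (g (φ₁ q.2) q.2) (g (φ₂ q.2) q.2)) ∧
      (max (g (φ₁ q.2) q.2) (g (φ₂ q.2) q.2) ≤ g q.1 q.2 → ∀ x' ≥ a, g x' q.2 ≤ g q.1 q.2) ∧
      (max (g (φ₁ q.2) q.2) (g (φ₂ q.2) q.2) < g q.1 q.2 → ∀ x' ≥ a, g x' q.2 < g q.1 q.2) := by
  have hx₁ : x₁ ∈ Ioo (x₁ - ρ₁) (x₁ + ρ₁) := ⟨by linarith [p₁.ρ_pos], by linarith [p₁.ρ_pos]⟩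
  have hx₂ : x₂ ∈ Ioo (x₂ - ρ₂) (x₂ + ρ₂) := ⟨by linarith [p₂.ρ_pos], by linarith [p₂.ρ_pos]⟩
  have e1 := H.far_lt (x₀ := x₀) (y₀ := y₀) (a := a)
    (U := Ioo (x₁ - ρ₁) (x₁ + ρ₁) ∪ Ioo (x₂ - ρ₂) (x₂ + ρ₂)) (isOpen_Ioo.union isOpen_Ioo)
    (fun x' hx' hU => hlt x' hx' (fun e => hU (Or.inl (e ▸ hx₁))) fun e => hU (Or.inr (e ▸ hx₂)))
  have e2 : ∀ᶠ q : ℝ × ℝ in 𝓝 (x₀, y₀), q.2 ∈ Ioo (y₀ - r₁) (y₀ + r₁) :=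
    continuous_snd.continuousAt.eventually
      (Ioo_mem_nhds (by linarith [p₁.r_pos]) (by linarith [p₁.r_pos]))
  have e3 : ∀ᶠ q : ℝ × ℝ in 𝓝 (x₀, y₀), q.2 ∈ Ioo (y₀ - r₂) (y₀ + r₂) :=
    continuous_snd.continuousAt.eventually
      (Ioo_mem_nhds (by linarith [p₂.r_pos]) (by linarith [p₂.r_pos]))
  filter_upwards [e1, e2, e3] with q q1 q2 q3
  have hle : ∀ x' ≥ a, g x' q.2 < g q.1 q.2 ∨
      g x' q.2 ≤ max (g (φ₁ q.2) q.2) (g (φ₂ q.2) q.2) := fun x' hx' => by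
    by_cases hU : x' ∈ Ioo (x₁ - ρ₁) (x₁ + ρ₁) ∪ Ioo (x₂ - ρ₂) (x₂ + ρ₂)
    · right
      rcases hU with hU | hU
      · exact (p₁.le_max _ q2 x' (Ioo_subset_Icc_self hU)).trans (le_max_left _ _)
      · exact (p₂.le_max _ q3 x' (Ioo_subset_Icc_self hU)).trans (le_max_right _ _)
    · exact Or.inl (q1 x' hx' hU)
  refine ⟨?_, fun hm x' hx' => ?_, fun hm x' hx' => ?_⟩
  · rcases max_choice (g (φ₁ q.2) q.2) (g (φ₂ q.2) q.2) with h' | h'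
    · exact ⟨φ₁ q.2, ha₁.trans (p₁.mem _ q2).1.le, h'.symm⟩
    · exact ⟨φ₂ q.2, ha₂.trans (p₂.mem _ q3).1.le, h'.symm⟩
  · exact (hle x' hx').elim le_of_lt fun h' => h'.trans hm
  · exact (hle x' hx').elim id fun h' => h'.trans_lt hm

end SlopeData

/-! ### Noncritical and nondegenerate contact points. -/

theorem HasDerivAt.exists_sign {k : ℝ → ℝ} {d x₀ : ℝ} (hk : HasDerivAt k d x₀) (h0 : k x₀ = 0)
    (hd : 0 < d) :
    ∃ δ > 0, ∀ x ∈ Ioo (x₀ - δ) (x₀ + δ), (x₀ < x → 0 < k x) ∧ (x < x₀ → k x < 0) := by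
  have h1 := (hasDerivAt_iff_tendsto_slope.1 hk).eventually_const_lt hd
  rw [eventually_nhdsWithin_iff] at h1
  obtain ⟨δ, hδ, hb⟩ := Metric.eventually_nhds_iff.1 h1
  refine ⟨δ, hδ, fun x hx => ?_⟩
  have hd : dist x x₀ < δ := by
    rw [Real.dist_eq, abs_lt]; constructor <;> linarith [hx.1, hx.2]
  have hs : ∀ hne : x ≠ x₀, 0 < k x / (x - x₀) := fun hne => by
    have := hb hd hne
    rwa [slope_def_field, h0, sub_zero] at this
  constructor
  · intro h
    have := hs h.ne'
    rwa [div_pos_iff_of_pos_right (by linarith)] at this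
  · intro h
    rcases div_pos_iff.1 (hs h.ne) with ⟨-, h'⟩ | ⟨h', -⟩
    · linarith
    · exact h'

namespace SlopeData

variable {g gy h h1 h2 h11 : ℝ → ℝ → ℝ} {S : Set Plane} {x₀ y₀ : ℝ}

theorem not_pos_of_max_right (H : SlopeData g gy h h1 h2 h11) {δ x y : ℝ} (hδ : 0 < δ)
    (hpos : ∀ x' ∈ Ioo x (x + δ), 0 < h x' y) (hmax : ∀ x', x ≤ x' → g x' y ≤ g x y) : False := by
  have := H.strictMonoOn hpos (left_mem_Icc.2 (by linarith)) (right_mem_Icc.2 (by linarith))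
    (by linarith : x < x + δ)
  exact absurd this (not_lt.2 (hmax _ (by linarith)))

theorem nonpos_of_max_right (H : SlopeData g gy h h1 h2 h11) {x y : ℝ}
    (hmax : ∀ x', x ≤ x' → g x' y ≤ g x y) : h x y ≤ 0 := by
  by_contra hcon
  obtain ⟨δ, hδ, hs⟩ := ((H.dgx x y).sub_const (g x y)).exists_sign (sub_self _) (not_le.1 hcon)
  have := (hs (x + δ / 2) ⟨by linarith, by linarith⟩).1 (by linarith)
  linarith [hmax (x + δ / 2) (by linarith)]

theorem h1_nonpos_of_max_right (H : SlopeData g gy h h1 h2 h11) {x y : ℝ}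
    (hmax : ∀ x', x ≤ x' → g x' y ≤ g x y) (h0 : h x y = 0) : h1 x y ≤ 0 := by
  by_contra hcon
  obtain ⟨δ, hδ, hs⟩ := (H.dhx x y).exists_sign h0 (not_le.1 hcon)
  exact H.not_pos_of_max_right hδ (fun x' hx' => (hs x' ⟨by linarith [hx'.1], hx'.2⟩).1 hx'.1) hmax

/-- If h11 were positive, h would increase from 0 just to the right of x, and g would rise above its
value at x. -/
theorem h11_nonpos_of_max_right (H : SlopeData g gy h h1 h2 h11) {x y : ℝ}
    (hmax : ∀ x', x ≤ x' → g x' y ≤ g x y) (h0 : h x y = 0) (h10 : h1 x y = 0) :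
    h11 x y ≤ 0 := by
  by_contra hcon
  obtain ⟨δ, hδ, hs⟩ := (H.dh1x x y).exists_sign h10 (not_le.1 hcon)
  have hm : StrictMonoOn (fun x => h x y) (Icc x (x + δ)) :=
    strictMonoOn_of_deriv_pos (convex_Icc _ _)
      (fun x' _ => (H.dhx x' y).continuousAt.continuousWithinAt) fun x' hx' => by
        rw [interior_Icc] at hx'
        rw [(H.dhx x' y).deriv]; exact (hs x' ⟨by linarith [hx'.1], hx'.2⟩).1 hx'.1
  refine H.not_pos_of_max_right hδ (fun x' hx' => ?_) hmax
  rw [← h0]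
  exact hm (left_mem_Icc.2 (by linarith)) (Ioo_subset_Icc_self hx') hx'.1

/-- A maximum with room on its left is nondegenerate: if h = h1 = 0, then h11 ≤ 0 together with
`ne_cusp` gives h11 < 0, so h is negative just left of x and g would be larger there. All later
contacts of a contact point are therefore peaks. -/
theorem critical_of_max (H : SlopeData g gy h h1 h2 h11) {a x y : ℝ} (hax : a < x)
    (hmax : ∀ x', a ≤ x' → g x' y ≤ g x y) : h x y = 0 ∧ h1 x y < 0 := by
  have hmax' : ∀ x', x ≤ x' → g x' y ≤ g x y := fun x' hx' => hmax x' (hax.le.trans hx')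
  have hloc : IsLocalMax (fun x => g x y) x := by
    filter_upwards [lt_mem_nhds hax] with x' hx' using hmax x' hx'.le
  have h0 := hloc.hasDerivAt_eq_zero (H.dgx x y)
  refine ⟨h0, lt_of_le_of_ne (H.h1_nonpos_of_max_right hmax' h0) fun h10 => ?_⟩
  have hlt := lt_of_le_of_ne (H.h11_nonpos_of_max_right hmax' h0 h10) (H.ne_cusp x y h0 h10)
  obtain ⟨δ, hδ, hs⟩ := (H.dh1x x y).neg.exists_sign (k := fun x => -h1 x y) (by simp [h10])
    (neg_pos.2 hlt)
  set δ' := min δ (x - a)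
  have hδ' : 0 < δ' := lt_min hδ (by linarith)
  have hδδ : δ' ≤ δ := min_le_left _ _
  have hδa : δ' ≤ x - a := min_le_right _ _
  have hm : StrictMonoOn (fun x => h x y) (Icc (x - δ') x) :=
    strictMonoOn_of_deriv_pos (convex_Icc _ _)
      (fun x' _ => (H.dhx x' y).continuousAt.continuousWithinAt) fun x' hx' => by
        rw [interior_Icc] at hx'
        rw [(H.dhx x' y).deriv]
        have := (hs x' ⟨by linarith [hx'.1], by linarith [hx'.2]⟩).2 hx'.2
        linarith
  have hneg : ∀ x' ∈ Ioo (x - δ') x, h x' y < 0 := fun x' hx' => by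
    rw [← h0]; exact hm (Ioo_subset_Icc_self hx') (right_mem_Icc.2 (by linarith)) hx'.2
  have := H.strictAntiOn hneg (left_mem_Icc.2 (by linarith)) (right_mem_Icc.2 (by linarith))
    (by linarith : x - δ' < x)
  exact absurd this (not_lt.2 (hmax _ (by linarith)))

/-- Since ∂₁g = h is negative at the base point, the equation can be solved for x. -/
theorem exists_graph_of_eq (H : SlopeData g gy h h1 h2 h11) {r : ℝ} {M d : ℝ → ℝ}
    (hneg : h x₀ y₀ < 0) (hr : 0 < r) (hM : ∀ y ∈ Ioo (y₀ - r) (y₀ + r), HasDerivAt M (d y) y)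
    (hd : ContinuousOn d (Ioo (y₀ - r) (y₀ + r))) (h0 : M y₀ = g x₀ y₀) :
    ∃ δ > 0, ∃ ψ : ℝ → ℝ, ψ y₀ = x₀ ∧ ContDiffOn ℝ 1 ψ (Ioo (y₀ - δ) (y₀ + δ)) ∧
      ∀ᶠ q : ℝ × ℝ in 𝓝 (x₀, y₀), M q.2 = g q.1 q.2 ↔ q.1 = ψ q.2 := by
  have hy₀ : y₀ ∈ Ioo (y₀ - r) (y₀ + r) := ⟨by linarith, by linarith⟩
  obtain ⟨s, hs, ρ, hρ, ψ, ψ0, -, -, -, hkey, -, hC⟩ :=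
    exists_implicit_graph_local (F := fun y x => M y - g x y) (Fx := fun y x => d y - gy x y)
    (Fy := fun y x => -h x y) (x₀ := y₀) (y₀ := x₀) (O := Ioo (y₀ - r) (y₀ + r) ×ˢ univ)
    ((isOpen_Ioo.prod isOpen_univ).mem_nhds ⟨hy₀, trivial⟩)
    (fun p hp => (hM p.1 hp.1).sub (H.dgy p.2 p.1))
    (fun p _ => by simpa using (H.dgx p.2 p.1).const_sub (M p.1))
    ((hd.comp continuousOn_fst fun p hp => hp.1).sub (H.cgy.comp continuous_swap).continuousOn)
    (H.ch.comp continuous_swap).neg.continuousOn (by simp [h0]) (by simpa using hneg) zero_lt_one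
  refine ⟨ρ, hρ.1, ψ, ψ0, hC, ?_⟩
  have hbox : ∀ᶠ q : ℝ × ℝ in 𝓝 (x₀, y₀), q.1 ∈ Ioo (x₀ - s) (x₀ + s) ∧
      q.2 ∈ Ioo (y₀ - ρ) (y₀ + ρ) :=
    (isOpen_Ioo.prod isOpen_Ioo).mem_nhds
      ⟨⟨by linarith [hs.1], by linarith [hs.1]⟩, ⟨by linarith [hρ.1], by linarith [hρ.1]⟩⟩
  filter_upwards [hbox] with q hq
  rw [← (hkey q.2 hq.2 q.1 (Ioo_subset_Icc_self hq.1)).1, sub_eq_zero]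

/-- `M` may have a corner at y₀: the equation is solved on each side with a function differentiable
through y₀, and only the relevant half of each graph is kept. -/
theorem exists_param_of_eq_glued (H : SlopeData g gy h h1 h2 h11) {r r' : ℝ} {M M₁ M₂ d₁ d₂ : ℝ → ℝ}
    (hneg : h x₀ y₀ < 0) (hr : 0 < r) (hr' : 0 < r')
    (hM₁ : ∀ y ∈ Ioo (y₀ - r) (y₀ + r), HasDerivAt M₁ (d₁ y) y)
    (hd₁ : ContinuousOn d₁ (Ioo (y₀ - r) (y₀ + r))) (h0₁ : M₁ y₀ = g x₀ y₀)
    (hM₂ : ∀ y ∈ Ioo (y₀ - r') (y₀ + r'), HasDerivAt M₂ (d₂ y) y)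
    (hd₂ : ContinuousOn d₂ (Ioo (y₀ - r') (y₀ + r'))) (h0₂ : M₂ y₀ = g x₀ y₀)
    (hM : ∀ᶠ y in 𝓝 y₀, (y₀ ≤ y → M y = M₁ y) ∧ (y ≤ y₀ → M y = M₂ y))
    (hS : ∀ᶠ q : ℝ × ℝ in 𝓝 (x₀, y₀), pt q.1 q.2 ∈ S ↔ M q.2 = g q.1 q.2) :
    ∃ r₀ : ℝ, 0 < r₀ ∧ ∃ γ : ℝ → Plane,
      IsPiecewiseC1Param γ (S ∩ Metric.ball (pt x₀ y₀) r₀) (pt x₀ y₀) := by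
  obtain ⟨δ, hδ, φ, φ0, hφ, E⟩ := H.exists_graph_of_eq hneg hr hM₁ hd₁ h0₁
  obtain ⟨δ', hδ', χ, χ0, hχ, E'⟩ := H.exists_graph_of_eq hneg hr' hM₂ hd₂ h0₂
  refine exists_param_of_graphs_snd hδ hδ' φ0 χ0 hφ hχ ?_
  filter_upwards [hS, E, E', (continuous_snd.tendsto (x₀, y₀)).eventually hM] with q q1 q2 q3 q4
  rw [q1, ← q2, ← q3]
  rcases le_total y₀ q.2 with hy | hy
  · rw [q4.1 hy]
    refine ⟨fun h => Or.inl ⟨hy, h⟩, ?_⟩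
    rintro (h | h)
    · exact h.2
    · rw [← q4.1 hy, q4.2 h.1, h.2]
  · rw [q4.2 hy]
    refine ⟨fun h => Or.inr ⟨hy, h⟩, ?_⟩
    rintro (h | h)
    · rw [← q4.2 hy, q4.1 h.1, h.2]
    · exact h.2

theorem continuousOn_peak_deriv (H : SlopeData g gy h h1 h2 h11) {x₁ ρ r : ℝ} {φ : ℝ → ℝ}
    (p : IsPeak g gy h x₁ y₀ ρ r φ) :
    ContinuousOn (fun y => gy (φ y) y) (Ioo (y₀ - r) (y₀ + r)) :=
  H.cgy.comp_continuousOn (p.contDiffOn.continuousOn.prodMk continuousOn_id)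

/-- A contact point which is not critical. -/
theorem exists_param_of_neg (H : SlopeData g gy h h1 h2 h11)
    (hS : ∀ x y, pt x y ∈ S ↔ IsContact g h x y) (hz : IsContact g h x₀ y₀)
    (hneg : h x₀ y₀ < 0) :
    ∃ r₀ : ℝ, 0 < r₀ ∧ ∃ γ : ℝ → Plane,
      IsPiecewiseC1Param γ (S ∩ Metric.ball (pt x₀ y₀) r₀) (pt x₀ y₀) := by
  obtain ⟨hmax, hz | ⟨x₁, hx₁, hg₁⟩⟩ := hz
  · exact absurd hz hneg.ne
  have hcrit : ∀ x' > x₀, g x' y₀ = g x₀ y₀ → h x' y₀ = 0 ∧ h1 x' y₀ < 0 := fun x' hx' he =>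
    H.critical_of_max hx' fun x'' h'' => he ▸ hmax x'' h''
  obtain ⟨δ, hδ, hbox⟩ := Metric.eventually_nhds_iff.1
    (H.ch.continuousAt.eventually_lt_const hneg : ∀ᶠ q : ℝ × ℝ in 𝓝 (x₀, y₀), h q.1 q.2 < 0)
  have hbox' : ∀ x y, |x - x₀| < δ → |y - y₀| < δ → h x y < 0 := fun x y hx hy =>
    @hbox (x, y) (by rw [Prod.dist_eq]; exact max_lt hx hy)
  set a := x₀ + δ / 2 with ha
  have hanti : ∀ y, |y - y₀| < δ → StrictAntiOn (fun x => g x y) (Icc (x₀ - δ / 2) a) :=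
    fun y hy => H.strictAntiOn fun x hx => hbox' x y (by
      rw [abs_lt]; constructor <;> linarith [hx.1, hx.2]) hy
  have hgt : ∀ x' > x₀, g x' y₀ = g x₀ y₀ → a < x' := fun x' hx' he => by
    by_contra hcon
    exact (hanti y₀ (by simpa) ⟨by linarith, by linarith⟩ ⟨by linarith, not_lt.1 hcon⟩ hx').ne he
  -- `ne_triple` leaves at most two later contacts. If there is only one, it is listed twice, x₂ =
  -- x₁.
  obtain ⟨x₂, hx₂, hg₂, hT⟩ : ∃ x₂ > x₀, g x₂ y₀ = g x₀ y₀ ∧ ∀ x' > x₀, x' ≠ x₁ → x' ≠ x₂ →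
      g x' y₀ ≠ g x₀ y₀ := by
    by_cases hex : ∃ x₂ > x₀, x₂ ≠ x₁ ∧ g x₂ y₀ = g x₀ y₀
    · obtain ⟨x₂, hx₂, hne, hg₂⟩ := hex
      refine ⟨x₂, hx₂, hg₂, fun x' hx' n1 n2 he => ?_⟩
      exact H.ne_triple x₁ x₂ x' y₀ hne.symm n1.symm n2.symm (hcrit _ hx₁ hg₁).1 (hcrit _ hx₂ hg₂).1
        (hcrit _ hx' he).1 (hg₁.trans hg₂.symm) (hg₂.trans he.symm)
    · push Not at hex
      exact ⟨x₁, hx₁, hg₁, fun x' hx' n1 _ => hex x' hx' n1⟩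
  obtain ⟨c1, n1⟩ := hcrit _ hx₁ hg₁
  obtain ⟨c2, n2⟩ := hcrit _ hx₂ hg₂
  obtain ⟨ρ₁, hρ₁, r₁, φ₁, p₁⟩ := H.exists_isPeak c1 n1 (sub_pos.2 (hgt _ hx₁ hg₁))
  obtain ⟨ρ₂, hρ₂, r₂, φ₂, p₂⟩ := H.exists_isPeak c2 n2 (sub_pos.2 (hgt _ hx₂ hg₂))
  have far := H.far_max (x₀ := x₀) (a := a) p₁ p₂ (by linarith) (by linarith)
    (fun x' hx' e1 e2 => lt_of_le_of_ne (hmax x' (by linarith)) (hT x' (by linarith) e1 e2))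
  have near : ∀ᶠ q : ℝ × ℝ in 𝓝 (x₀, y₀), q ∈ Ioo (x₀ - δ / 2) a ×ˢ Ioo (y₀ - δ) (y₀ + δ) :=
    (isOpen_Ioo.prod isOpen_Ioo).mem_nhds ⟨⟨by linarith, by linarith⟩, ⟨by linarith, by linarith⟩⟩
  have hS' : ∀ᶠ q : ℝ × ℝ in 𝓝 (x₀, y₀), pt q.1 q.2 ∈ S ↔
      max (g (φ₁ q.2) q.2) (g (φ₂ q.2) q.2) = g q.1 q.2 := by
    filter_upwards [far, near] with q ⟨⟨x', hx', he⟩, f2, f3⟩ ⟨nx, ny⟩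
    rw [hS]
    have hy : |q.2 - y₀| < δ := by rw [abs_lt]; constructor <;> linarith [ny.1, ny.2]
    have hloc : ∀ x'', q.1 < x'' → x'' ≤ a → g x'' q.2 < g q.1 q.2 := fun x'' l1 l2 =>
      hanti _ hy ⟨nx.1.le, nx.2.le⟩ ⟨nx.1.le.trans l1.le, l2⟩ l1
    constructor
    · rintro ⟨hm, hc⟩
      refine le_antisymm (he ▸ hm x' (nx.2.le.trans hx')) (not_lt.1 fun hlt => ?_)
      rcases hc with hc | ⟨x'', hx'', he''⟩
      · exact (hbox' q.1 q.2 (by rw [abs_lt]; constructor <;> linarith [nx.1, nx.2]) hy).ne hc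
      · rcases le_total x'' a with h' | h'
        · exact (hloc x'' hx'' h').ne he''
        · exact (f3 hlt x'' h').ne he''
    · intro hm
      refine ⟨fun x'' hx'' => ?_, Or.inr ⟨x', nx.2.trans_le hx', he.trans hm⟩⟩
      rcases le_total x'' a with h' | h'
      · rcases hx''.eq_or_lt with rfl | h''
        · exact le_rfl
        · exact (hloc x'' h'' h').le
      · exact f2 hm.le x'' h'
  have m₁ : g (φ₁ y₀) y₀ = g x₀ y₀ := by rw [p₁.map, hg₁]
  have m₂ : g (φ₂ y₀) y₀ = g x₀ y₀ := by rw [p₂.map, hg₂]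
  have hy₁ : y₀ ∈ Ioo (y₀ - r₁) (y₀ + r₁) := ⟨by linarith [p₁.r_pos], by linarith [p₁.r_pos]⟩
  have hy₂ : y₀ ∈ Ioo (y₀ - r₂) (y₀ + r₂) := ⟨by linarith [p₂.r_pos], by linarith [p₂.r_pos]⟩
  have D₁ := p₁.hasDerivAt y₀ hy₁
  have D₂ := p₂.hasDerivAt y₀ hy₂
  rw [p₁.map] at D₁
  rw [p₂.map] at D₂
  by_cases h12 : x₁ = x₂
  · subst h12
    -- The two peaks were produced separately and may have different windows; near y₀ each maximizer
    -- lies in both windows, so the peak values agree.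
    have : ∀ᶠ y in 𝓝 y₀, g (φ₁ y) y = g (φ₂ y) y := by
      set ρ := min ρ₁ ρ₂
      have hρ : 0 < ρ := lt_min p₁.ρ_pos p₂.ρ_pos
      filter_upwards [Ioo_mem_nhds hy₁.1 hy₁.2, Ioo_mem_nhds hy₂.1 hy₂.2,
        (p₁.contDiffOn.continuousOn.continuousAt (Ioo_mem_nhds hy₁.1 hy₁.2)).eventually
          (Ioo_mem_nhds (a := x₁ - ρ) (b := x₁ + ρ) (by rw [p₁.map]; linarith)
            (by rw [p₁.map]; linarith)),
        (p₂.contDiffOn.continuousOn.continuousAt (Ioo_mem_nhds hy₂.1 hy₂.2)).eventually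
          (Ioo_mem_nhds (a := x₁ - ρ) (b := x₁ + ρ) (by rw [p₂.map]; linarith)
            (by rw [p₂.map]; linarith))] with y i1 i2 j1 j2
      have k1 : ρ ≤ ρ₁ := min_le_left _ _
      have k2 : ρ ≤ ρ₂ := min_le_right _ _
      exact le_antisymm (p₂.le_max y i2 _ ⟨by linarith [j1.1], by linarith [j1.2]⟩)
        (p₁.le_max y i1 _ ⟨by linarith [j2.1], by linarith [j2.2]⟩)
    refine H.exists_param_of_eq_glued
            (M := fun y => max (g (φ₁ y) y) (g (φ₂ y) y)) hneg p₁.r_pos p₁.r_pos p₁.hasDerivAt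
      (H.continuousOn_peak_deriv p₁) m₁ p₁.hasDerivAt (H.continuousOn_peak_deriv p₁) m₁ ?_ hS'
    filter_upwards [this] with y hy
    simp [hy]
  · have hne := H.ne_tangent x₁ x₂ y₀ h12 c1 c2 (hg₁.trans hg₂.symm)
    rcases lt_or_gt_of_ne hne with hlt | hlt
    · obtain ⟨ε, hε, hs⟩ := (D₂.sub D₁).exists_sign (by simp [m₁, m₂]) (sub_pos.2 hlt)
      refine H.exists_param_of_eq_glued
            (M := fun y => max (g (φ₁ y) y) (g (φ₂ y) y)) hneg p₂.r_pos p₁.r_pos p₂.hasDerivAt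
        (H.continuousOn_peak_deriv p₂) m₂ p₁.hasDerivAt (H.continuousOn_peak_deriv p₁) m₁ ?_ hS'
      filter_upwards [Ioo_mem_nhds (by linarith : y₀ - ε < y₀) (by linarith : y₀ < y₀ + ε)] with y hy
      have := hs y hy
      simp only [Pi.sub_apply, sub_pos, sub_neg] at this
      refine ⟨fun h' => max_eq_right ?_, fun h' => max_eq_left ?_⟩
      · rcases h'.eq_or_lt with rfl | h'
        · rw [m₁, m₂]
        · exact (this.1 h').le
      · rcases h'.eq_or_lt with rfl | h'
        · rw [m₁, m₂]
        · exact (this.2 h').le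
    · obtain ⟨ε, hε, hs⟩ := (D₁.sub D₂).exists_sign (by simp [m₁, m₂]) (sub_pos.2 hlt)
      refine H.exists_param_of_eq_glued
            (M := fun y => max (g (φ₁ y) y) (g (φ₂ y) y)) hneg p₁.r_pos p₂.r_pos p₁.hasDerivAt
        (H.continuousOn_peak_deriv p₁) m₁ p₂.hasDerivAt (H.continuousOn_peak_deriv p₂) m₂ ?_ hS'
      filter_upwards [Ioo_mem_nhds (by linarith : y₀ - ε < y₀) (by linarith : y₀ < y₀ + ε)] with y hy
      have := hs y hy
      simp only [Pi.sub_apply, sub_pos, sub_neg] at this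
      refine ⟨fun h' => max_eq_left ?_, fun h' => max_eq_right ?_⟩
      · rcases h'.eq_or_lt with rfl | h'
        · rw [m₁, m₂]
        · exact (this.1 h').le
      · rcases h'.eq_or_lt with rfl | h'
        · rw [m₁, m₂]
        · exact (this.2 h').le

/-- A contact point which is a nondegenerate critical point. -/
theorem exists_param_of_peak (H : SlopeData g gy h h1 h2 h11)
    (hS : ∀ x y, pt x y ∈ S ↔ IsContact g h x y) (hz : IsContact g h x₀ y₀)
    (h0 : h x₀ y₀ = 0) (hneg : h1 x₀ y₀ < 0) :
    ∃ r₀ : ℝ, 0 < r₀ ∧ ∃ γ : ℝ → Plane,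
      IsPiecewiseC1Param γ (S ∩ Metric.ball (pt x₀ y₀) r₀) (pt x₀ y₀) := by
  have hmax := hz.1
  obtain ⟨ρ, -, r, φ, p⟩ := H.exists_isPeak h0 hneg zero_lt_one
  set b := x₀ + ρ with hb
  have hρ := p.ρ_pos
  have hr := p.r_pos
  have hy₀ : y₀ ∈ Ioo (y₀ - r) (y₀ + r) := ⟨by linarith, by linarith⟩
  have hgt : ∀ x' > x₀, g x' y₀ = g x₀ y₀ → b < x' := fun x' hx' he => by
    by_contra hcon
    have := p.anti y₀ hy₀ ⟨le_rfl, by rw [p.map]; linarith⟩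
      ⟨by rw [p.map]; exact hx'.le, not_lt.1 hcon⟩ (by rw [p.map]; exact hx' : φ y₀ < x')
    simp only [p.map] at this
    exact this.ne he
  have near : ∀ᶠ q : ℝ × ℝ in 𝓝 (x₀, y₀), q ∈ Ioo (x₀ - ρ) b ×ˢ Ioo (y₀ - r) (y₀ + r) :=
    (isOpen_Ioo.prod isOpen_Ioo).mem_nhds ⟨⟨by linarith, by linarith⟩, hy₀⟩
  by_cases hT : ∃ x₁ > x₀, g x₁ y₀ = g x₀ y₀
  · obtain ⟨x₁, hx₁, hg₁⟩ := hT
    obtain ⟨c1, n1⟩ := H.critical_of_max hx₁ fun x'' h'' => hg₁ ▸ hmax x'' h''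
    obtain ⟨ρ₁, hρ₁, r₁, φ₁, p₁⟩ := H.exists_isPeak c1 n1 (sub_pos.2 (hgt _ hx₁ hg₁))
    have hr₁ := p₁.r_pos
    have hy₁ : y₀ ∈ Ioo (y₀ - r₁) (y₀ + r₁) := ⟨by linarith, by linarith⟩
    have far := H.far_max (x₀ := x₀) (a := b) p₁ p₁ (by linarith) (by linarith)
      (fun x' hx' e1 _ => lt_of_le_of_ne (hmax x' (by linarith)) fun he =>
        H.ne_triple x₀ x₁ x' y₀ hx₁.ne (by linarith) e1.symm h0 c1
          (H.critical_of_max (a := x₀) (by linarith) fun x'' h'' => he ▸ hmax x'' h'').1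
          hg₁.symm (hg₁.trans he.symm))
    simp only [max_self] at far
    -- Two kinds of nearby contact points: points of the critical curve at least as high as the far
    -- peak, and points on the descending side of the local peak at exactly the height of the far
    -- one.
    have hS' : ∀ᶠ q : ℝ × ℝ in 𝓝 (x₀, y₀), pt q.1 q.2 ∈ S ↔
        (q.1 = φ q.2 ∧ g (φ₁ q.2) q.2 ≤ g (φ q.2) q.2) ∨
        (φ q.2 ≤ q.1 ∧ g (φ₁ q.2) q.2 = g q.1 q.2) := by
      filter_upwards [far, near] with q ⟨⟨x', hx', he⟩, f2, f3⟩ ⟨nx, ny⟩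
      rw [hS]
      have nx' := Ioo_subset_Icc_self nx
      have hloc : φ q.2 ≤ q.1 → ∀ x'', q.1 < x'' → x'' ≤ b → g x'' q.2 < g q.1 q.2 :=
        fun l0 x'' l1 l2 => p.anti _ ny ⟨l0, nx.2.le⟩ ⟨l0.trans l1.le, l2⟩ l1
      constructor
      · rintro ⟨hm, hc⟩
        have hφ : φ q.2 ≤ q.1 := not_lt.1 fun hlt =>
          absurd ((p.pos_iff _ ny _ nx').2 hlt) (not_lt.2 (H.nonpos_of_max_right hm))
        have hMle : g (φ₁ q.2) q.2 ≤ g q.1 q.2 := he ▸ hm x' (nx.2.le.trans hx')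
        rcases hc with hc | ⟨x'', hx'', he''⟩
        · left
          have := (p.eq_iff _ ny _ nx').1 hc
          exact ⟨this, this ▸ hMle⟩
        · right
          refine ⟨hφ, le_antisymm hMle (not_lt.1 fun hlt => ?_)⟩
          rcases le_total x'' b with h' | h'
          · exact (hloc hφ x'' hx'' h').ne he''
          · exact (f3 hlt x'' h').ne he''
      · intro hc
        have hφ : φ q.2 ≤ q.1 := by
          rcases hc with hc | hc
          · exact hc.1.ge
          · exact hc.1
        have hMle : g (φ₁ q.2) q.2 ≤ g q.1 q.2 := by
          rcases hc with hc | hc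
          · rw [hc.1]; exact hc.2
          · exact hc.2.le
        refine ⟨fun x'' hx'' => ?_, ?_⟩
        · rcases le_total x'' b with h' | h'
          · rcases hx''.eq_or_lt with rfl | h''
            · exact le_rfl
            · exact (hloc hφ x'' h'' h').le
          · exact f2 hMle x'' h'
        · rcases hc with hc | hc
          · exact Or.inl ((p.eq_iff _ ny _ nx').2 hc.1)
          · exact Or.inr ⟨x', nx.2.trans_le hx', he.trans hc.2⟩
    have D₀ := p.hasDerivAt y₀ hy₀
    have D₁ := p₁.hasDerivAt y₀ hy₁
    rw [p.map] at D₀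
    rw [p₁.map] at D₁
    have hne := H.ne_tangent x₀ x₁ y₀ hx₁.ne h0 c1 hg₁.symm
    -- σ is the side of y₀ on which the local peak rises above the far one; only that half of the
    -- critical curve belongs to the level set.
    obtain ⟨σ, hσ, hσd⟩ : ∃ σ : ℝ, σ * σ = 1 ∧ 0 < σ * (gy x₀ y₀ - gy x₁ y₀) := by
      rcases lt_or_gt_of_ne hne with hlt | hlt
      · exact ⟨-1, by norm_num, by linarith⟩
      · exact ⟨1, by norm_num, by linarith⟩
    have hσ' : σ = 1 ∨ σ = -1 := mul_self_eq_one_iff.1 hσ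
    obtain ⟨ε, hε, hs⟩ := ((D₀.sub D₁).const_mul σ).exists_sign
      (by simp [p.map, p₁.map, hg₁]) hσd
    obtain ⟨s, hs1, ρ', hρ', χ, χ0, -, -, -, hkey, hder, hC⟩ :=
      exists_implicit_graph_local (F := fun x y => -σ * (g (φ₁ y) y - g x y))
      (Fx := fun x y => σ * h x y) (Fy := fun x y => -σ * (gy (φ₁ y) y - gy x y))
      (x₀ := x₀) (y₀ := y₀) (O := univ ×ˢ Ioo (y₀ - r₁) (y₀ + r₁))
      ((isOpen_univ.prod isOpen_Ioo).mem_nhds ⟨trivial, hy₁⟩)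
      (fun q _ => (((H.dgx q.1 q.2).const_sub _).const_mul (-σ)).congr_deriv (by ring))
      (fun q hq => ((p₁.hasDerivAt q.2 hq.2).sub (H.dgy q.1 q.2)).const_mul (-σ))
      (H.ch.const_smul σ).continuousOn
      (((H.continuousOn_peak_deriv p₁).comp continuousOn_snd fun q hq => hq.2).sub
        H.cgy.continuousOn |>.const_smul (-σ))
      (by simp [p₁.map, hg₁]) (by rw [p₁.map]; linarith) zero_lt_one
    -- χ' vanishes at x₀ because h does, so x − φ(χ x) has derivative 1 there: along the graph of χ,
    -- being to the right of the critical curve amounts to x > x₀.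
    have hχd : HasDerivAt χ 0 x₀ := by
      have := hder x₀ ⟨by linarith [hρ'.1], by linarith [hρ'.1]⟩
      simpa [χ0, h0] using this
    have hφd : HasDerivAt φ (deriv φ y₀) (χ x₀) := by
      rw [χ0]
      exact ((p.contDiffOn.differentiableOn one_ne_zero).differentiableAt
        (Ioo_mem_nhds hy₀.1 hy₀.2)).hasDerivAt
    obtain ⟨κ, hκ, hk⟩ := ((hasDerivAt_id x₀).sub (hφd.comp x₀ hχd)).exists_sign
      (by simp [χ0, p.map]) (by simp)
    simp only [Pi.sub_apply, id, Function.comp_apply, sub_pos, sub_neg] at hk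
    set κ' := min κ ρ'
    have hκ' : 0 < κ' := lt_min hκ hρ'.1
    have hκκ : κ' ≤ κ := min_le_left _ _
    have hκρ : κ' ≤ ρ' := min_le_right _ _
    refine exists_param_of_graph_snd_fst hσ hr hκ' p.map χ0 p.contDiffOn (hC.mono ?_) ?_ ?_
    · exact Ioo_subset_Ioo (by linarith) (by linarith)
    · exact fun x hx => (hk x ⟨by linarith [hx.1], by linarith [hx.2]⟩).1 hx.1
    · have near2 : ∀ᶠ q : ℝ × ℝ in 𝓝 (x₀, y₀), q ∈ Ioo (x₀ - κ') (x₀ + κ') ×ˢ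
          (Ioo (y₀ - s) (y₀ + s) ∩ Ioo (y₀ - ε) (y₀ + ε)) :=
        (isOpen_Ioo.prod (isOpen_Ioo.inter isOpen_Ioo)).mem_nhds ⟨⟨by linarith, by linarith⟩,
          ⟨by linarith [hs1.1], by linarith [hs1.1]⟩, by linarith, by linarith⟩
      filter_upwards [hS', near2] with q q1 ⟨nx, ny, ny'⟩
      rw [q1]
      have k1 : g (φ₁ q.2) q.2 ≤ g (φ q.2) q.2 ↔ 0 ≤ σ * (q.2 - y₀) := by
        have := hs q.2 ny'
        simp only [Pi.sub_apply] at this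
        rcases lt_trichotomy q.2 y₀ with h' | h' | h'
        · have t := this.2 h'
          rcases hσ' with rfl | rfl
          · constructor <;> intro <;> linarith
          · constructor <;> intro <;> linarith
        · rw [h', p.map, p₁.map, hg₁]; simp
        · have t := this.1 h'
          rcases hσ' with rfl | rfl
          · constructor <;> intro <;> linarith
          · constructor <;> intro <;> linarith
      have k2 : g (φ₁ q.2) q.2 = g q.1 q.2 ↔ q.2 = χ q.1 := by
        rw [← (hkey q.1 ⟨by linarith [nx.1], by linarith [nx.2]⟩ q.2 (Ioo_subset_Icc_self ny)).1]
        rcases hσ' with rfl | rfl <;> constructor <;> intro <;> linarith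
      have k3 : φ (χ q.1) ≤ q.1 ↔ x₀ ≤ q.1 := by
        have := hk q.1 ⟨by linarith [nx.1], by linarith [nx.2]⟩
        rcases lt_trichotomy q.1 x₀ with h' | h' | h'
        · have t := this.2 h'
          constructor <;> intro <;> linarith
        · rw [h', χ0, p.map]
        · have t := this.1 h'
          constructor <;> intro <;> linarith
      rw [k1, k2, and_comm]
      refine or_congr Iff.rfl ⟨fun hh => ⟨k3.1 (hh.2 ▸ hh.1), hh.2⟩, fun hh => ⟨?_, hh.2⟩⟩
      rw [hh.2]; exact k3.2 hh.1
  · push Not at hT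
    -- Without a later contact, everything beyond the window stays strictly lower and the level set
    -- is the whole critical curve.
    have far := H.far_lt (x₀ := x₀) (y₀ := y₀) (a := b) isOpen_empty
      (fun x' hx' _ => lt_of_le_of_ne (hmax x' (by linarith)) (hT x' (by linarith)))
    refine exists_param_of_graphs_snd hr hr p.map p.map p.contDiffOn p.contDiffOn ?_
    filter_upwards [far, near] with q f ⟨nx, ny⟩
    rw [hS]
    have nx' := Ioo_subset_Icc_self nx
    have hloc : φ q.2 ≤ q.1 → ∀ x'', q.1 < x'' → g x'' q.2 < g q.1 q.2 := fun l0 x'' l1 => by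
      rcases le_total x'' b with l2 | l2
      · exact p.anti _ ny ⟨l0, nx.2.le⟩ ⟨l0.trans l1.le, l2⟩ l1
      · exact f x'' l2 (notMem_empty _)
    have key : IsContact g h q.1 q.2 ↔ q.1 = φ q.2 := by
      constructor
      · rintro ⟨hm, hc⟩
        have hφ : φ q.2 ≤ q.1 := not_lt.1 fun hlt =>
          absurd ((p.pos_iff _ ny _ nx').2 hlt) (not_lt.2 (H.nonpos_of_max_right hm))
        rcases hc with hc | ⟨x'', hx'', he''⟩
        · exact (p.eq_iff _ ny _ nx').1 hc
        · exact absurd he'' (hloc hφ x'' hx'').ne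
      · intro hc
        refine ⟨fun x'' hx'' => ?_, Or.inl ((p.eq_iff _ ny _ nx').2 hc)⟩
        rcases hx''.eq_or_lt with rfl | h''
        · exact le_rfl
        · exact (hloc hc.ge x'' h'').le
    rw [key]
    rcases le_total y₀ q.2 with hy | hy
    · exact ⟨fun hh => Or.inl ⟨hy, hh⟩, fun hh => hh.elim And.right And.right⟩
    · exact ⟨fun hh => Or.inr ⟨hy, hh⟩, fun hh => hh.elim And.right And.right⟩

end SlopeData

/-! ### Folds: degenerate critical contact points. -/

/-- A `C¹` function on an open interval whose derivative tends to `0` at the right endpoint extends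
to a function that is `C¹` up to that endpoint. -/
theorem contDiffOn_Ioc_of_tendsto {χ : ℝ → ℝ} {a x₀ : ℝ} (hC : ContDiffOn ℝ 1 χ (Ioo a x₀))
    (hχ : ContinuousWithinAt χ (Iio x₀) x₀) (hd : Tendsto (deriv χ) (𝓝[<] x₀) (𝓝 0)) :
    ContDiffOn ℝ 1 χ (Ioc a x₀) := by
  by_cases hax : a < x₀
  swap
  · rw [Ioc_eq_empty hax]; exact contDiffOn_empty
  have hdiff : ∀ x ∈ Ioo a x₀, HasDerivAt χ (deriv χ x) x := fun x hx =>
    ((hC.differentiableOn one_ne_zero).differentiableAt (Ioo_mem_nhds hx.1 hx.2)).hasDerivAt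
  have h0 : HasDerivWithinAt χ 0 (Iic x₀) x₀ :=
    hasDerivWithinAt_Iic_of_tendsto_deriv (s := Ioo a x₀) (hC.differentiableOn one_ne_zero)
      (hχ.mono fun x hx => hx.2) (Ioo_mem_nhdsLT hax) hd
  have hdc : ContinuousOn (deriv χ) (Ioo a x₀) :=
    hC.continuousOn_deriv_of_isOpen isOpen_Ioo le_rfl
  set D : ℝ → ℝ := Function.update (deriv χ) x₀ 0
  have hD : ∀ x ∈ Ioc a x₀, HasDerivWithinAt χ (D x) (Ioc a x₀) x := by
    intro x hx
    rcases hx.2.eq_or_lt with rfl | h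
    · simpa [D] using h0.mono Ioc_subset_Iic_self
    · simpa [D, h.ne] using (hdiff x ⟨hx.1, h⟩).hasDerivWithinAt
  rw [show (1 : WithTop ℕ∞) = 0 + 1 from rfl, contDiffOn_succ_iff_derivWithin (uniqueDiffOn_Ioc a x₀)]
  refine ⟨fun x hx => (hD x hx).differentiableWithinAt, by simp, ?_⟩
  rw [contDiffOn_zero]
  have hDc : ContinuousOn D (Ioc a x₀) := by
    intro x hx
    rcases hx.2.eq_or_lt with rfl | h
    · have : ContinuousWithinAt D (Iic x) x := by
        rw [← Iio_insert, continuousWithinAt_insert_self]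
        exact continuousWithinAt_update_same.2 (hd.mono_left (nhdsWithin_mono _ sdiff_subset))
      exact this.mono Ioc_subset_Iic_self
    · have : ContinuousAt D x :=
        (continuousAt_update_of_ne h.ne).2 (hdc.continuousAt (Ioo_mem_nhds hx.1 h))
      exact this.continuousWithinAt
  exact hDc.congr fun x hx => (hD x hx).derivWithin (uniqueDiffOn_Ioc a x₀ x hx)

namespace SlopeData

variable {g gy h h1 h2 h11 : ℝ → ℝ → ℝ} {S : Set Plane} {x₀ y₀ : ℝ}

/-- The reflection y ↦ −y changes the sign of h2, which allows h2 > 0 to be assumed at a fold. -/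
theorem reflect (H : SlopeData g gy h h1 h2 h11) :
    SlopeData (fun x y => g x (-y)) (fun x y => -gy x (-y)) (fun x y => h x (-y))
      (fun x y => h1 x (-y)) (fun x y => -h2 x (-y)) (fun x y => h11 x (-y)) := by
  have c : Continuous fun p : ℝ × ℝ => (p.1, -p.2) := by fun_prop
  have d : ∀ {F F' : ℝ → ℝ} (y : ℝ), HasDerivAt F (F' (-y)) (-y) →
      HasDerivAt (fun y => F (-y)) (-F' (-y)) y := fun y hF =>
    (HasDerivAt.comp y hF (hasDerivAt_neg y)).congr_deriv (by simp)
  exact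
  { cg := H.cg.comp c
    cgy := (H.cgy.comp c).neg
    ch := H.ch.comp c
    ch1 := H.ch1.comp c
    ch2 := (H.ch2.comp c).neg
    ch11 := H.ch11.comp c
    dgx := fun x y => H.dgx x (-y)
    dgy := fun x y => d y (H.dgy x (-y))
    dhx := fun x y => H.dhx x (-y)
    dhy := fun x y => d y (H.dhy x (-y))
    dgyx := fun x y => (H.dgyx x (-y)).neg
    dh1x := fun x y => H.dh1x x (-y)
    decay := fun K => by
      obtain ⟨c, hc, R, hR⟩ := H.decay K
      exact ⟨c, hc, R, fun x hx y hy => hR x hx (-y) (by rwa [abs_neg])⟩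
    ne_fold := fun x y e1 e2 => neg_ne_zero.2 (H.ne_fold x (-y) e1 e2)
    ne_cusp := fun x y => H.ne_cusp x (-y)
    ne_triple := fun x₁ x₂ x₃ y => H.ne_triple x₁ x₂ x₃ (-y)
    ne_tangent := fun x₁ x₂ y e1 e2 e3 e4 => fun e => H.ne_tangent x₁ x₂ (-y) e1 e2 e3 e4 (neg_inj.1 e)
    ne_double := fun x₁ x₂ y => H.ne_double x₁ x₂ (-y) }

/-- Near the fold h(·,y) is strictly concave, h(·,y₀) is negative except at x₀, and h increases with
y. Hence {h = 0} is a graph y = η(x) with minimum at x₀; for y slightly above y₀ it consists of a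
local minimum of g(·,y) left of x₀ and a local maximum right of x₀. The maxima, on the right half of
the graph, are contact points.

The minima are not. Left of x₀, a contact point has the height P(y) of the maximum of g(·,y) to the
right of x₀, and P(y) = g(x,y) has a solution y = χ(x) between y₀ and η(x). What remains delicate is
that χ is C¹ up to x₀. -/
theorem fold_aux (H : SlopeData g gy h h1 h2 h11) (h0 : h x₀ y₀ = 0) (h10 : h1 x₀ y₀ = 0)
    (h11neg : h11 x₀ y₀ < 0) (h2pos : 0 < h2 x₀ y₀) (hmax : ∀ x' > x₀, g x' y₀ < g x₀ y₀) :
    ∃ δ > 0, ∃ δ' > 0, ∃ φ χ : ℝ → ℝ, φ x₀ = y₀ ∧ χ x₀ = y₀ ∧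
      ContDiffOn ℝ 1 φ (Ico x₀ (x₀ + δ)) ∧ ContDiffOn ℝ 1 χ (Ioc (x₀ - δ') x₀) ∧
      ∀ᶠ q : ℝ × ℝ in 𝓝 (x₀, y₀), IsContact g h q.1 q.2 ↔
        (x₀ ≤ q.1 ∧ q.2 = φ q.1) ∨ (q.1 ≤ x₀ ∧ q.2 = χ q.1) := by
  set c := h2 x₀ y₀ / 2 with hc
  set C := 2 * h2 x₀ y₀ with hC
  have hcpos : 0 < c := by positivity
  have o1 : ∀ᶠ q : ℝ × ℝ in 𝓝 (x₀, y₀), h11 q.1 q.2 < 0 :=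
    H.ch11.continuousAt.eventually_lt_const h11neg
  have o2 : ∀ᶠ q : ℝ × ℝ in 𝓝 (x₀, y₀), c < h2 q.1 q.2 :=
    H.ch2.continuousAt.eventually_const_lt (show c < h2 x₀ y₀ by linarith)
  have o3 : ∀ᶠ q : ℝ × ℝ in 𝓝 (x₀, y₀), h2 q.1 q.2 < C :=
    H.ch2.continuousAt.eventually_lt_const (show h2 x₀ y₀ < C by linarith)
  have hO : {q : ℝ × ℝ | h11 q.1 q.2 < 0 ∧ c < h2 q.1 q.2 ∧ h2 q.1 q.2 < C} ∈ 𝓝 (x₀, y₀) :=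
    o1.and (o2.and o3)
  obtain ⟨r, hr, ρ, hρ, η, η0, hsub, -, hηm, hkey, hηd, hηC⟩ :=
    exists_implicit_graph_local (F := h) hO (fun q _ => H.dhx q.1 q.2) (fun q _ => H.dhy q.1 q.2)
      H.ch1.continuousOn H.ch2.continuousOn h0 h2pos zero_lt_one
  have hr := hr.1
  have hρ := hρ.1
  set I := Ioo (x₀ - ρ) (x₀ + ρ) with hI
  have hx₀ : x₀ ∈ I := ⟨by linarith, by linarith⟩
  have hy₀ : y₀ ∈ Icc (y₀ - r) (y₀ + r) := ⟨by linarith, by linarith⟩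
  have B : ∀ x ∈ I, ∀ y ∈ Icc (y₀ - r) (y₀ + r), h11 x y < 0 ∧ c < h2 x y ∧ h2 x y < C :=
    fun x hx y hy => hsub (mk_mem_prod hx hy)
  -- strict concavity of `h` in `x`
  have hconc : ∀ y ∈ Icc (y₀ - r) (y₀ + r), ∀ x₁ ∈ I, ∀ x₃ ∈ I, ∀ x₂, x₁ < x₂ → x₂ < x₃ →
      min (h x₁ y) (h x₃ y) < h x₂ y := by
    intro y hy x₁ m1 x₃ m3 x₂ l1 l2
    have hanti : StrictAntiOn (fun x => h1 x y) I :=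
      strictAntiOn_of_deriv_neg (convex_Ioo _ _)
        (fun x _ => (H.dh1x x y).continuousAt.continuousWithinAt) fun x hx => by
          rw [(H.dh1x x y).deriv]; exact (B x (interior_subset hx) y hy).1
    have hsc : StrictConcaveOn ℝ I (fun x => h x y) := by
      refine StrictAntiOn.strictConcaveOn_of_deriv (convex_Ioo _ _)
        (fun x _ => (H.dhx x y).continuousAt.continuousWithinAt) ?_
      rw [interior_Ioo]
      exact hanti.congr fun x _ => (H.dhx x y).deriv.symm
    refine hsc.lt_on_openSegment m1 m3 (l1.trans l2).ne ?_
    rw [openSegment_eq_Ioo (l1.trans l2)]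
    exact ⟨l1, l2⟩
  have hneg₀ : ∀ x ∈ I, x ≠ x₀ → h x y₀ < 0 := by
    intro x hx hne
    have hanti : StrictAntiOn (fun x => h1 x y₀) I :=
      strictAntiOn_of_deriv_neg (convex_Ioo _ _)
        (fun x _ => (H.dh1x x y₀).continuousAt.continuousWithinAt) fun x hx => by
          rw [(H.dh1x x y₀).deriv]; exact (B x (interior_subset hx) y₀ hy₀).1
    rcases lt_or_gt_of_ne hne with hl | hl
    · have : StrictMonoOn (fun x => h x y₀) (Icc x x₀) :=
        strictMonoOn_of_deriv_pos (convex_Icc _ _)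
          (fun x' _ => (H.dhx x' y₀).continuousAt.continuousWithinAt) fun x' hx' => by
            rw [interior_Icc] at hx'
            rw [(H.dhx x' y₀).deriv, ← h10]
            exact hanti ⟨hx.1.trans hx'.1, hx'.2.trans hx₀.2⟩ hx₀ hx'.2
      rw [← h0]
      exact this (left_mem_Icc.2 hl.le) (right_mem_Icc.2 hl.le) hl
    · have : StrictAntiOn (fun x => h x y₀) (Icc x₀ x) :=
        strictAntiOn_of_deriv_neg (convex_Icc _ _)
          (fun x' _ => (H.dhx x' y₀).continuousAt.continuousWithinAt) fun x' hx' => by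
            rw [interior_Icc] at hx'
            rw [(H.dhx x' y₀).deriv, ← h10]
            exact hanti hx₀ ⟨hx₀.1.trans hx'.1, hx'.2.trans hx.2⟩ hx'.1
      rw [← h0]
      exact this (left_mem_Icc.2 hl.le) (right_mem_Icc.2 hl.le) hl
  have hη : ∀ x ∈ I, x ≠ x₀ → y₀ < η x := fun x hx hne =>
    ((hkey x hx y₀ hy₀).2).1 (hneg₀ x hx hne)
  have hlt : ∀ x ∈ I, ∀ y ∈ Icc (y₀ - r) (y₀ + r), h x y < 0 ↔ y < η x := fun x hx y hy =>
    (hkey x hx y hy).2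
  have hgt : ∀ x ∈ I, ∀ y ∈ Icc (y₀ - r) (y₀ + r), 0 < h x y ↔ η x < y := fun x hx y hy => by
    have k := hkey x hx y hy
    constructor
    · intro hp
      rcases lt_trichotomy y (η x) with t | t | t
      · exact absurd (k.2.2 t) (by linarith)
      · exact absurd (k.1.2 t) hp.ne'
      · exact t
    · intro hp
      rcases lt_trichotomy (h x y) 0 with t | t | t
      · exact absurd (k.2.1 t) (by linarith)
      · exact absurd (k.1.1 t) hp.ne'
      · exact t
  -- the right end of the local interval
  set b := x₀ + ρ / 2 with hb
  have hbI : b ∈ I := ⟨by linarith, by linarith⟩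
  have hIcc : ∀ x, x₀ - ρ < x → x ≤ b → x ∈ I := fun x l1 l2 => ⟨l1, by linarith⟩
  have hby : ∀ᶠ y in 𝓝 y₀, h b y < 0 :=
    (H.dhy b y₀).continuousAt.eventually_lt_const (hneg₀ b hbI (by linarith))
  obtain ⟨s₀, hs₀, hbs₀⟩ := Metric.eventually_nhds_iff.1 hby
  set s := min s₀ r with hs
  have hspos : 0 < s := lt_min hs₀ hr
  have hsr : s ≤ r := min_le_right _ _
  have hJ : ∀ y ∈ Ioo (y₀ - s) (y₀ + s), y ∈ Icc (y₀ - r) (y₀ + r) ∧ h b y < 0 := fun y hy =>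
    ⟨⟨by linarith [hy.1], by linarith [hy.2]⟩, hbs₀ (by
      rw [Real.dist_eq, abs_lt]
      have := min_le_left s₀ r
      constructor <;> linarith [hy.1, hy.2])⟩
  -- α(y) is the maximizer of g(·,y) on [x₀, b]: it is x₀ for y ≤ y₀, where h < 0 on the right, and
  -- otherwise the zero of h between h(x₀,y) > 0 and h(b,y) < 0. Concavity gives the signs around
  -- this zero.
  have exα : ∀ y ∈ Ioo (y₀ - s) (y₀ + s), ∃ α ∈ Icc x₀ b, (∀ x ∈ Ioo x₀ α, 0 < h x y) ∧
      ∀ x ∈ Ioo α b, h x y < 0 := by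
    intro y hy
    obtain ⟨hyr, hyb⟩ := hJ y hy
    rcases le_or_gt y y₀ with hle | hl
    · refine ⟨x₀, ⟨le_rfl, by linarith⟩, by simp, fun x hx => ?_⟩
      have hxI := hIcc x (by linarith [hx.1]) hx.2.le
      exact (hlt x hxI y hyr).2 (hle.trans_lt (hη x hxI hx.1.ne'))
    · have hp : 0 < h x₀ y := (hgt x₀ hx₀ y hyr).2 (η0 ▸ hl)
      obtain ⟨α, hα, hα0⟩ := intermediate_value_Icc' (by linarith : x₀ ≤ b)
        (fun x _ => (H.dhx x y).continuousAt.continuousWithinAt) (⟨hyb.le, hp.le⟩ :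
          (0 : ℝ) ∈ Icc (h b y) (h x₀ y))
      have hαI := hIcc α (by linarith [hα.1]) hα.2
      simp only at hα0
      refine ⟨α, hα, fun x hx => ?_, fun x hx => ?_⟩
      · have := hconc y hyr x₀ hx₀ α hαI x hx.1 hx.2
        rwa [hα0, min_eq_right hp.le] at this
      · have hα1 : x₀ < α := lt_of_le_of_ne hα.1 fun e => by rw [← e] at hα0; linarith
        by_contra hcon
        have := hconc y hyr x₀ hx₀ x (hIcc x (by linarith [hx.1]) hx.2.le) α hα1 hx.1
        rw [hα0] at this
        exact absurd this (not_lt.2 (le_min hp.le (not_lt.1 hcon)))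
  choose! α hαm hαpos hαneg using exα
  have hαmax : ∀ y ∈ Ioo (y₀ - s) (y₀ + s), ∀ x ∈ Icc x₀ b, x ≠ α y → g x y < g (α y) y := by
    intro y hy x hx hne
    have hm := hαm y hy
    rcases lt_or_gt_of_ne hne with hl | hl
    · exact H.strictMonoOn (hαpos y hy) ⟨hx.1, hl.le⟩ ⟨hm.1, le_rfl⟩ hl
    · exact H.strictAntiOn (hαneg y hy) ⟨le_rfl, hm.2⟩ ⟨hl.le, hx.2⟩ hl
  have hαle : ∀ y ∈ Ioo (y₀ - s) (y₀ + s), ∀ x ∈ Icc x₀ b, g x y ≤ g (α y) y := fun y hy x hx => by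
    by_cases e : x = α y
    · rw [e]
    · exact (hαmax y hy x hx e).le
  have hys : y₀ ∈ Ioo (y₀ - s) (y₀ + s) := ⟨by linarith, by linarith⟩
  have hα0 : α y₀ = x₀ := by
    by_contra hne
    have hl : x₀ < α y₀ := lt_of_le_of_ne (hαm y₀ hys).1 (Ne.symm hne)
    have hm := (hαm y₀ hys).2
    have := hαpos y₀ hys ((x₀ + α y₀) / 2) ⟨by linarith, by linarith⟩
    exact absurd this (not_lt.2 (hneg₀ _ (hIcc _ (by linarith) (by linarith)) (by linarith)).le)
  obtain ⟨hαc, hPd⟩ := hasDerivAt_max_of_unique H.cg H.cgy H.dgy isOpen_Ioo hαm hαmax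
  -- the left branch
  set d := y₀ + s / 2 with hd
  have hηcont : ContinuousAt η x₀ := (hηd x₀ hx₀).continuousAt
  obtain ⟨δ₀, hδ₀, hbδ₀⟩ := Metric.eventually_nhds_iff.1
    (hηcont.eventually_lt_const (show η x₀ < d by rw [η0]; linarith))
  set δ := min δ₀ (ρ / 2) with hδ
  have hδpos : 0 < δ := lt_min hδ₀ (by linarith)
  have hδρ : δ ≤ ρ / 2 := min_le_right _ _
  have hηδ : ∀ x ∈ Ioo (x₀ - δ) x₀, x ∈ I ∧ y₀ < η x ∧ η x < d := fun x hx => by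
    have hxI : x ∈ I := ⟨by linarith [hx.1], by linarith [hx.2]⟩
    refine ⟨hxI, hη x hxI hx.2.ne, hbδ₀ ?_⟩
    rw [Real.dist_eq, abs_lt]
    have := min_le_left δ₀ (ρ / 2)
    constructor <;> linarith [hx.1, hx.2]
  have hyd : ∀ y ∈ Icc y₀ d, y ∈ Ioo (y₀ - s) (y₀ + s) := fun y hy =>
    ⟨by linarith [hy.1], by linarith [hy.2]⟩
  have hyr : ∀ y ∈ Icc y₀ d, y ∈ Icc (y₀ - r) (y₀ + r) := fun y hy => (hJ y (hyd y hy)).1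
  -- ∂₁∂₂g ≥ c is integrated from x to α(y) ≥ x₀. This makes P(y) − g(x,y) increasing in y, and the
  -- explicit lower bound is used again to estimate χ'.
  have hgap : ∀ x ∈ Ioo (x₀ - δ) x₀, ∀ y ∈ Icc y₀ d,
      c * (x₀ - x) ≤ gy (α y) y - gy x y := by
    intro x hx y hy
    have hm := hαm y (hyd y hy)
    have := (convex_Icc x (α y)).mul_sub_le_image_sub_of_le_deriv (f := fun x => gy x y)
      (fun x' _ => (H.dgyx x' y).continuousAt.continuousWithinAt)
      (fun x' _ => (H.dgyx x' y).differentiableAt.differentiableWithinAt) (C := c)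
      (fun x' hx' => by
        rw [interior_Icc] at hx'
        rw [(H.dgyx x' y).deriv]
        exact (B x' (hIcc x' (by linarith [hx.1, hx'.1]) (hx'.2.le.trans hm.2)) y (hyr y hy)).2.1.le)
      x ⟨le_rfl, hx.2.le.trans hm.1⟩ (α y) ⟨hx.2.le.trans hm.1, le_rfl⟩ (hx.2.le.trans hm.1)
    have h3 : c * (x₀ - x) ≤ c * (α y - x) := by gcongr; exact hm.1
    exact h3.trans this
  -- On or above the curve η, concavity makes h positive between x and x₀, so g(x,y) is below P(y).
  -- This provides the sign on the side y = d and later forces χ < η.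
  have hincr : ∀ x ∈ Ioo (x₀ - δ) x₀, ∀ y ∈ Icc y₀ d, y₀ < y → η x ≤ y → g x y < g (α y) y := by
    intro x hx y hy hl hle
    have hxI := (hηδ x hx).1
    have hp : 0 < h x₀ y := (hgt x₀ hx₀ y (hyr y hy)).2 (η0 ▸ hl)
    have hq : 0 ≤ h x y := not_lt.1 fun hh => absurd ((hlt x hxI y (hyr y hy)).1 hh) (not_lt.2 hle)
    have : g x y < g x₀ y := H.strictMonoOn (a := x) (b := x₀) (fun x' hx' =>
      (le_min hq hp.le).trans_lt (hconc y (hyr y hy) x hxI x₀ hx₀ x' hx'.1 hx'.2))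
      (left_mem_Icc.2 hx.2.le) (right_mem_Icc.2 hx.2.le) hx.2
    exact this.trans_le (hαle y (hyd y hy) x₀ ⟨le_rfl, by linarith⟩)
  have hd0 : y₀ < d := by linarith
  obtain ⟨χ, hχm, hχk, hχd, hχC⟩ := exists_implicit_graph (a := x₀ - δ) (b := x₀) (c := y₀) (d := d)
    (F := fun x y => g (α y) y - g x y) (Fx := fun x y => -h x y)
    (Fy := fun x y => gy (α y) y - gy x y) hd0
    (fun x _ y _ => (H.dgx x y).const_sub _)
    (fun x _ y hy => (hPd y (hyd y hy)).sub (H.dgy x y)) H.ch.neg.continuousOn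
    (((H.cgy.comp_continuousOn (f := fun q : ℝ × ℝ => (α q.2, q.2)) fun q hq =>
      (((hαc q.2 (hyd q.2 hq.2)).comp continuousAt_snd).prodMk
        continuousAt_snd).continuousWithinAt)).sub H.cgy.continuousOn)
    (fun x hx y hy => lt_of_lt_of_le (mul_pos hcpos (by linarith [hx.2])) (hgap x hx y hy))
    (fun x hx => by
      have : g x₀ y₀ < g x y₀ := H.strictAntiOn (a := x) (b := x₀) (fun x' hx' =>
        hneg₀ x' ⟨by linarith [hx.1, hx'.1], by linarith [hx'.2]⟩ hx'.2.ne)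
        (left_mem_Icc.2 hx.2.le) (right_mem_Icc.2 hx.2.le) hx.2
      rw [hα0]; linarith)
    (fun x hx => sub_pos.2 (hincr x hx d ⟨hd0.le, le_rfl⟩ hd0 (hηδ x hx).2.2.le))
  have hχη : ∀ x ∈ Ioo (x₀ - δ) x₀, χ x < η x := by
    intro x hx
    obtain ⟨-, l1, l2⟩ := hηδ x hx
    have hm : η x ∈ Icc y₀ d := ⟨l1.le, l2.le⟩
    have hpos := hincr x hx (η x) hm l1 le_rfl
    have k := hχk x hx (η x) hm
    rcases lt_trichotomy (η x) (χ x) with t | t | t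
    · linarith [k.2.2 t]
    · linarith [k.1.2 t]
    · exact t
  -- η'(x₀) = −h1/h2 = 0 at the fold.
  have hηslope : Tendsto (fun x => (η x - y₀) / (x₀ - x)) (𝓝[<] x₀) (𝓝 0) := by
    have h' : HasDerivAt η 0 x₀ := by simpa [η0, h10] using hηd x₀ hx₀
    have := (hasDerivAt_iff_tendsto_slope.1 h').mono_left
      (nhdsWithin_mono x₀ (fun x (hx : x < x₀) => hx.ne : Iio x₀ ⊆ {x₀}ᶜ))
    rw [← neg_zero]
    refine this.neg.congr fun x => ?_
    rw [slope_def_field, η0, ← div_neg, neg_sub]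
  have hIoo : Ioo (x₀ - δ) x₀ ∈ 𝓝[<] x₀ := Ioo_mem_nhdsLT (by linarith)
  -- χ is only determined on the open interval; its value at x₀ is imposed by the squeeze y₀ ≤ χ ≤
  -- η.
  set χ' := Function.update χ x₀ y₀ with hχ'
  have eqχ : ∀ x, x < x₀ → χ' x = χ x := fun x hx => Function.update_of_ne hx.ne _ _
  have evχ : ∀ x, x < x₀ → χ' =ᶠ[𝓝 x] χ := fun x hx => by
    filter_upwards [gt_mem_nhds hx] with x' hx' using eqχ x' hx'
  have hχC' : ContDiffOn ℝ 1 χ' (Ioc (x₀ - δ) x₀) := by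
    refine contDiffOn_Ioc_of_tendsto (hχC.congr fun x hx => eqχ x hx.2) ?_ ?_
    · have : Tendsto χ' (𝓝[<] x₀) (𝓝 y₀) := by
        refine tendsto_of_tendsto_of_tendsto_of_le_of_le' tendsto_const_nhds
          (by
          have := hηcont.continuousWithinAt (s := Iio x₀)
          rwa [ContinuousWithinAt, η0] at this) ?_ ?_
        · filter_upwards [hIoo] with x hx
          rw [eqχ x hx.2]; exact (hχm x hx).1.le
        · filter_upwards [hIoo] with x hx
          rw [eqχ x hx.2]; exact (hχη x hx).le
      rw [ContinuousWithinAt, hχ', Function.update_self]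
      exact this
    -- |χ'| is −h(x,χ) divided by ∂₂g(α,χ) − ∂₂g(x,χ). As h(x,η) = 0 and ∂₂h ≤ C, the numerator is
    -- at most C(η − y₀); the denominator is at least c(x₀ − x); and η − y₀ = o(x₀ − x).
    · have hlim : Tendsto (fun x => C / c * ((η x - y₀) / (x₀ - x))) (𝓝[<] x₀) (𝓝 0) := by
        simpa using hηslope.const_mul (C / c)
      refine squeeze_zero_norm' ?_ hlim
      filter_upwards [hIoo] with x hx
      have hm := Ioo_subset_Icc_self (hχm x hx)
      obtain ⟨hxI, l1, l2⟩ := hηδ x hx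
      rw [(evχ x hx.2).deriv_eq, (hχd x hx).deriv, neg_neg]
      have g1 := hgap x hx _ hm
      have hx0 : 0 < x₀ - x := by linarith [hx.2]
      have g0 : 0 < c * (x₀ - x) := mul_pos hcpos hx0
      have hη0 : h x (η x) = 0 := (hkey x hxI _ (Ioo_subset_Icc_self (hηm x hxI))).1.2 rfl
      have hneg : h x (χ x) < 0 := (hlt x hxI _ (hyr _ hm)).2 (hχη x hx)
      have hub := (convex_Icc (χ x) (η x)).image_sub_le_mul_sub_of_deriv_le (f := h x)
        (fun y _ => (H.dhy x y).continuousAt.continuousWithinAt)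
        (fun y _ => (H.dhy x y).differentiableAt.differentiableWithinAt) (C := C)
        (fun y hy => by
          rw [interior_Icc] at hy
          rw [(H.dhy x y).deriv]
          exact (B x hxI y (hyr y ⟨hm.1.trans hy.1.le, hy.2.le.trans l2.le⟩)).2.2.le)
        _ (left_mem_Icc.2 (hχη x hx).le) _ (right_mem_Icc.2 (hχη x hx).le) (hχη x hx).le
      have hC0 : 0 < C := by positivity
      have hub2 : -h x (χ x) ≤ C * (η x - y₀) := by
        have : C * (η x - χ x) ≤ C * (η x - y₀) := by gcongr; exact hm.1
        rw [hη0] at hub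
        linarith
      rw [Real.norm_eq_abs, abs_div, abs_of_neg hneg, abs_of_pos (g0.trans_le g1)]
      calc -h x (χ x) / (gy (α (χ x)) (χ x) - gy x (χ x))
          ≤ C * (η x - y₀) / (c * (x₀ - x)) :=
            div_le_div₀ (by nlinarith) hub2 g0 g1
        _ = C / c * ((η x - y₀) / (x₀ - x)) := by field_simp
  refine ⟨ρ, hρ, δ, hδpos, η, χ', η0, Function.update_self _ _ _,
    hηC.mono fun x hx => ⟨by linarith [hx.1], hx.2⟩, hχC', ?_⟩
  have far := H.far_lt (x₀ := x₀) (y₀ := y₀) (a := b) isOpen_empty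
    (fun x' hx' _ => hmax x' (by linarith))
  have near : ∀ᶠ q : ℝ × ℝ in 𝓝 (x₀, y₀), q ∈ Ioo (x₀ - δ) b ×ˢ Ioo (y₀ - s / 2) d :=
    (isOpen_Ioo.prod isOpen_Ioo).mem_nhds ⟨⟨by linarith, by linarith⟩, ⟨by linarith, by linarith⟩⟩
  filter_upwards [far, near] with ⟨x, y⟩ f ⟨nx, ny⟩
  simp only at f nx ny ⊢
  have fb : ∀ x' ≥ b, g x' y < g x y := fun x' hx' => f x' hx' (notMem_empty _)
  have hyJ : y ∈ Ioo (y₀ - s) (y₀ + s) := ⟨by linarith [ny.1], by linarith [ny.2]⟩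
  obtain ⟨hyr', -⟩ := hJ y hyJ
  have hxI : x ∈ I := hIcc x (by linarith [nx.1]) nx.2.le
  have hle_η : IsContact g h x y → y ≤ η x := fun hc => not_lt.1 fun hh =>
    absurd ((hgt x hxI y hyr').2 hh) (not_lt.2 (H.nonpos_of_max_right hc.1))
  rcases le_or_gt x₀ x with hx | hx
  · -- right of the fold
    have hright : y ≤ η x → ∀ x', x < x' → g x' y < g x y := by
      intro hle x' hx'
      rcases le_total b x' with hb' | hb'
      · exact fb x' hb'
      refine H.strictAntiOn (a := x) (b := b) (fun x'' hx'' => ?_) ⟨le_rfl, nx.2.le⟩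
        ⟨hx'.le, hb'⟩ hx'
      have hI'' := hIcc x'' (by linarith [hx''.1]) hx''.2.le
      rcases le_or_gt y y₀ with hy | hy
      · exact (hlt x'' hI'' y hyr').2 (hy.trans_lt (hη x'' hI'' (by linarith [hx''.1])))
      · have hx1 : x₀ < x := lt_of_le_of_ne hx fun e => by rw [← e, η0] at hle; linarith
        have hp : 0 < h x₀ y := (hgt x₀ hx₀ y hyr').2 (η0 ▸ hy)
        have hq : h x y ≤ 0 := not_lt.1 fun hh => absurd ((hgt x hxI y hyr').1 hh) (not_lt.2 hle)
        by_contra hcon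
        have := hconc y hyr' x₀ hx₀ x'' hI'' x hx1 hx''.1
        exact absurd (this.trans_le hq) (not_lt.2 (le_min hp.le (not_lt.1 hcon)))
    have key : IsContact g h x y ↔ y = η x := by
      constructor
      · intro hc
        rcases hc.2 with hc' | ⟨x', hx', he⟩
        · exact (hkey x hxI y hyr').1.1 hc'
        · exact absurd he (hright (hle_η hc) x' hx').ne
      · intro e
        refine ⟨fun x' hx' => ?_, Or.inl ((hkey x hxI y hyr').1.2 e)⟩
        rcases hx'.eq_or_lt with rfl | h'
        · exact le_rfl
        · exact (hright e.le x' h').le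
    rw [key]
    refine ⟨fun e => Or.inl ⟨hx, e⟩, ?_⟩
    rintro (⟨-, e⟩ | ⟨e1, e⟩)
    · exact e
    · have : x = x₀ := le_antisymm e1 hx
      rw [e, this, hχ', Function.update_self, η0]
  · -- left of the fold
    have hxδ : x ∈ Ioo (x₀ - δ) x₀ := ⟨nx.1, hx⟩
    -- Since h(x₀,y) > 0 and h(·,y) is concave, h(·,y) can change sign on [x, x₀] only from negative
    -- to positive. So g(·,y) stays below one of its two end values.
    have hQ : ∀ x', y₀ < y → x < x' → x' < x₀ → g x' y < g x₀ y ∨ g x' y < g x y := by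
      intro x' hy l1 l2
      have hI' : x' ∈ I := ⟨by linarith [hxI.1], by linarith⟩
      have hp : 0 < h x₀ y := (hgt x₀ hx₀ y hyr').2 (η0 ▸ hy)
      rcases le_or_gt 0 (h x' y) with hq | hq
      · left
        exact H.strictMonoOn (a := x') (b := x₀) (fun x'' hx'' =>
          (le_min hq hp.le).trans_lt (hconc y hyr' x' hI' x₀ hx₀ x'' hx''.1 hx''.2))
          (left_mem_Icc.2 l2.le) (right_mem_Icc.2 l2.le) l2
      · right
        refine H.strictAntiOn (a := x) (b := x') (fun x'' hx'' => ?_)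
          (left_mem_Icc.2 l1.le) (right_mem_Icc.2 l1.le) l1
        by_contra hcon
        have := hconc y hyr' x'' ⟨by linarith [hxI.1, hx''.1], by linarith [hx''.2]⟩ x₀ hx₀ x' hx''.2 l2
        exact absurd (this.trans hq) (not_lt.2 (le_min (not_lt.1 hcon) hp.le))
    have hx₀b : x₀ ∈ Icc x₀ b := ⟨le_rfl, by linarith⟩
    have key : IsContact g h x y ↔ y = χ x := by
      constructor
      · intro hc
        rcases le_or_gt y y₀ with hy | hy
        · exfalso
          have hnegx : ∀ x' ∈ I, x' ≠ x₀ → h x' y < 0 := fun x' hI' hne =>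
            (hlt x' hI' y hyr').2 (hy.trans_lt (hη x' hI' hne))
          have a1 := H.strictAntiOn (a := x) (b := x₀) (y := y) fun x' hx' =>
            hnegx x' ⟨by linarith [hxI.1, hx'.1], by linarith [hx'.2]⟩ hx'.2.ne
          have a2 := H.strictAntiOn (a := x₀) (b := b) (y := y) fun x' hx' =>
            hnegx x' (hIcc x' (by linarith [hx'.1]) hx'.2.le) hx'.1.ne'
          have a12 : g x₀ y < g x y := a1 (left_mem_Icc.2 hx.le) (right_mem_Icc.2 hx.le) hx
          rcases hc.2 with hc' | ⟨x', hx', he⟩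
          · exact (hnegx x hxI hx.ne).ne hc'
          · rcases le_total b x' with hb' | hb'
            · exact (fb x' hb').ne he
            · rcases le_or_gt x' x₀ with t | t
              · exact (a1 (left_mem_Icc.2 hx.le) ⟨hx'.le, t⟩ hx').ne he
              · exact ((a2 hx₀b ⟨t.le, hb'⟩ t).trans a12).ne he
        · have hyI : y ∈ Icc y₀ d := ⟨hy.le, ny.2.le⟩
          have hPle : g (α y) y ≤ g x y := hc.1 _ (hx.le.trans (hαm y hyJ).1)
          refine (hχk x hxδ y hyI).1.1 (sub_eq_zero.2 (le_antisymm hPle ?_))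
          rcases hc.2 with hc' | ⟨x', hx', he⟩
          · have := (hkey x hxI y hyr').1.1 hc'
            exact (hincr x hxδ y hyI hy this.ge).le
          · rcases le_total b x' with hb' | hb'
            · exact absurd he (fb x' hb').ne
            · rcases le_or_gt x₀ x' with t | t
              · rw [← he]; exact hαle y hyJ x' ⟨t, hb'⟩
              · rcases hQ x' hy hx' t with t' | t'
                · rw [← he]; exact t'.le.trans (hαle y hyJ x₀ hx₀b)
                · exact absurd he t'.ne
      · intro e
        obtain ⟨hy, hyd'⟩ : y ∈ Ioo y₀ d := e ▸ hχm x hxδ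
        have hyI : y ∈ Icc y₀ d := ⟨hy.le, ny.2.le⟩
        have hP : g (α y) y = g x y := sub_eq_zero.1 ((hχk x hxδ y hyI).1.2 e)
        refine ⟨fun x' hx' => ?_, Or.inr ⟨α y, hx.trans_le (hαm y hyJ).1, hP⟩⟩
        rcases hx'.eq_or_lt with rfl | hx'
        · exact le_rfl
        rcases le_total b x' with hb' | hb'
        · exact (fb x' hb').le
        · rcases le_or_gt x₀ x' with t | t
          · rw [← hP]; exact hαle y hyJ x' ⟨t, hb'⟩
          · rcases hQ x' hy hx' t with t' | t'
            · rw [← hP]; exact t'.le.trans (hαle y hyJ x₀ hx₀b)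
            · exact t'.le
    rw [key]
    refine ⟨fun e => Or.inr ⟨hx.le, by rw [eqχ x hx]; exact e⟩, ?_⟩
    rintro (⟨e, -⟩ | ⟨-, e⟩)
    · linarith
    · rw [← eqχ x hx]; exact e

/-- A contact point which is a degenerate critical point. -/
theorem exists_param_of_fold (H : SlopeData g gy h h1 h2 h11)
    (hS : ∀ x y, pt x y ∈ S ↔ IsContact g h x y) (hz : IsContact g h x₀ y₀)
    (h0 : h x₀ y₀ = 0) (h10 : h1 x₀ y₀ = 0) :
    ∃ r₀ : ℝ, 0 < r₀ ∧ ∃ γ : ℝ → Plane,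
      IsPiecewiseC1Param γ (S ∩ Metric.ball (pt x₀ y₀) r₀) (pt x₀ y₀) := by
  have hneg := lt_of_le_of_ne (H.h11_nonpos_of_max_right hz.1 h0 h10) (H.ne_cusp x₀ y₀ h0 h10)
  -- A later contact would be a critical point of the same height, which `ne_double` forbids next to
  -- a degenerate one.
  have hmax : ∀ x' > x₀, g x' y₀ < g x₀ y₀ := fun x' hx' =>
    lt_of_le_of_ne (hz.1 x' hx'.le) fun he =>
      H.ne_double x₀ x' y₀ hx'.ne h0
        (H.critical_of_max hx' fun x'' h'' => he ▸ hz.1 x'' h'').1 he.symm h10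
  rcases lt_or_gt_of_ne (H.ne_fold x₀ y₀ h0 h10) with hlt | hlt
  · obtain ⟨δ, hδ, δ', hδ', φ, χ, φ0, χ0, hφ, hχ, E⟩ := H.reflect.fold_aux (x₀ := x₀) (y₀ := -y₀)
      (by simpa using h0) (by simpa using h10) (by simpa using hneg) (by simpa using hlt)
      (by simpa using hmax)
    refine exists_param_of_graphs_fst (φ := fun x => -φ x) (χ := fun x => -χ x) hδ hδ' (by simp [φ0])
      (by simp [χ0]) hφ.neg hχ.neg ?_
    have hc : Tendsto (fun q : ℝ × ℝ => (q.1, -q.2)) (𝓝 (x₀, y₀)) (𝓝 (x₀, -y₀)) :=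
      (by fun_prop : Continuous fun q : ℝ × ℝ => (q.1, -q.2)).tendsto (x₀, y₀)
    filter_upwards [hc.eventually E] with q hq
    rw [hS]
    simpa [IsContact, neg_eq_iff_eq_neg] using hq
  · obtain ⟨δ, hδ, δ', hδ', φ, χ, φ0, χ0, hφ, hχ, E⟩ := H.fold_aux h0 h10 hneg hlt hmax
    refine exists_param_of_graphs_fst hδ hδ' φ0 χ0 hφ hχ ?_
    filter_upwards [E] with q hq
    rw [hS, hq]

theorem exists_param (H : SlopeData g gy h h1 h2 h11)
    (hS : ∀ x y, pt x y ∈ S ↔ IsContact g h x y) {z₀ : Plane} (hz : z₀ ∈ S) :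
    ∃ r₀ : ℝ, 0 < r₀ ∧ ∃ γ : ℝ → Plane,
      IsPiecewiseC1Param γ (S ∩ Metric.ball z₀ r₀) z₀ := by
  rw [← pt_eta z₀] at hz ⊢
  have hc := (hS _ _).1 hz
  have hle := H.nonpos_of_max_right hc.1
  rcases hle.lt_or_eq with h0 | h0
  · exact H.exists_param_of_neg hS hc h0
  · rcases (H.h1_nonpos_of_max_right hc.1 h0).lt_or_eq with h10 | h10
    · exact H.exists_param_of_peak hS hc h0 h10
    · exact H.exists_param_of_fold hS hc h0 h10

end SlopeData

/-! ### From the slope field to contact points. -/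

theorem pt_add_smul_e₁ (x y t : ℝ) : pt x y + t • e₁ = pt (x + t) y := by
  ext i; fin_cases i <;> simp [pt, e₁]

/-- The slopes of f are ℓ plus those of g. If neither alternative of contact held, the slopes of g
would be bounded away from 0: near x by h/2, on a compact middle range by their maximum, far away by
the decay. Conversely, a critical point gives ℓ as a limit of slopes, a second maximum gives it as a
slope. -/
theorem slopeField_eq_iff {f : Plane → ℝ} {l : ℝ} {g h : ℝ → ℝ → ℝ}
    (hg : ∀ x y, g x y = f (pt x y) - l * x)
    (dgx : ∀ x y, HasDerivAt (fun x => g x y) (h x y) x)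
    (decay : ∀ K : ℝ, ∃ c > 0, ∃ R : ℝ, ∀ x ≥ R, ∀ y, |y| ≤ K → g x y ≤ -c * x) (x y : ℝ) :
    slopeField f (pt x y) = l ↔ IsContact g h x y := by
  set Q : ℝ → ℝ := fun t => (f (pt x y + t • e₁) - f (pt x y)) / t with hQ
  have hQg : ∀ t, 0 < t → Q t = l + (g (x + t) y - g x y) / t := fun t ht => by
    rw [hQ, hg, hg]
    simp only [pt_add_smul_e₁]
    field_simp; ring
  have hsup : ∀ t, 0 < t → ((Q t : ℝ) : EReal) ≤ slopeField f (pt x y) := fun t ht =>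
    le_iSup₂ (f := fun (t : ℝ) (_ : 0 < t) =>
      (((f (pt x y + t • e₁) - f (pt x y)) / t : ℝ) : EReal)) t ht
  constructor
  · intro heq
    have hle : ∀ t, 0 < t → g (x + t) y ≤ g x y := fun t ht => by
      have := hsup t ht
      rw [heq, EReal.coe_le_coe_iff, hQg t ht] at this
      have h2 : (g (x + t) y - g x y) / t ≤ 0 := by linarith
      have := (div_le_iff₀ ht).1 h2
      linarith
    have hmax : ∀ x', x ≤ x' → g x' y ≤ g x y := fun x' hx' => by
      rcases hx'.eq_or_lt with rfl | h'
      · exact le_rfl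
      · simpa using hle (x' - x) (by linarith)
    refine ⟨hmax, ?_⟩
    by_contra hcon
    push Not at hcon
    obtain ⟨h0, hne⟩ := hcon
    have hlt : ∀ x' > x, g x' y < g x y := fun x' hx' => lt_of_le_of_ne (hmax x' hx'.le) (hne x' hx')
    have hslope := hasDerivAt_iff_tendsto_slope.1 (dgx x y)
    have hsub : Ioi x ⊆ {x}ᶜ := fun x' hx' => ne_of_gt (mem_Ioi.1 hx')
    have hright := hslope.mono_left (nhdsWithin_mono x hsub)
    have hneg : h x y < 0 := by
      refine lt_of_le_of_ne (le_of_tendsto hright ?_) h0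
      filter_upwards [self_mem_nhdsWithin] with x' hx'
      rw [slope_def_field]
      exact div_nonpos_of_nonpos_of_nonneg (by linarith [hmax x' (le_of_lt hx')])
        (by linarith [mem_Ioi.1 hx'])
    obtain ⟨b, hb, hb'⟩ := (mem_nhdsGT_iff_exists_Ioo_subset).1
      (hright.eventually_lt_const (show h x y < h x y / 2 by linarith))
    obtain ⟨c, hc, R, hR⟩ := decay |y|
    -- Beyond R' the decay yields g(x',y) − g(x,y) ≤ −(c/2)(x' − x).
    set R' := max (max R b) (x + max 1 (2 * (-(c * x) - g x y) / c)) with hR'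
    have hcont : ContinuousOn (fun x' => (g x' y - g x y) / (x' - x)) (Icc b R') := by
      refine ContinuousOn.div (fun x' _ => ((dgx x' y).continuousAt.sub
        continuousAt_const).continuousWithinAt) (by fun_prop) fun x' hx' => ?_
      have := mem_Ioi.1 hb
      linarith [hx'.1]
    have hbx : x < b := hb
    obtain ⟨m, hm, hmm⟩ := isCompact_Icc.exists_isMaxOn
      ⟨b, le_rfl, (le_max_right R b).trans (le_max_left _ _)⟩ hcont
    set v := (g m y - g x y) / (m - x) with hv
    have hvneg : v < 0 := div_neg_of_neg_of_pos (by linarith [hlt m (by linarith [hm.1])])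
      (by linarith [hm.1])
    set ε := max (h x y / 2) (max v (-c / 2)) with hε
    have hεneg : ε < 0 := max_lt (by linarith) (max_lt hvneg (by linarith))
    have hall : ∀ x' > x, (g x' y - g x y) / (x' - x) ≤ ε := by
      intro x' hx'
      rcases lt_or_ge x' b with h1 | h1
      · have := hb' ⟨hx', h1⟩
        simp only [mem_ofPred_eq, slope_def_field] at this
        exact this.le.trans (le_max_left _ _)
      rcases le_or_gt x' R' with h2 | h2
      · exact (hmm ⟨h1, h2⟩).trans ((le_max_left _ _).trans (le_max_right _ _))
      · have h3 := hR x' (((le_max_left R b).trans (le_max_left _ _)).trans h2.le) y le_rfl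
        refine le_trans ?_ ((le_max_right _ _).trans (le_max_right _ _))
        have h4 : x + max 1 (2 * (-(c * x) - g x y) / c) < x' := (le_max_right _ _).trans_lt h2
        have h5 : 2 * (-(c * x) - g x y) / c ≤ x' - x := by
          linarith [le_max_right 1 (2 * (-(c * x) - g x y) / c)]
        rw [div_le_iff₀ hc] at h5
        rw [div_le_iff₀ (by linarith)]
        linarith
    have hfin : slopeField f (pt x y) ≤ ((l + ε : ℝ) : EReal) := by
      refine iSup₂_le fun t ht => ?_
      change ((Q t : ℝ) : EReal) ≤ _
      rw [EReal.coe_le_coe_iff, hQg t ht]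
      have := hall (x + t) (by linarith)
      rw [add_sub_cancel_left] at this
      linarith
    rw [heq, EReal.coe_le_coe_iff] at hfin
    linarith
  · rintro ⟨hmax, hc⟩
    refine le_antisymm (iSup₂_le fun t ht => ?_) ?_
    · change ((Q t : ℝ) : EReal) ≤ _
      rw [EReal.coe_le_coe_iff, hQg t ht]
      have : (g (x + t) y - g x y) / t ≤ 0 :=
        div_nonpos_of_nonpos_of_nonneg (by linarith [hmax (x + t) (by linarith)]) ht.le
      linarith
    · rcases hc with hc | ⟨x', hx', he⟩
      · have hs := hasDerivAt_iff_tendsto_slope_zero.1 (dgx x y)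
        rw [hc] at hs
        have hsub : Ioi (0 : ℝ) ⊆ {0}ᶜ := fun t ht => ne_of_gt (mem_Ioi.1 ht)
        have hs' := hs.mono_left (nhdsWithin_mono 0 hsub)
        have hQt : Tendsto Q (𝓝[>] 0) (𝓝 l) := by
          have h2 := hs'.const_add l
          rw [add_zero] at h2
          refine h2.congr' ?_
          filter_upwards [self_mem_nhdsWithin] with t ht
          rw [hQg t ht, smul_eq_mul, div_eq_inv_mul]
        refine le_of_tendsto ((continuous_coe_real_ereal.tendsto l).comp hQt) ?_
        filter_upwards [self_mem_nhdsWithin] with t ht using hsup t ht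
      · have := hsup (x' - x) (by linarith)
        rwa [hQg _ (by linarith), add_sub_cancel, he, sub_self, zero_div, add_zero] at this

theorem slopeLevelSet_exists_param {f : Plane → ℝ} {l : ℝ} {gy h h1 h2 h11 : ℝ → ℝ → ℝ}
    (H : SlopeData (fun x y => f (pt x y) - l * x) gy h h1 h2 h11) :
    ∀ z₀ ∈ slopeLevelSet f l, ∃ r₀ : ℝ, 0 < r₀ ∧ ∃ γ : ℝ → Plane,
      IsPiecewiseC1Param γ (slopeLevelSet f l ∩ Metric.ball z₀ r₀) z₀ := fun _ hz =>
  H.exists_param (fun x y => slopeField_eq_iff (fun _ _ => rfl) H.dgx H.decay x y) hz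

/-! ### Partial derivatives -/

/-- The canonical basis vectors of the plane. -/
noncomputable abbrev basisVec (i : Fin 2) : Plane := EuclideanSpace.single i 1

theorem contDiff_partialD {G : Plane → ℝ} {n : ℕ} (hG : ContDiff ℝ (n + 1 : ℕ) G) (i : Fin 2) :
    ContDiff ℝ n (partialD i G) := by
  have h : ContDiff ℝ n (fderiv ℝ G) := hG.fderiv_right (by norm_cast)
  exact h.clm_apply contDiff_const

theorem contDiff_multiD {G : Plane → ℝ} {n : ℕ} (hG : ContDiff ℝ n G) {a b m : ℕ}
    (h : a + b + m = n) : ContDiff ℝ m (multiD a b G) := by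
  have h1 : ∀ b m : ℕ, ∀ F : Plane → ℝ, ContDiff ℝ (b + m : ℕ) F →
      ∀ i, ContDiff ℝ m ((partialD i)^[b] F) := by
    intro b
    induction b with
    | zero => intro m F hF i; simpa using hF
    | succ b ih =>
      intro m F hF i
      rw [Function.iterate_succ_apply]
      exact ih m _ (contDiff_partialD (by convert hF using 2; ring) i) i
  exact h1 a m _ (h1 b (a + m) _ (by convert hG using 2; omega) 1) 0

theorem partialD_comm {G : Plane → ℝ} (hG : ContDiff ℝ 2 G) (i j : Fin 2) :
    partialD i (partialD j G) = partialD j (partialD i G) := by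
  have hd : Differentiable ℝ (fderiv ℝ G) :=
    (hG.fderiv_right (m := 1) (by norm_num)).differentiable one_ne_zero
  have key : ∀ (i j : Fin 2) z, partialD i (partialD j G) z
      = fderiv ℝ (fderiv ℝ G) z (basisVec i) (basisVec j) := fun i j z => by
    unfold partialD
    rw [fderiv_clm_apply (hd z) (by fun_prop)]
    simp
  ext z
  rw [key, key]
  exact (hG.contDiffAt.isSymmSndFDerivAt (by simp)) _ _

theorem partialD_zero_multiD (G : Plane → ℝ) (a b : ℕ) :
    partialD 0 (multiD a b G) = multiD (a + 1) b G := by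
  rw [multiD, multiD, Function.iterate_succ_apply']

/-- `multiD` applies `partialD 0` last, so a new `partialD 1` is moved inside by the symmetry of
second derivatives, one step at a time. -/
theorem partialD_one_multiD {G : Plane → ℝ} {n : ℕ} (hG : ContDiff ℝ n G) (a b : ℕ)
    (h : a + b + 1 ≤ n) : partialD 1 (multiD a b G) = multiD a (b + 1) G := by
  induction a with
  | zero => simp only [multiD, Function.iterate_zero, id]; rw [Function.iterate_succ_apply']
  | succ a ih =>
    rw [← partialD_zero_multiD, ← partialD_zero_multiD, ← ih (by omega)]
    refine partialD_comm ?_ 1 0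
    exact (contDiff_multiD hG (m := n - (a + b)) (by omega)).of_le (by
      norm_cast; omega)

theorem HasDerivAt.of_partialD {G : Plane → ℝ} (hG : Differentiable ℝ G) (i : Fin 2) (z : Plane)
    (t : ℝ) : HasDerivAt (fun t : ℝ => G (z + t • basisVec i)) (partialD i G (z + t • basisVec i)) t := by
  have h1 : HasDerivAt (fun t : ℝ => z + t • basisVec i) (basisVec i) t := by
    simpa using ((hasDerivAt_id t).smul_const (basisVec i)).const_add z
  exact (hG _).hasFDerivAt.comp_hasDerivAt t h1

/-! ### Translations in `L²` -/

theorem MeasureTheory.MemLp.comp_sub_left {G : Plane → ℝ} (hG : MemLp G 2 volume) (z : Plane) :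
    MemLp (fun x => G (z - x)) 2 volume :=
  hG.comp_measurePreserving (Measure.measurePreserving_sub_left volume z)

/-- The function `G(z - ·)` as an element of `L²`. -/
noncomputable def shiftLp {G : Plane → ℝ} (hG : MemLp G 2 volume) (z : Plane) :
    Lp ℝ 2 (volume : Measure Plane) :=
  (hG.comp_sub_left z).toLp (fun x => G (z - x))

/-- Averaging translates does not increase the L² norm: Jensen on the unit interval, Tonelli, and
translation invariance. -/
theorem eLpNorm_two_le_of_le_integral {A K : Plane → ℝ} (hK : Continuous K) (v : Plane)
    (h : ∀ x, |A x| ≤ ∫ s in (0 : ℝ)..1, |K (x + s • v)|) :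
    eLpNorm A 2 volume ≤ eLpNorm K 2 volume := by
  have hμ : IsProbabilityMeasure (volume.restrict (Ioc (0 : ℝ) 1)) := ⟨by simp⟩
  have h2 : (2 : ℝ≥0∞) ≠ 0 := by norm_num
  rw [eLpNorm_eq_lintegral_rpow_enorm_toReal h2 (by norm_num),
    eLpNorm_eq_lintegral_rpow_enorm_toReal h2 (by norm_num)]
  refine ENNReal.rpow_le_rpow ?_ (by simp)
  simp only [ENNReal.toReal_ofNat]
  have hc : ∀ x, Continuous fun s : ℝ => K (x + s • v) := fun x => hK.comp (by fun_prop)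
  have step : ∀ x, ‖A x‖ₑ ^ (2 : ℝ) ≤ ∫⁻ s in Ioc (0 : ℝ) 1, ‖K (x + s • v)‖ₑ ^ (2 : ℝ) := by
    intro x
    have e1 : ‖A x‖ₑ ≤ eLpNorm (fun s : ℝ => K (x + s • v)) 1 (volume.restrict (Ioc (0 : ℝ) 1)) := by
      rw [eLpNorm_one_eq_lintegral_enorm]
      have hi : IntegrableOn (fun s : ℝ => K (x + s • v)) (Ioc 0 1) :=
        ((hc x).intervalIntegrable 0 1).1
      rw [← ofReal_integral_norm_eq_lintegral_enorm hi, ← ofReal_norm]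
      refine ENNReal.ofReal_le_ofReal ?_
      have := h x
      rwa [intervalIntegral.integral_of_le zero_le_one] at this
    have e2 := eLpNorm_le_eLpNorm_of_exponent_le (μ := volume.restrict (Ioc (0 : ℝ) 1))
      (p := 1) (q := 2) (by norm_num) ((hc x).aestronglyMeasurable (μ := volume.restrict (Ioc (0 : ℝ) 1)))
    have e3 := ENNReal.rpow_le_rpow (e1.trans e2) (by norm_num : (0 : ℝ) ≤ 2)
    refine e3.trans (le_of_eq ?_)
    rw [eLpNorm_eq_lintegral_rpow_enorm_toReal h2 (by norm_num), ← ENNReal.rpow_mul]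
    simp
  calc ∫⁻ x, ‖A x‖ₑ ^ (2 : ℝ) ≤ ∫⁻ x, ∫⁻ s in Ioc (0 : ℝ) 1, ‖K (x + s • v)‖ₑ ^ (2 : ℝ) :=
        lintegral_mono step
    _ = ∫⁻ s in Ioc (0 : ℝ) 1, ∫⁻ x, ‖K (x + s • v)‖ₑ ^ (2 : ℝ) := by
        refine lintegral_lintegral_swap ?_
        have : Continuous fun p : Plane × ℝ => K (p.1 + p.2 • v) := hK.comp (by fun_prop)
        exact (this.measurable.enorm.pow_const _).aemeasurable
    _ = ∫⁻ s in Ioc (0 : ℝ) 1, ∫⁻ x, ‖K x‖ₑ ^ (2 : ℝ) := by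
        refine lintegral_congr fun s => ?_
        exact lintegral_add_right_eq_self (fun x => ‖K x‖ₑ ^ (2 : ℝ)) (s • v)
    _ = ∫⁻ x, ‖K x‖ₑ ^ (2 : ℝ) := by simp

variable {G : Plane → ℝ}

theorem norm_toLp_comp_sub_left_le {A K : Plane → ℝ} (hA : Continuous A) (hK : MemLp K 2 volume)
    (h : eLpNorm A 2 volume ≤ eLpNorm K 2 volume) (z : Plane) {F : Lp ℝ 2 (volume : Measure Plane)}
    (hF : F =ᵐ[volume] fun x => A (z - x)) : ‖F‖ ≤ (eLpNorm K 2 volume).toReal := by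
  rw [Lp.norm_def, eLpNorm_congr_ae hF]
  refine ENNReal.toReal_mono hK.eLpNorm_ne_top ?_
  have := eLpNorm_comp_measurePreserving (p := 2) hA.aestronglyMeasurable
    (Measure.measurePreserving_sub_left volume z)
  exact this.trans_le h

theorem integral_partialD (hG : ContDiff ℝ 1 G) (i : Fin 2) (z : Plane) (t : ℝ) :
    G (z + t • basisVec i) - G z
      = ∫ s in (0 : ℝ)..1, t * partialD i G (z + s • (t • basisVec i)) := by
  have hd := fun s : ℝ => HasDerivAt.of_partialD (hG.differentiable one_ne_zero) i z (s * t)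
  have hd' : ∀ s : ℝ, HasDerivAt (fun s : ℝ => G (z + s • (t • basisVec i)))
      (t * partialD i G (z + s • (t • basisVec i))) s := fun s => by
    have := (hd s).comp s ((hasDerivAt_id s).mul_const t)
    simp only [Function.comp_def, id, one_mul, ← smul_smul] at this
    rwa [mul_comm] at this
  have hc : Continuous (partialD i G) := (contDiff_partialD (n := 0) (by simpa using hG) i).continuous
  rw [intervalIntegral.integral_eq_sub_of_hasDerivAt (fun s _ => hd' s)
    ((continuous_const.mul (hc.comp (by fun_prop))).intervalIntegrable 0 1)]
  simp

theorem norm_shiftLp_add_sub_le (hG : ContDiff ℝ 1 G) (h0 : MemLp G 2 volume) {i : Fin 2}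
    (h1 : MemLp (partialD i G) 2 volume) (z : Plane) (t : ℝ) :
    ‖shiftLp h0 (z + t • basisVec i) - shiftLp h0 z‖ ≤
      |t| * (eLpNorm (partialD i G) 2 volume).toReal := by
  have hc : Continuous (partialD i G) := (contDiff_partialD (n := 0) (by simpa using hG) i).continuous
  set A : Plane → ℝ := fun x => G (x + t • basisVec i) - G x
  have hA : eLpNorm A 2 volume ≤ eLpNorm (t • partialD i G) 2 volume := by
    refine eLpNorm_two_le_of_le_integral (hc.const_smul t) (t • basisVec i) fun x => ?_
    simp only [A, integral_partialD hG]
    exact intervalIntegral.abs_integral_le_integral_abs zero_le_one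
  have hF : (shiftLp h0 (z + t • basisVec i) - shiftLp h0 z : Lp ℝ 2 (volume : Measure Plane))
      =ᵐ[volume] fun x => A (z - x) := by
    filter_upwards [Lp.coeFn_sub (shiftLp h0 (z + t • basisVec i)) (shiftLp h0 z),
      (h0.comp_sub_left (z + t • basisVec i)).coeFn_toLp, (h0.comp_sub_left z).coeFn_toLp]
      with x e1 e2 e3
    rw [e1, Pi.sub_apply]
    simp only [shiftLp, e2, e3, A]
    congr 2; abel
  have := norm_toLp_comp_sub_left_le
    ((hG.continuous.comp (by fun_prop : Continuous fun x : Plane => x + t • basisVec i)).sub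
      hG.continuous) (h1.const_smul t) hA z hF
  rwa [eLpNorm_const_smul, ENNReal.toReal_mul, toReal_enorm, Real.norm_eq_abs] at this

/-- Differentiability of z ↦ G(z − ·) as an L²-valued map along a basis vector, with quadratic
remainder. The factor 1/2 is lost by bounding integrals over [0, s] by integrals over [0, 1]. -/
theorem norm_shiftLp_taylor_le (hG : ContDiff ℝ 2 G) (h0 : MemLp G 2 volume) {i : Fin 2}
    (h1 : MemLp (partialD i G) 2 volume) (h2 : MemLp (partialD i (partialD i G)) 2 volume)
    (z : Plane) (t : ℝ) :
    ‖shiftLp h0 (z + t • basisVec i) - shiftLp h0 z - t • shiftLp h1 z‖ ≤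
      t ^ 2 * (eLpNorm (partialD i (partialD i G)) 2 volume).toReal := by
  have hG1 : ContDiff ℝ 1 (partialD i G) := contDiff_partialD (n := 1) hG i
  have hc1 := hG1.continuous
  have hc : Continuous (partialD i (partialD i G)) :=
    (contDiff_partialD (n := 0) (by simpa using hG1) i).continuous
  set v := t • basisVec i with hv
  set A : Plane → ℝ := fun x => G (x + v) - G x - t * partialD i G x
  set K : Plane → ℝ := t ^ 2 • partialD i (partialD i G) with hKdef
  have hKc : Continuous K := hc.const_smul _
  have hA : eLpNorm A 2 volume ≤ eLpNorm K 2 volume := by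
    refine eLpNorm_two_le_of_le_integral hKc v fun x => ?_
    have hcx : Continuous fun s : ℝ => t * partialD i G (x + s • v) :=
      continuous_const.mul (hc1.comp (by fun_prop))
    have hKx : Continuous fun s : ℝ => |K (x + s • v)| := (hKc.comp (by fun_prop)).abs
    have e : A x = ∫ s in (0 : ℝ)..1, (t * partialD i G (x + s • v) - t * partialD i G x) := by
      rw [intervalIntegral.integral_sub (hcx.intervalIntegrable 0 1) (by simp),
        ← integral_partialD (hG.of_le (by norm_num))]
      simp [A, hv]
    rw [e]
    have hb : ∀ s ∈ Set.uIoc (0 : ℝ) 1, ‖t * partialD i G (x + s • v) - t * partialD i G x‖ ≤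
        ∫ s in (0 : ℝ)..1, |K (x + s • v)| := by
      intro s hs
      rw [uIoc_of_le zero_le_one] at hs
      have hd : ∀ s : ℝ, HasDerivAt (fun s : ℝ => t * partialD i G (x + s • v)) (K (x + s • v)) s := by
        intro s
        have := ((HasDerivAt.of_partialD (hG1.differentiable one_ne_zero) i x (s * t)).comp s
          ((hasDerivAt_id s).mul_const t)).const_mul t
        simp only [Function.comp_def, id, one_mul, ← smul_smul, ← hv] at this
        refine this.congr_deriv ?_
        simp only [hKdef, Pi.smul_apply, smul_eq_mul]; ring
      have := intervalIntegral.integral_eq_sub_of_hasDerivAt (fun s _ => hd s)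
        ((hKc.comp (by fun_prop : Continuous fun s : ℝ => x + s • v)).intervalIntegrable 0 s)
      simp only [zero_smul, add_zero] at this
      rw [← this, Real.norm_eq_abs]
      refine (intervalIntegral.abs_integral_le_integral_abs hs.1.le).trans ?_
      exact intervalIntegral.integral_mono_interval le_rfl hs.1.le hs.2
        (Eventually.of_forall fun _ => abs_nonneg _) (hKx.intervalIntegrable 0 1)
    simpa using intervalIntegral.norm_integral_le_of_norm_le_const hb
  have hF : (shiftLp h0 (z + v) - shiftLp h0 z - t • shiftLp h1 z : Lp ℝ 2 (volume : Measure Plane))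
      =ᵐ[volume] fun x => A (z - x) := by
    filter_upwards [Lp.coeFn_sub (shiftLp h0 (z + v) - shiftLp h0 z) (t • shiftLp h1 z),
      Lp.coeFn_sub (shiftLp h0 (z + v)) (shiftLp h0 z), Lp.coeFn_smul t (shiftLp h1 z),
      (h0.comp_sub_left (z + v)).coeFn_toLp, (h0.comp_sub_left z).coeFn_toLp,
      (h1.comp_sub_left z).coeFn_toLp] with x e1 e2 e3 e4 e5 e6
    rw [e1, Pi.sub_apply, e2, Pi.sub_apply, e3, Pi.smul_apply]
    simp only [shiftLp, e4, e5, e6, A, smul_eq_mul]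
    congr 3; abel
  have := norm_toLp_comp_sub_left_le
    (((hG.continuous.comp (by fun_prop : Continuous fun x : Plane => x + v)).sub
      hG.continuous).sub (continuous_const.mul hc1)) (h2.const_smul (t ^ 2)) hA z hF
  rwa [eLpNorm_const_smul, ENNReal.toReal_mul, toReal_enorm, Real.norm_eq_abs,
    abs_of_nonneg (sq_nonneg t)] at this

/-! ### White noise -/

/-- The Hilbert space indexing the white noise. -/
abbrev PlaneL2 : Type := Lp ℝ 2 (volume : Measure Plane)

section WhiteNoise

variable {Ω : Type*} [MeasurableSpace Ω] {P : Measure Ω} {W : PlaneL2 → Ω → ℝ}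

namespace IsWhiteNoise

theorem aemeasurable (hW : IsWhiteNoise P W) (φ : PlaneL2) : AEMeasurable (W φ) P :=
  hW.gaussian.aemeasurable φ

theorem memLp_two (hW : IsWhiteNoise P W) (φ : PlaneL2) : MemLp (W φ) 2 P :=
  (hW.gaussian.hasGaussianLaw_eval φ).memLp_two

theorem integrable_mul (hW : IsWhiteNoise P W) (φ ψ : PlaneL2) :
    Integrable (fun ω => W φ ω * W ψ ω) P :=
  (hW.memLp_two φ).integrable_mul (hW.memLp_two ψ)

theorem map_eq (hW : IsWhiteNoise P W) (φ : PlaneL2) :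
    P.map (W φ) = gaussianReal 0 (‖φ‖₊ ^ 2) := by
  rw [(hW.gaussian.hasGaussianLaw_eval φ).map_eq_gaussianReal, hW.centered,
    variance_of_integral_eq_zero (hW.aemeasurable φ) (hW.centered φ)]
  congr 1
  have : ∫ ω, W φ ω ^ 2 ∂P = ‖φ‖ ^ 2 := by
    simp_rw [pow_two (W φ _)]
    rw [hW.covariance, real_inner_self_eq_norm_sq]
  rw [this]
  ext
  simp

/-- The second moment of the defect of linearity expands, through the covariance, to 0. -/
theorem add_smul_ae_eq (hW : IsWhiteNoise P W) (φ ψ : PlaneL2) (c : ℝ) :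
    W (φ + c • ψ) =ᵐ[P] fun ω => W φ ω + c * W ψ ω := by
  set D : Ω → ℝ := fun ω => W (φ + c • ψ) ω - (W φ ω + c * W ψ ω) with hD
  have hmem : MemLp D 2 P :=
    (hW.memLp_two _).sub ((hW.memLp_two _).add ((hW.memLp_two _).const_mul c))
  have hint : ∫ ω, D ω ^ 2 ∂P = 0 := by
    have e : ∀ ω, D ω ^ 2 = W (φ + c • ψ) ω * W (φ + c • ψ) ω
        + W φ ω * W φ ω + c ^ 2 * (W ψ ω * W ψ ω) + 2 * c * (W φ ω * W ψ ω)
        + (-2) * (W (φ + c • ψ) ω * W φ ω) + (-2 * c) * (W (φ + c • ψ) ω * W ψ ω) := by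
      intro ω; simp only [hD]; ring
    have i2 := fun (k : ℝ) a b => (hW.integrable_mul a b).const_mul k
    have i1 := hW.integrable_mul
    have j2 := (i1 (φ + c • ψ) (φ + c • ψ)).fun_add (i1 φ φ)
    have j3 := j2.fun_add (i2 (c ^ 2) ψ ψ)
    have j4 := j3.fun_add (i2 (2 * c) φ ψ)
    have j5 := j4.fun_add (i2 (-2) (φ + c • ψ) φ)
    simp_rw [e]
    rw [integral_add j5 (i2 _ _ _), integral_add j4 (i2 _ _ _), integral_add j3 (i2 _ _ _),
      integral_add j2 (i2 _ _ _), integral_add (i1 _ _) (i1 _ _)]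
    simp only [integral_const_mul, hW.covariance, inner_add_left, inner_add_right,
      real_inner_smul_left, real_inner_smul_right, real_inner_comm φ ψ]
    ring
  have h0 := (integral_eq_zero_iff_of_nonneg (fun ω => sq_nonneg (D ω)) hmem.integrable_sq).1 hint
  filter_upwards [h0] with ω h
  have : D ω = 0 := by simpa using h
  simp only [hD] at this
  linarith

theorem sub_ae_eq (hW : IsWhiteNoise P W) (φ ψ : PlaneL2) :
    W (φ - ψ) =ᵐ[P] fun ω => W φ ω - W ψ ω := by
  filter_upwards [hW.add_smul_ae_eq φ ψ (-1)] with ω h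
  rw [show φ - ψ = φ + (-1 : ℝ) • ψ by module, h]; ring

theorem zero_ae_eq (hW : IsWhiteNoise P W) : W 0 =ᵐ[P] fun _ => 0 := by
  filter_upwards [hW.sub_ae_eq 0 0] with ω h
  simpa using h

theorem smul_ae_eq (hW : IsWhiteNoise P W) (c : ℝ) (φ : PlaneL2) :
    W (c • φ) =ᵐ[P] fun ω => c * W φ ω := by
  filter_upwards [hW.add_smul_ae_eq 0 φ c, hW.zero_ae_eq] with ω h h0
  simpa [h0] using h

theorem sum_ae_eq (hW : IsWhiteNoise P W) {ι : Type*} (s : Finset ι) (c : ι → ℝ) (φ : ι → PlaneL2) :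
    W (∑ i ∈ s, c i • φ i) =ᵐ[P] fun ω => ∑ i ∈ s, c i * W (φ i) ω := by
  classical
  induction s using Finset.induction_on with
  | empty => simpa using hW.zero_ae_eq
  | insert a s ha ih =>
    filter_upwards [ih, hW.add_smul_ae_eq (∑ i ∈ s, c i • φ i) (φ a) (c a)] with ω h1 h2
    rw [Finset.sum_insert ha, Finset.sum_insert ha, add_comm, h2, h1, add_comm]

/-- `W` is isometric, so that L² convergence of kernels becomes convergence in probability of the
values. -/
theorem eLpNorm_sub (hW : IsWhiteNoise P W) (φ ψ : PlaneL2) :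
    eLpNorm (W φ - W ψ) 2 P = ENNReal.ofReal ‖φ - ψ‖ := by
  have h : eLpNorm (W φ - W ψ) 2 P = eLpNorm (W (φ - ψ)) 2 P :=
    (eLpNorm_congr_ae (hW.sub_ae_eq φ ψ)).symm
  rw [h, (hW.memLp_two _).eLpNorm_eq_integral_rpow_norm (by norm_num) (by norm_num)]
  congr 1
  simp only [ENNReal.toReal_ofNat, Real.rpow_two, Real.norm_eq_abs, sq_abs]
  simp_rw [pow_two]
  rw [hW.covariance, real_inner_self_eq_norm_sq, ← one_div, ← Real.sqrt_eq_rpow,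
    Real.sqrt_sq (norm_nonneg _)]

/-- Almost sure limits of white noise values are white noise values at the `L²` limit. -/
theorem ae_eq_of_tendsto [IsFiniteMeasure P] (hW : IsWhiteNoise P W) {Y : ℕ → Ω → ℝ} {Z : Ω → ℝ} {φ : ℕ → PlaneL2}
    {ψ : PlaneL2} (hY : ∀ n, Y n =ᵐ[P] W (φ n)) (hZ : ∀ᵐ ω ∂P, Tendsto (fun n => Y n ω) atTop (𝓝 (Z ω)))
    (hφ : Tendsto φ atTop (𝓝 ψ)) : Z =ᵐ[P] W ψ := by
  refine tendstoInMeasure_ae_unique (f := fun n => W (φ n)) (u := atTop) ?_ ?_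
  · refine tendstoInMeasure_of_tendsto_ae
      (fun n => (hW.aemeasurable (φ n)).aestronglyMeasurable) ?_
    filter_upwards [hZ, ae_all_iff.2 hY] with ω h1 h2
    simpa only [← h2] using h1
  · refine tendstoInMeasure_of_tendsto_eLpNorm (p := 2) (by norm_num)
      (fun n => (hW.aemeasurable (φ n)).aestronglyMeasurable)
      (hW.aemeasurable ψ).aestronglyMeasurable ?_
    simp_rw [hW.eLpNorm_sub]
    rw [← ENNReal.ofReal_zero]
    exact ENNReal.tendsto_ofReal (tendsto_iff_norm_sub_tendsto_zero.1 hφ)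

/-- W(φ) is distributed as ‖φ‖ times a standard Gaussian. Fourth moments are used because second
moments would not beat the 4ⁿ edges per unit square in the chaining. -/
theorem lintegral_pow_four (hW : IsWhiteNoise P W) (φ : PlaneL2) :
    ∫⁻ ω, ‖W φ ω‖ₑ ^ 4 ∂P = ‖φ‖ₑ ^ 4 * ∫⁻ x, ‖x‖ₑ ^ 4 ∂(gaussianReal 0 1) := by
  have e : gaussianReal 0 (‖φ‖₊ ^ 2) = (gaussianReal 0 1).map (‖φ‖ * ·) := by
    rw [gaussianReal_map_const_mul]
    simp only [mul_zero, mul_one]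
    congr 1
  have e2 : ∫⁻ ω, ‖W φ ω‖ₑ ^ 4 ∂P = ∫⁻ x, ‖x‖ₑ ^ 4 ∂(P.map (W φ)) := by
    rw [lintegral_map' (by fun_prop) (hW.aemeasurable φ)]
  rw [e2, hW.map_eq, e, lintegral_map (by fun_prop) (by fun_prop), ← lintegral_const_mul _ (by fun_prop)]
  refine lintegral_congr fun x => ?_
  rw [enorm_mul, enorm_norm, mul_pow]

end IsWhiteNoise

theorem lintegral_gaussianReal_pow_four_lt_top : ∫⁻ x, ‖x‖ₑ ^ 4 ∂(gaussianReal 0 1) < ∞ := by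
  have h := lintegral_rpow_enorm_lt_top_of_eLpNorm_lt_top (by norm_num) (by norm_num)
    (memLp_id_gaussianReal (μ := 0) (v := 1) 4).eLpNorm_lt_top
  simpa using h

end WhiteNoise

/-! ### Versions of convolution fields -/

theorem KernelAssumption.memLp_self {q : Plane → ℝ} (hq : KernelAssumption q) : MemLp q 2 volume :=
  hq.memLp 0 0 (by norm_num)

/-- Evenness of q turns q(· − z) into q(z − ·), a form whose z-derivatives are shifts of the
derivatives of q without sign changes. -/
theorem KernelAssumption.translate_eq_shiftLp {q : Plane → ℝ} (hq : KernelAssumption q)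
    (z : Plane) : hq.translate z = shiftLp hq.memLp_self z := by
  unfold KernelAssumption.translate shiftLp
  congr 1
  ext x
  rw [hq.symm, neg_sub]

section Version
variable {Ω : Type*} [MeasurableSpace Ω] {P : Measure Ω} {W : PlaneL2 → Ω → ℝ}

/-- `X` is a version of the field `G ∗ W`. -/
def IsVersion (P : Measure Ω) (W : PlaneL2 → Ω → ℝ) {G : Plane → ℝ} (hG : MemLp G 2 volume)
    (X : Ω → Plane → ℝ) : Prop :=
  ∀ z, ∀ᵐ ω ∂P, X ω z = W (shiftLp hG z) ω

variable {G : Plane → ℝ} {X : Ω → Plane → ℝ}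

/-- Difference quotients converge pathwise to the derivative of X, and their kernels converge in L²
by the Taylor bound; the two limits must agree almost surely. -/
theorem IsVersion.partialD [IsFiniteMeasure P] (hW : IsWhiteNoise P W) {h0 : MemLp G 2 volume}
    (hX : IsVersion P W h0 X) (hG : ContDiff ℝ 2 G) (i : Fin 2)
    (h1 : MemLp (partialD i G) 2 volume) (h2 : MemLp (partialD i (partialD i G)) 2 volume)
    (hd : ∀ᵐ ω ∂P, Differentiable ℝ (X ω)) :
    IsVersion P W h1 (fun ω => _root_.partialD i (X ω)) := by
  intro z
  have hpos : ∀ n : ℕ, (0 : ℝ) < 1 / ((n : ℝ) + 1) := fun n => by positivity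
  set t : ℕ → ℝ := fun n => 1 / ((n : ℝ) + 1) with ht
  have ht0 : Tendsto t atTop (𝓝 0) := tendsto_one_div_add_atTop_nhds_zero_nat
  refine hW.ae_eq_of_tendsto (Y := fun n ω => (t n)⁻¹ * (X ω (z + t n • basisVec i) - X ω z))
    (φ := fun n => (t n)⁻¹ • (shiftLp h0 (z + t n • basisVec i) - shiftLp h0 z)) (fun n => ?_) ?_ ?_
  · filter_upwards [hX z, hX (z + t n • basisVec i), hW.smul_ae_eq (t n)⁻¹
      (shiftLp h0 (z + t n • basisVec i) - shiftLp h0 z), hW.sub_ae_eq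
      (shiftLp h0 (z + t n • basisVec i)) (shiftLp h0 z)] with ω a b c d
    rw [a, b, c, d]
  · filter_upwards [hd] with ω hω
    have := HasDerivAt.of_partialD hω i z 0
    have h2 := this.tendsto_slope_zero
    simp only [zero_add, zero_smul, add_zero, smul_eq_mul] at h2
    refine h2.comp (tendsto_nhdsWithin_iff.2 ⟨ht0, Eventually.of_forall fun n => (hpos n).ne'⟩)
  · rw [tendsto_iff_norm_sub_tendsto_zero]
    refine squeeze_zero (fun _ => norm_nonneg _) (g := fun n => t n * (eLpNorm (_root_.partialD i (_root_.partialD i G)) 2 volume).toReal) (fun n => ?_) (by simpa using ht0.mul_const _)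
    have := norm_shiftLp_taylor_le hG h0 h1 h2 z (t n)
    have e : (t n)⁻¹ • (shiftLp h0 (z + t n • basisVec i) - shiftLp h0 z) - shiftLp h1 z
        = (t n)⁻¹ • (shiftLp h0 (z + t n • basisVec i) - shiftLp h0 z - t n • shiftLp h1 z) := by
      rw [smul_sub (t n)⁻¹ _ (t n • _), smul_smul, inv_mul_cancel₀ (hpos n).ne', one_smul]
    rw [e, norm_smul, Real.norm_eq_abs, abs_of_pos (inv_pos.2 (hpos n)), inv_mul_le_iff₀ (hpos n)]
    refine this.trans (le_of_eq (by ring))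

theorem norm_shiftLp_sub_le (hG : ContDiff ℝ 1 G) (h0 : MemLp G 2 volume)
    (h1 : ∀ i, MemLp (partialD i G) 2 volume) :
    ∃ K : ℝ, 0 ≤ K ∧ ∀ z w, ‖shiftLp h0 z - shiftLp h0 w‖ ≤ K * ‖z - w‖ := by
  set c : Fin 2 → ℝ := fun i => (eLpNorm (partialD i G) 2 volume).toReal
  refine ⟨c 0 + c 1, add_nonneg ENNReal.toReal_nonneg ENNReal.toReal_nonneg, fun z w => ?_⟩
  have hz : z = (w + (z - w) 0 • basisVec 0) + (z - w) 1 • basisVec 1 := by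
    ext i; fin_cases i <;> simp
  set w' := w + (z - w) 0 • basisVec 0
  have e1 := norm_shiftLp_add_sub_le hG h0 (h1 0) w ((z - w) 0)
  have e2 := norm_shiftLp_add_sub_le hG h0 (h1 1) w' ((z - w) 1)
  rw [← hz] at e2
  have n0 : |(z - w) 0| ≤ ‖z - w‖ := PiLp.norm_apply_le (z - w) 0
  have n1 : |(z - w) 1| ≤ ‖z - w‖ := PiLp.norm_apply_le (z - w) 1
  calc ‖shiftLp h0 z - shiftLp h0 w‖ ≤ ‖shiftLp h0 z - shiftLp h0 w'‖ + ‖shiftLp h0 w' - shiftLp h0 w‖ :=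
        norm_sub_le_norm_sub_add_norm_sub _ _ _
    _ ≤ ‖z - w‖ * c 1 + ‖z - w‖ * c 0 := by
        refine add_le_add (e2.trans ?_) (e1.trans ?_)
        · exact mul_le_mul_of_nonneg_right n1 ENNReal.toReal_nonneg
        · exact mul_le_mul_of_nonneg_right n0 ENNReal.toReal_nonneg
    _ = _ := by ring

theorem continuous_shiftLp (hG : ContDiff ℝ 1 G) (h0 : MemLp G 2 volume)
    (h1 : ∀ i, MemLp (partialD i G) 2 volume) : Continuous (shiftLp h0) := by
  obtain ⟨K, hK, h⟩ := norm_shiftLp_sub_le hG h0 h1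
  refine LipschitzWith.continuous (K := ⟨K, hK⟩) (LipschitzWith.of_dist_le_mul fun z w => ?_)
  rw [dist_eq_norm, dist_eq_norm]
  exact h z w

end Version

@[fun_prop]
theorem Continuous.pt {T : Type*} [TopologicalSpace T] {a b : T → ℝ} (ha : Continuous a)
    (hb : Continuous b) : Continuous fun t => pt (a t) (b t) := by
  refine (PiLp.continuous_toLp 2 _).comp (continuous_pi fun i => ?_)
  fin_cases i
  · exact ha
  · exact hb

/-! ### Dyadic chaining -/

/-- The point `(i / 2ⁿ, j / 2ⁿ)` of the dyadic grid of level `n`. -/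
noncomputable def dyad (n : ℕ) (i j : ℤ) : Plane := pt (i / 2 ^ n) (j / 2 ^ n)

/-- The largest point of the dyadic grid of level `n` below `z`. -/
noncomputable def dyadFloor (n : ℕ) (z : Plane) : Plane := dyad n ⌊2 ^ n * z 0⌋ ⌊2 ^ n * z 1⌋

/-- The half-open square of side `m` with lower left corner `(a, b)`. -/
def gridBox (a b : ℤ) (m : ℕ) : Set Plane :=
  {z | (a : ℝ) ≤ z 0 ∧ z 0 < a + m ∧ (b : ℝ) ≤ z 1 ∧ z 1 < b + m}

/-- The indices of the points of level `n` of the square `gridBox a b m`. -/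
noncomputable def gridIndex (a : ℤ) (m n : ℕ) : Finset ℤ := Finset.Ico (a * 2 ^ n) ((a + m) * 2 ^ n)

/-- The increments of `x` along the edges of level `n` are at most `M (3/4)ⁿ`. -/
def EdgeBound (x : Plane → ℝ) (a b : ℤ) (m : ℕ) (M : ℝ) : Prop :=
  ∀ n, ∀ i ∈ gridIndex a m n, ∀ j ∈ gridIndex b m n,
    |x (dyad n (i + 1) j) - x (dyad n i j)| ≤ M * (3 / 4) ^ n ∧
    |x (dyad n i (j + 1)) - x (dyad n i j)| ≤ M * (3 / 4) ^ n

theorem floor_mem_gridIndex {a : ℤ} {m : ℕ} {s : ℝ} (h1 : (a : ℝ) ≤ s) (h2 : s < a + m) (n : ℕ) :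
    ⌊2 ^ n * s⌋ ∈ gridIndex a m n := by
  have h : (0 : ℝ) < 2 ^ n := by positivity
  rw [gridIndex, Finset.mem_Ico, Int.le_floor, Int.floor_lt]
  push_cast
  constructor <;> nlinarith

theorem tendsto_floor_div (s : ℝ) :
    Tendsto (fun n : ℕ => (⌊2 ^ n * s⌋ : ℝ) / 2 ^ n) atTop (𝓝 s) := by
  have h := (tendsto_pow_atTop_nhds_zero_of_lt_one (r := (1 / 2 : ℝ)) (by norm_num) (by norm_num))
  rw [tendsto_iff_norm_sub_tendsto_zero]
  refine squeeze_zero (fun _ => norm_nonneg _) (fun n => ?_) h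
  have h0 : (0 : ℝ) < 2 ^ n := by positivity
  rw [Real.norm_eq_abs, div_sub' h0.ne', abs_div, abs_of_pos h0, one_div, inv_pow, ← one_div]
  refine div_le_div_of_nonneg_right ?_ h0.le
  rw [abs_le]
  constructor <;> linarith [Int.floor_le (2 ^ n * s), Int.lt_floor_add_one (2 ^ n * s)]

theorem tendsto_dyadFloor (z : Plane) : Tendsto (fun n => dyadFloor n z) atTop (𝓝 z) := by
  conv => rhs; rw [← pt_eta z]
  have : Continuous fun p : ℝ × ℝ => pt p.1 p.2 := by fun_prop
  exact (this.tendsto (z 0, z 1)).comp ((tendsto_floor_div (z 0)).prodMk_nhds (tendsto_floor_div (z 1)))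

theorem dyad_two_mul (n : ℕ) (i j : ℤ) : dyad (n + 1) (2 * i) (2 * j) = dyad n i j := by
  unfold dyad
  congr 1 <;> · push_cast; rw [pow_succ]; field_simp

namespace EdgeBound
variable {x : Plane → ℝ} {a b : ℤ} {m : ℕ} {M : ℝ}

theorem abs_sub_le_of_adj (h : EdgeBound x a b m M) (hM : 0 ≤ M) {n : ℕ} {i i' j j' : ℤ}
    (hi : i ∈ gridIndex a m n) (hi' : i' ∈ gridIndex a m n) (hj : j ∈ gridIndex b m n)
    (hj' : j' ∈ gridIndex b m n) (hii : |i' - i| ≤ 1) (hjj : |j' - j| ≤ 1) :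
    |x (dyad n i' j') - x (dyad n i j)| ≤ 2 * M * (3 / 4) ^ n := by
  have h0 : 0 ≤ M * (3 / 4) ^ n := by positivity
  have e1 : |x (dyad n i' j) - x (dyad n i j)| ≤ M * (3 / 4) ^ n := by
    rw [abs_le] at hii
    obtain rfl | rfl | rfl : i' = i ∨ i' = i + 1 ∨ i = i' + 1 := by omega
    · simpa using h0
    · exact (h n i hi j hj).1
    · rw [abs_sub_comm]; exact (h n i' hi' j hj).1
  have e2 : |x (dyad n i' j') - x (dyad n i' j)| ≤ M * (3 / 4) ^ n := by
    rw [abs_le] at hjj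
    obtain rfl | rfl | rfl : j' = j ∨ j' = j + 1 ∨ j = j' + 1 := by omega
    · simpa using h0
    · exact (h n i' hi' j hj).2
    · rw [abs_sub_comm]; exact (h n i' hi' j' hj').2
  linarith [abs_sub_le (x (dyad n i' j')) (x (dyad n i' j)) (x (dyad n i j))]

/-- Refining the grid moves the lower-left approximation by at most one edge in each coordinate. -/
theorem abs_succ_sub_le (h : EdgeBound x a b m M) (hM : 0 ≤ M) {z : Plane}
    (hz : z ∈ gridBox a b m) (n : ℕ) :
    |x (dyadFloor (n + 1) z) - x (dyadFloor n z)| ≤ 2 * M * (3 / 4) ^ (n + 1) := by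
  have key : ∀ {c : ℤ} {s : ℝ}, ⌊2 ^ n * s⌋ ∈ gridIndex c m n →
      2 * ⌊2 ^ n * s⌋ ∈ gridIndex c m (n + 1) ∧ |⌊2 ^ (n + 1) * s⌋ - 2 * ⌊2 ^ n * s⌋| ≤ 1 := by
    intro c s hs
    constructor
    · rw [gridIndex, Finset.mem_Ico] at hs ⊢
      rw [pow_succ]
      constructor <;> linarith [hs.1, hs.2]
    · have h1 : 2 * ⌊2 ^ n * s⌋ ≤ ⌊2 ^ (n + 1) * s⌋ := by
        rw [Int.le_floor, pow_succ]; push_cast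
        linarith [Int.floor_le (2 ^ n * s)]
      have h2 : ⌊2 ^ (n + 1) * s⌋ < 2 * ⌊2 ^ n * s⌋ + 2 := by
        rw [Int.floor_lt, pow_succ]; push_cast
        linarith [Int.lt_floor_add_one (2 ^ n * s)]
      rw [abs_le]; omega
  obtain ⟨hz1, hz2, hz3, hz4⟩ := hz
  obtain ⟨p1, p2⟩ := key (floor_mem_gridIndex hz1 hz2 n)
  obtain ⟨q1, q2⟩ := key (floor_mem_gridIndex hz3 hz4 n)
  rw [dyadFloor, dyadFloor, ← dyad_two_mul n]
  exact h.abs_sub_le_of_adj hM p1 (floor_mem_gridIndex hz1 hz2 _) q1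
    (floor_mem_gridIndex hz3 hz4 _) p2 q2

theorem dist_succ_le (h : EdgeBound x a b m M) (hM : 0 ≤ M) {z : Plane}
    (hz : z ∈ gridBox a b m) (n : ℕ) :
    dist (x (dyadFloor n z)) (x (dyadFloor (n + 1) z)) ≤ (3 / 2 * M) * (3 / 4) ^ n := by
  rw [dist_comm, Real.dist_eq]
  refine (h.abs_succ_sub_le hM hz n).trans (le_of_eq ?_)
  rw [pow_succ]; ring

theorem exists_tendsto (h : EdgeBound x a b m M) (hM : 0 ≤ M) {z : Plane}
    (hz : z ∈ gridBox a b m) : ∃ y, Tendsto (fun n => x (dyadFloor n z)) atTop (𝓝 y) :=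
  cauchySeq_tendsto_of_complete
    (cauchySeq_of_le_geometric _ _ (by norm_num) (h.dist_succ_le hM hz))

/-- Geometric series: (3/2)M / (1 − 3/4) = 6M. -/
theorem abs_sub_le_of_tendsto (h : EdgeBound x a b m M) (hM : 0 ≤ M) {z : Plane}
    (hz : z ∈ gridBox a b m) {y : ℝ} (hy : Tendsto (fun n => x (dyadFloor n z)) atTop (𝓝 y))
    (n : ℕ) : |x (dyadFloor n z) - y| ≤ 6 * M * (3 / 4) ^ n := by
  have := dist_le_of_le_geometric_of_tendsto _ _ (by norm_num) (h.dist_succ_le hM hz) hy n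
  rw [Real.dist_eq] at this
  refine this.trans (le_of_eq ?_)
  ring

/-- The limit along dyadic approximations is continuous in the interior of the square. -/
theorem continuousAt_of_tendsto (h : EdgeBound x a b m M) (hM : 0 ≤ M) {y : Plane → ℝ}
    (hy : ∀ z ∈ gridBox a b m, Tendsto (fun n => x (dyadFloor n z)) atTop (𝓝 (y z))) {z : Plane}
    (hz : gridBox a b m ∈ 𝓝 z) : ContinuousAt y z := by
  rw [Metric.continuousAt_iff]
  intro ε hε
  -- 14M = 6M + 6M + 2M: two tails beyond level n and one move between neighbouring grid points.
  have hlim := (tendsto_pow_atTop_nhds_zero_of_lt_one (r := (3 / 4 : ℝ)) (by norm_num)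
    (by norm_num)).const_mul (14 * M)
  rw [mul_zero] at hlim
  obtain ⟨n, hn⟩ := (hlim.eventually (gt_mem_nhds hε)).exists
  obtain ⟨δ, hδ, hball⟩ := Metric.mem_nhds_iff.1 hz
  have h2 : (0 : ℝ) < 2 ^ n := by positivity
  refine ⟨min δ (1 / 2 ^ n), lt_min hδ (by positivity), fun {w} hw => ?_⟩
  have hwb : w ∈ gridBox a b m := hball (hw.trans_le (min_le_left _ _))
  have hzb : z ∈ gridBox a b m := mem_of_mem_nhds hz
  have hadj : ∀ i : Fin 2, |⌊2 ^ n * w i⌋ - ⌊2 ^ n * z i⌋| ≤ 1 := by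
    intro i
    have hi : |w i - z i| < 1 / 2 ^ n := by
      refine lt_of_le_of_lt ?_ (hw.trans_le (min_le_right _ _))
      rw [dist_eq_norm]
      exact PiLp.norm_apply_le (w - z) i
    rw [lt_div_iff₀ h2, ← abs_of_pos h2, ← abs_mul, abs_lt] at hi
    have a1 : ⌊2 ^ n * w i⌋ < ⌊2 ^ n * z i⌋ + 2 := by
      rw [Int.floor_lt]; push_cast
      linarith [Int.lt_floor_add_one (2 ^ n * z i)]
    have a2 : ⌊2 ^ n * z i⌋ < ⌊2 ^ n * w i⌋ + 2 := by
      rw [Int.floor_lt]; push_cast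
      linarith [Int.lt_floor_add_one (2 ^ n * w i)]
    rw [abs_le]; omega
  have e1 := h.abs_sub_le_of_tendsto hM hwb (hy w hwb) n
  have e2 := h.abs_sub_le_of_tendsto hM hzb (hy z hzb) n
  have e3 : |x (dyadFloor n w) - x (dyadFloor n z)| ≤ 2 * M * (3 / 4) ^ n :=
    h.abs_sub_le_of_adj hM (floor_mem_gridIndex hzb.1 hzb.2.1 n)
      (floor_mem_gridIndex hwb.1 hwb.2.1 n) (floor_mem_gridIndex hzb.2.2.1 hzb.2.2.2 n)
      (floor_mem_gridIndex hwb.2.2.1 hwb.2.2.2 n) (hadj 0) (hadj 1)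
  rw [Real.dist_eq]
  refine lt_of_le_of_lt ?_ hn
  rw [abs_le] at e1 e2 e3 ⊢
  constructor <;> linarith

end EdgeBound

/-! ### Moment bounds for the chaining -/

section Random
variable {Ω : Type*} [MeasurableSpace Ω] {P : Measure Ω} {X : Ω → Plane → ℝ} {L : ℝ≥0∞}

/-- Fourth moments of the increments of `X` along dyadic edges. -/
structure EdgeMoment (P : Measure Ω) (X : Ω → Plane → ℝ) (L : ℝ≥0∞) : Prop where
  aemeasurable : ∀ z, AEMeasurable (fun ω => X ω z) P
  horizontal : ∀ n i j, ∫⁻ ω, ‖X ω (dyad n (i + 1) j) - X ω (dyad n i j)‖ₑ ^ 4 ∂P ≤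
    L * ENNReal.ofReal ((1 / 16) ^ n)
  vertical : ∀ n i j, ∫⁻ ω, ‖X ω (dyad n i (j + 1)) - X ω (dyad n i j)‖ₑ ^ 4 ∂P ≤
    L * ENNReal.ofReal ((1 / 16) ^ n)

/-- The weighted sum of the fourth powers of the increments along dyadic edges. -/
noncomputable def edgeSum (x : Plane → ℝ) (a b : ℤ) (m : ℕ) : ℝ≥0∞ :=
  ∑' n : ℕ, ENNReal.ofReal ((256 / 81) ^ n) * ∑ i ∈ gridIndex a m n, ∑ j ∈ gridIndex b m n,
    (‖x (dyad n (i + 1) j) - x (dyad n i j)‖ₑ ^ 4 + ‖x (dyad n i (j + 1)) - x (dyad n i j)‖ₑ ^ 4)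

/-- A single term is at most the whole sum, and 256/81 = (4/3)⁴ is the weight that turns fourth
powers into increments of order (3/4)ⁿ. -/
theorem edgeBound_of_edgeSum_le {x : Plane → ℝ} {a b : ℤ} {m : ℕ} {M : ℝ} (hM : 0 ≤ M)
    (h : edgeSum x a b m ≤ ENNReal.ofReal (M ^ 4)) : EdgeBound x a b m M := by
  intro n i hi j hj
  have key : ∀ d : ℝ, ENNReal.ofReal ((256 / 81) ^ n) * ‖d‖ₑ ^ 4 ≤ edgeSum x a b m →
      |d| ≤ M * (3 / 4) ^ n := by
    intro d hd
    have h1 := hd.trans h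
    rw [← ofReal_norm, ← ENNReal.ofReal_pow (norm_nonneg _), ← ENNReal.ofReal_mul (by positivity),
      ENNReal.ofReal_le_ofReal_iff (by positivity), Real.norm_eq_abs] at h1
    refine le_of_pow_le_pow_left₀ (n := 4) (by norm_num) (by positivity) ?_
    have e : (M * (3 / 4) ^ n) ^ 4 = M ^ 4 * (81 / 256) ^ n := by
      rw [mul_pow, ← pow_mul, mul_comm n 4, pow_mul]; norm_num
    have e' : ((256 : ℝ) / 81) ^ n * (81 / 256) ^ n = 1 := by rw [← mul_pow]; norm_num
    rw [e]
    calc |d| ^ 4 = ((256 : ℝ) / 81) ^ n * |d| ^ 4 * (81 / 256) ^ n := by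
          rw [mul_right_comm, e', one_mul]
      _ ≤ _ := mul_le_mul_of_nonneg_right h1 (by positivity)
  have hterm : ENNReal.ofReal ((256 / 81) ^ n) * (‖x (dyad n (i + 1) j) - x (dyad n i j)‖ₑ ^ 4 +
      ‖x (dyad n i (j + 1)) - x (dyad n i j)‖ₑ ^ 4) ≤ edgeSum x a b m := by
    refine le_trans ?_ (ENNReal.le_tsum n)
    refine mul_le_mul_right ?_ _
    refine le_trans ?_ (Finset.single_le_sum (f := fun i => ∑ j ∈ gridIndex b m n,
      (‖x (dyad n (i + 1) j) - x (dyad n i j)‖ₑ ^ 4 + ‖x (dyad n i (j + 1)) - x (dyad n i j)‖ₑ ^ 4))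
      (fun _ _ => zero_le) hi)
    exact Finset.single_le_sum (f := fun j =>
      (‖x (dyad n (i + 1) j) - x (dyad n i j)‖ₑ ^ 4 + ‖x (dyad n i (j + 1)) - x (dyad n i j)‖ₑ ^ 4))
      (fun _ _ => zero_le) hj
  exact ⟨key _ (le_trans (mul_le_mul_right le_self_add _) hterm),
    key _ (le_trans (mul_le_mul_right le_add_self _) hterm)⟩

theorem tsum_ofReal_geometric_ne_top : ∑' n : ℕ, ENNReal.ofReal ((64 / 81) ^ n) ≠ ∞ := by
  rw [← ENNReal.ofReal_tsum_of_nonneg (fun n => by positivity)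
    (summable_geometric_of_lt_one (by norm_num) (by norm_num))]
  exact ENNReal.ofReal_ne_top

namespace EdgeMoment

theorem aemeasurable_edgeSum (h : EdgeMoment P X L) (a b : ℤ) (m : ℕ) :
    AEMeasurable (fun ω => edgeSum (X ω) a b m) P := by
  have := h.aemeasurable
  unfold edgeSum
  fun_prop

/-- Level n contributes 2(m2ⁿ)² increments of fourth moment at most L/16ⁿ, with weight (256/81)ⁿ;
the resulting ratio 256/81 · 4/16 = 64/81 is below 1. -/
theorem lintegral_edgeSum_le (h : EdgeMoment P X L) (a b : ℤ) (m : ℕ) :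
    ∫⁻ ω, edgeSum (X ω) a b m ∂P ≤
      2 * m ^ 2 * L * ∑' n : ℕ, ENNReal.ofReal ((64 / 81) ^ n) := by
  have hm := h.aemeasurable
  unfold edgeSum
  rw [lintegral_tsum (fun n => by fun_prop), ← ENNReal.tsum_mul_left]
  refine ENNReal.tsum_le_tsum fun n => ?_
  rw [lintegral_const_mul'' _ (by fun_prop), lintegral_finsetSum' _ (by fun_prop)]
  have hcard : ∀ c : ℤ, ((gridIndex c m n).card : ℝ≥0∞) = m * 2 ^ n := by
    intro c
    have : (gridIndex c m n).card = m * 2 ^ n := by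
      rw [gridIndex, Int.card_Ico, add_mul, add_sub_cancel_left]
      norm_cast
    rw [this]; push_cast; rfl
  have hin : ∀ i ∈ gridIndex a m n, ∫⁻ ω, ∑ j ∈ gridIndex b m n,
      (‖X ω (dyad n (i + 1) j) - X ω (dyad n i j)‖ₑ ^ 4 +
        ‖X ω (dyad n i (j + 1)) - X ω (dyad n i j)‖ₑ ^ 4) ∂P ≤
      m * 2 ^ n * (2 * (L * ENNReal.ofReal ((1 / 16) ^ n))) := by
    intro i _
    rw [lintegral_finsetSum' _ (by fun_prop), ← hcard b, ← nsmul_eq_mul]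
    refine Finset.sum_le_card_nsmul _ _ _ fun j _ => ?_
    rw [lintegral_add_left' (by fun_prop), two_mul]
    exact add_le_add (h.horizontal n i j) (h.vertical n i j)
  have hout := Finset.sum_le_card_nsmul _ _ _ hin
  rw [nsmul_eq_mul, hcard a] at hout
  refine (mul_le_mul_right hout _).trans (le_of_eq ?_)
  have e : ENNReal.ofReal ((64 / 81) ^ n) = ENNReal.ofReal ((256 / 81) ^ n) * (2 ^ n * 2 ^ n) *
      ENNReal.ofReal ((1 / 16) ^ n) := by
    have : (2 : ℝ≥0∞) = ENNReal.ofReal 2 := by simp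
    rw [this, ← ENNReal.ofReal_pow (by norm_num), ← ENNReal.ofReal_mul (by positivity),
      ← ENNReal.ofReal_mul (by positivity), ← ENNReal.ofReal_mul (by positivity)]
    congr 1
    rw [← mul_pow, ← mul_pow, ← mul_pow]; norm_num
  rw [e]; ring

theorem ae_exists_edgeBound (h : EdgeMoment P X L) (hL : L ≠ ∞) :
    ∀ᵐ ω ∂P, ∀ a b m, ∃ M, 0 ≤ M ∧ EdgeBound (X ω) a b m M := by
  rw [ae_all_iff]; intro a
  rw [ae_all_iff]; intro b
  rw [ae_all_iff]; intro m
  have hfin : ∫⁻ ω, edgeSum (X ω) a b m ∂P ≠ ∞ := by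
    refine ne_top_of_le_ne_top ?_ (h.lintegral_edgeSum_le a b m)
    refine ENNReal.mul_ne_top (ENNReal.mul_ne_top ?_ hL) tsum_ofReal_geometric_ne_top
    exact ENNReal.mul_ne_top (by norm_num) (by simp)
  filter_upwards [ae_lt_top' (h.aemeasurable_edgeSum a b m) hfin] with ω hω
  -- The maximum with 1 ensures M ≤ M⁴, so M⁴ bounds the edge sum.
  refine ⟨max 1 (edgeSum (X ω) a b m).toReal, by positivity, edgeBound_of_edgeSum_le (by positivity) ?_⟩
  rw [← ENNReal.ofReal_toReal hω.ne]
  refine ENNReal.ofReal_le_ofReal ?_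
  rw [ENNReal.toReal_ofReal ENNReal.toReal_nonneg]
  refine (le_max_right 1 _).trans ?_
  exact le_self_pow₀ (le_max_left _ _) (by norm_num)

end EdgeMoment

end Random

section Fields
variable {Ω : Type*} [MeasurableSpace Ω] {P : Measure Ω} {W : PlaneL2 → Ω → ℝ}
  {G : Plane → ℝ} {X Y : Ω → Plane → ℝ}

theorem dyad_add_horizontal (n : ℕ) (i j : ℤ) :
    dyad n (i + 1) j = dyad n i j + (1 / 2 ^ n : ℝ) • basisVec 0 := by
  ext k; fin_cases k <;> simp [dyad, add_div]

theorem dyad_add_vertical (n : ℕ) (i j : ℤ) :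
    dyad n i (j + 1) = dyad n i j + (1 / 2 ^ n : ℝ) • basisVec 1 := by
  ext k; fin_cases k <;> simp [dyad, add_div]

/-- Shifts of G are Lipschitz in L², and Gaussian fourth moments are proportional to fourth powers
of L² norms, whence (2⁻ⁿ)⁴ = 16⁻ⁿ. -/
theorem IsVersion.edgeMoment (hW : IsWhiteNoise P W) {h0 : MemLp G 2 volume}
    (hX : IsVersion P W h0 X) (hG : ContDiff ℝ 1 G) (h1 : ∀ i, MemLp (_root_.partialD i G) 2 volume) :
    ∃ L : ℝ≥0∞, L ≠ ∞ ∧ EdgeMoment P X L := by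
  obtain ⟨K, hK, hKb⟩ := norm_shiftLp_sub_le hG h0 h1
  set C4 := ∫⁻ x, ‖x‖ₑ ^ 4 ∂(gaussianReal 0 1)
  have key : ∀ (n : ℕ) (z : Plane) (i : Fin 2),
      ∫⁻ ω, ‖X ω (z + (1 / 2 ^ n : ℝ) • basisVec i) - X ω z‖ₑ ^ 4 ∂P ≤
        (ENNReal.ofReal (K ^ 4) * C4) * ENNReal.ofReal ((1 / 16) ^ n) := by
    intro n z i
    set w := z + (1 / 2 ^ n : ℝ) • basisVec i with hw
    have e : ∫⁻ ω, ‖X ω w - X ω z‖ₑ ^ 4 ∂P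
        = ∫⁻ ω, ‖W (shiftLp h0 w - shiftLp h0 z) ω‖ₑ ^ 4 ∂P := by
      refine lintegral_congr_ae ?_
      filter_upwards [hX z, hX w, hW.sub_ae_eq (shiftLp h0 w) (shiftLp h0 z)] with ω a b c
      rw [a, b, c]
    rw [e, hW.lintegral_pow_four, mul_right_comm]
    refine mul_le_mul_left ?_ _
    have h2 : ‖shiftLp h0 w - shiftLp h0 z‖ ≤ K * (1 / 2 ^ n) := by
      refine (hKb w z).trans (le_of_eq ?_)
      rw [hw, add_sub_cancel_left, norm_smul]
      simp
    rw [← ofReal_norm, ← ENNReal.ofReal_pow (norm_nonneg _), ← ENNReal.ofReal_mul (by positivity)]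
    refine ENNReal.ofReal_le_ofReal ?_
    refine (pow_le_pow_left₀ (norm_nonneg _) h2 4).trans (le_of_eq ?_)
    rw [mul_pow, ← one_div_pow, ← pow_mul, mul_comm n 4, pow_mul]; norm_num
  refine ⟨ENNReal.ofReal (K ^ 4) * C4,
    ENNReal.mul_ne_top ENNReal.ofReal_ne_top lintegral_gaussianReal_pow_four_lt_top.ne,
    fun z => (hW.aemeasurable (shiftLp h0 z)).congr ?_, fun n i j => ?_, fun n i j => ?_⟩
  · filter_upwards [hX z] with ω h using h.symm
  · rw [dyad_add_horizontal]; exact key n _ 0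
  · rw [dyad_add_vertical]; exact key n _ 1

theorem gridBox_mem_nhds {a b : ℤ} {m : ℕ} {z : Plane} (h1 : (a : ℝ) < z 0) (h2 : z 0 < a + m)
    (h3 : (b : ℝ) < z 1) (h4 : z 1 < b + m) : gridBox a b m ∈ 𝓝 z := by
  have c0 : Continuous fun w : Plane => w 0 := by fun_prop
  have c1 : Continuous fun w : Plane => w 1 := by fun_prop
  filter_upwards [c0.continuousAt.eventually (lt_mem_nhds h1),
    c0.continuousAt.eventually (gt_mem_nhds h2), c1.continuousAt.eventually (lt_mem_nhds h3),
    c1.continuousAt.eventually (gt_mem_nhds h4)] with w a1 a2 a3 a4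
  exact ⟨a1.le, a2, a3.le, a4⟩

theorem exists_gridBox_mem_nhds (z : Plane) : ∃ a b m, gridBox a b m ∈ 𝓝 z := by
  refine ⟨⌊z 0⌋ - 1, ⌊z 1⌋ - 1, 3, gridBox_mem_nhds ?_ ?_ ?_ ?_⟩ <;> push_cast
  · linarith [Int.floor_le (z 0)]
  · linarith [Int.lt_floor_add_one (z 0)]
  · linarith [Int.floor_le (z 1)]
  · linarith [Int.lt_floor_add_one (z 1)]

/-- A convolution field whose kernel has square integrable derivatives has a continuous version. -/
theorem exists_continuous_version [IsFiniteMeasure P] (hW : IsWhiteNoise P W)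
    (h0 : MemLp G 2 volume) (hG : ContDiff ℝ 1 G) (h1 : ∀ i, MemLp (partialD i G) 2 volume) :
    ∃ X : Ω → Plane → ℝ, IsVersion P W h0 X ∧ ∀ᵐ ω ∂P, Continuous (X ω) := by
  have hV : IsVersion P W h0 (fun ω z => W (shiftLp h0 z) ω) := fun z => ae_of_all _ fun ω => rfl
  obtain ⟨L, hL, hmom⟩ := hV.edgeMoment hW hG h1
  have hE := hmom.ae_exists_edgeBound hL
  -- The version is the limit along dyadic approximations, which almost surely exists at all points
  -- simultaneously; at a fixed point it is W of the shift because shifts depend continuously on z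
  -- in L².
  set X : Ω → Plane → ℝ :=
    fun ω z => limUnder atTop (fun n => W (shiftLp h0 (dyadFloor n z)) ω) with hXdef
  have hlim : ∀ᵐ ω ∂P, ∀ z, Tendsto (fun n => W (shiftLp h0 (dyadFloor n z)) ω) atTop
      (𝓝 (X ω z)) := by
    filter_upwards [hE] with ω hω z
    obtain ⟨a, b, m, hz⟩ := exists_gridBox_mem_nhds z
    obtain ⟨M, hM, hb⟩ := hω a b m
    exact tendsto_nhds_limUnder (hb.exists_tendsto hM (mem_of_mem_nhds hz))
  refine ⟨X, fun z => ?_, ?_⟩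
  · refine hW.ae_eq_of_tendsto (Y := fun n ω => W (shiftLp h0 (dyadFloor n z)) ω)
      (fun n => EventuallyEq.rfl) ?_
      (((continuous_shiftLp hG h0 h1).tendsto z).comp (tendsto_dyadFloor z))
    filter_upwards [hlim] with ω hω using hω z
  · filter_upwards [hE, hlim] with ω hω hl
    rw [continuous_iff_continuousAt]
    intro z
    obtain ⟨a, b, m, hz⟩ := exists_gridBox_mem_nhds z
    obtain ⟨M, hM, hb⟩ := hω a b m
    exact hb.continuousAt_of_tendsto hM (fun w _ => hl w) hz

/-! ### Integration of fields along the axes -/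

theorem tendsto_riemann_sum {u : ℝ → ℝ} (hu : Continuous u) :
    Tendsto (fun n : ℕ => ∑ k ∈ Finset.range n, (1 / n : ℝ) * u (k / n)) atTop
      (𝓝 (∫ s in (0 : ℝ)..1, u s)) := by
  rw [Metric.tendsto_atTop]
  intro ε hε
  obtain ⟨δ, hδ, hunif⟩ := Metric.uniformContinuousOn_iff.1
    (isCompact_Icc.uniformContinuousOn_of_continuous (hu.continuousOn (s := Icc 0 1))) (ε / 2)
    (by positivity)
  obtain ⟨N, hN⟩ := exists_nat_gt (1 / δ)
  refine ⟨max N 1, fun n hn => ?_⟩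
  have hn1 : (1 : ℝ) ≤ n := by exact_mod_cast le_of_max_le_right hn
  have hn0 : (0 : ℝ) < n := by linarith
  have hnδ : 1 / (n : ℝ) < δ := by
    rw [div_lt_comm₀ hn0 hδ]
    exact hN.trans_le (by exact_mod_cast le_of_max_le_left hn)
  have hsum := intervalIntegral.sum_integral_adjacent_intervals (f := u) (μ := volume)
    (a := fun k : ℕ => (k : ℝ) / n) (n := n) (fun k _ => hu.intervalIntegrable _ _)
  simp only [Nat.cast_zero, zero_div, div_self hn0.ne'] at hsum
  rw [← hsum, Real.dist_eq, ← Finset.sum_sub_distrib]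
  have hb : ∀ k ∈ Finset.range n, |(1 / n : ℝ) * u (k / n) -
      ∫ s in ((k : ℝ) / n)..((k + 1 : ℕ) : ℝ) / n, u s| ≤ ε / 2 * (1 / n) := by
    intro k hk
    have hlen : ((k + 1 : ℕ) : ℝ) / n - (k : ℝ) / n = 1 / n := by push_cast; ring
    have hle : (k : ℝ) / n ≤ ((k + 1 : ℕ) : ℝ) / n := by
      rw [← sub_nonneg, hlen]; positivity
    have hk1 : ((k + 1 : ℕ) : ℝ) / n ≤ 1 := by
      rw [div_le_one hn0]; exact_mod_cast Finset.mem_range.1 hk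
    have hk0 : (0 : ℝ) ≤ k / n := by positivity
    have e : (1 / n : ℝ) * u (k / n) = ∫ _ in ((k : ℝ) / n)..((k + 1 : ℕ) : ℝ) / n, u (k / n) := by
      rw [intervalIntegral.integral_const, hlen, smul_eq_mul]
    rw [e, ← intervalIntegral.integral_sub (by simp) (hu.intervalIntegrable _ _), ← Real.norm_eq_abs]
    have := intervalIntegral.norm_integral_le_of_norm_le_const (a := (k : ℝ) / n)
      (b := ((k + 1 : ℕ) : ℝ) / n) (f := fun s => u (k / n) - u s) (C := ε / 2) (fun s hs => ?_)
    · rwa [hlen, abs_of_nonneg (by positivity : (0 : ℝ) ≤ 1 / n)] at this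
    · rw [uIoc_of_le hle] at hs
      rw [← dist_eq_norm]
      refine (hunif _ ⟨hk0, hle.trans hk1⟩ _ ⟨hk0.trans hs.1.le, hs.2.trans hk1⟩ ?_).le
      rw [Real.dist_eq, abs_sub_comm, abs_of_pos (by linarith [hs.1])]
      linarith [hs.2]
  refine (Finset.abs_sum_le_sum_abs _ _).trans_lt ((Finset.sum_le_sum hb).trans_lt ?_)
  rw [Finset.sum_const, Finset.card_range, nsmul_eq_mul]
  field_simp
  linarith

/-- The increment is telescoped over n steps of length t/n, each with a Taylor error of at most
(t/n)²C. -/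
theorem tendsto_sum_shiftLp {i : Fin 2} (hG : ContDiff ℝ 2 G) (h0 : MemLp G 2 volume)
    (h1 : MemLp (partialD i G) 2 volume) (h2 : MemLp (partialD i (partialD i G)) 2 volume)
    (z : Plane) (t : ℝ) :
    Tendsto (fun n : ℕ => ∑ k ∈ Finset.range n, (1 / n * t : ℝ) •
      shiftLp h1 (z + ((k / n : ℝ) * t) • basisVec i)) atTop
      (𝓝 (shiftLp h0 (z + t • basisVec i) - shiftLp h0 z)) := by
  set C := (eLpNorm (partialD i (partialD i G)) 2 volume).toReal
  have hlim : Tendsto (fun n : ℕ => t ^ 2 * C * (1 / (n : ℝ))) atTop (𝓝 0) := by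
    simpa using tendsto_one_div_atTop_nhds_zero_nat.const_mul (t ^ 2 * C)
  rw [tendsto_iff_norm_sub_tendsto_zero]
  refine squeeze_zero' (Eventually.of_forall fun _ => norm_nonneg _) ?_ hlim
  filter_upwards [eventually_gt_atTop 0] with n hn
  have hn0 : (0 : ℝ) < n := by exact_mod_cast hn
  set p : ℕ → Plane := fun k => z + ((k / n : ℝ) * t) • basisVec i with hp
  have hstep : ∀ k, p k + (1 / n * t : ℝ) • basisVec i = p (k + 1) := by
    intro k; simp only [hp]; push_cast; module
  have htel : shiftLp h0 (z + t • basisVec i) - shiftLp h0 z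
      = ∑ k ∈ Finset.range n, (shiftLp h0 (p (k + 1)) - shiftLp h0 (p k)) := by
    rw [Finset.sum_range_sub (fun k => shiftLp h0 (p k))]
    simp [hp, hn0.ne']
  rw [htel, ← Finset.sum_sub_distrib]
  refine (norm_sum_le _ _).trans ?_
  have hb : ∀ k ∈ Finset.range n, ‖(1 / n * t : ℝ) • shiftLp h1 (p k) -
      (shiftLp h0 (p (k + 1)) - shiftLp h0 (p k))‖ ≤ (1 / n * t) ^ 2 * C := by
    intro k _
    rw [norm_sub_rev, ← hstep]
    exact norm_shiftLp_taylor_le hG h0 h1 h2 (p k) _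
  refine (Finset.sum_le_sum hb).trans (le_of_eq ?_)
  rw [Finset.sum_const, Finset.card_range, nsmul_eq_mul]
  field_simp

theorem IsVersion.ae_sub_eq_integral [IsFiniteMeasure P] (hW : IsWhiteNoise P W) {i : Fin 2}
    (hG : ContDiff ℝ 2 G) {h0 : MemLp G 2 volume} {h1 : MemLp (_root_.partialD i G) 2 volume}
    (h2 : MemLp (_root_.partialD i (_root_.partialD i G)) 2 volume)
    (hX : IsVersion P W h0 X) (hY : IsVersion P W h1 Y) (hYc : ∀ᵐ ω ∂P, Continuous (Y ω))
    (z : Plane) (t : ℝ) :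
    ∀ᵐ ω ∂P, X ω (z + t • basisVec i) - X ω z
      = ∫ s in (0 : ℝ)..1, t * Y ω (z + (s * t) • basisVec i) := by
  have h := hW.ae_eq_of_tendsto
    (Y := fun n ω => ∑ k ∈ Finset.range n, (1 / n * t : ℝ) * Y ω (z + ((k / n : ℝ) * t) • basisVec i))
    (Z := fun ω => ∫ s in (0 : ℝ)..1, t * Y ω (z + (s * t) • basisVec i)) (fun n => ?_) ?_
    (tendsto_sum_shiftLp hG h0 h1 h2 z t)
  · filter_upwards [h, hX z, hX (z + t • basisVec i), hW.sub_ae_eq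
      (shiftLp h0 (z + t • basisVec i)) (shiftLp h0 z)] with ω a b c d
    rw [a, b, c, d]
  · filter_upwards [hW.sum_ae_eq (Finset.range n) (fun _ => (1 / n * t : ℝ))
      (fun k : ℕ => shiftLp h1 (z + ((k / n : ℝ) * t) • basisVec i)),
      ae_all_iff.2 fun k : ℕ => hY (z + ((k / n : ℝ) * t) • basisVec i)] with ω a b
    rw [a]
    simp_rw [b]
  · filter_upwards [hYc] with ω hω
    have := tendsto_riemann_sum (u := fun s => t * Y ω (z + (s * t) • basisVec i))
      (continuous_const.mul (hω.comp (by fun_prop)))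
    simpa only [mul_assoc] using this

/-- Here Y is not a derivative by definition, only a continuous version of the field with
differentiated kernel. The integral formula holds almost surely for each (z, t), hence on a
countable dense set, hence everywhere by continuity; the fundamental theorem of calculus concludes.
-/
theorem IsVersion.ae_hasDerivAt [IsFiniteMeasure P] (hW : IsWhiteNoise P W) {i : Fin 2}
    (hG : ContDiff ℝ 2 G) {h0 : MemLp G 2 volume} {h1 : MemLp (_root_.partialD i G) 2 volume}
    (h2 : MemLp (_root_.partialD i (_root_.partialD i G)) 2 volume)
    (hX : IsVersion P W h0 X) (hY : IsVersion P W h1 Y) (hXc : ∀ᵐ ω ∂P, Continuous (X ω))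
    (hYc : ∀ᵐ ω ∂P, Continuous (Y ω)) :
    ∀ᵐ ω ∂P, ∀ (z : Plane) (t : ℝ), HasDerivAt (fun t : ℝ => X ω (z + t • basisVec i))
      (Y ω (z + t • basisVec i)) t := by
  obtain ⟨D, hDc, hDd⟩ := TopologicalSpace.exists_countable_dense (Plane × ℝ)
  have hD : ∀ᵐ ω ∂P, ∀ p ∈ D, X ω (p.1 + p.2 • basisVec i) - X ω p.1
      = ∫ s in (0 : ℝ)..1, p.2 * Y ω (p.1 + (s * p.2) • basisVec i) :=
    (ae_ball_iff hDc).2 fun p _ => hX.ae_sub_eq_integral hW hG h2 hY hYc p.1 p.2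
  filter_upwards [hD, hXc, hYc] with ω hω hx hy z t
  have hall : (fun p : Plane × ℝ => X ω (p.1 + p.2 • basisVec i) - X ω p.1)
      = fun p : Plane × ℝ => ∫ s in (0 : ℝ)..1, p.2 * Y ω (p.1 + (s * p.2) • basisVec i) := by
    refine Continuous.ext_on hDd ?_ ?_ hω
    · exact (hx.comp (by fun_prop)).sub (hx.comp continuous_fst)
    · refine intervalIntegral.continuous_parametric_intervalIntegral_of_continuous' ?_ 0 1
      have : Continuous fun q : (Plane × ℝ) × ℝ => q.1.1 + (q.2 * q.1.2) • basisVec i := by fun_prop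
      exact (by fun_prop : Continuous fun q : (Plane × ℝ) × ℝ => q.1.2).mul (hy.comp this)
  have hint : (fun t : ℝ => X ω (z + t • basisVec i))
      = fun t : ℝ => X ω z + ∫ s in (0 : ℝ)..t, Y ω (z + s • basisVec i) := by
    ext t
    have h := congrFun hall (z, t)
    simp only [intervalIntegral.integral_const_mul] at h
    have h' := intervalIntegral.mul_integral_comp_mul_right (a := 0) (b := 1)
      (f := fun s => Y ω (z + s • basisVec i)) t
    rw [zero_mul, one_mul] at h'
    rw [← h', ← h]; ring
  rw [hint]
  have hc : Continuous fun s : ℝ => Y ω (z + s • basisVec i) := hy.comp (by fun_prop)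
  exact (intervalIntegral.integral_hasDerivAt_right (hc.intervalIntegrable 0 t)
    (hc.stronglyMeasurableAtFilter _ _) hc.continuousAt).const_add _

/-! ### Growth of convolution fields -/

/-- The edge sum of the unit box plus the fourth power at its corner has a mean bounded in a, so its
sum against 1/(a+1)² is almost surely finite and it is eventually at most (a+1)². Then M = √(a+1) is
an admissible chaining constant, and 7 = 1 + 6 counts the corner and the chain. -/
theorem IsVersion.ae_growth [IsFiniteMeasure P] (hW : IsWhiteNoise P W) {h0 : MemLp G 2 volume}
    (hX : IsVersion P W h0 X) (hG : ContDiff ℝ 1 G) (h1 : ∀ i, MemLp (_root_.partialD i G) 2 volume)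
    (hXc : ∀ᵐ ω ∂P, Continuous (X ω)) :
    ∀ᵐ ω ∂P, ∀ b : ℤ, ∀ᶠ a : ℕ in atTop, ∀ z ∈ gridBox a b 1, |X ω z| ≤ 7 * √(a + 1) := by
  obtain ⟨L, hL, hmom⟩ := hX.edgeMoment hW hG h1
  rw [ae_all_iff]; intro b
  set C4 := ∫⁻ x, ‖x‖ₑ ^ 4 ∂(gaussianReal 0 1)
  set D : ℝ≥0∞ := 2 * (1 : ℕ) ^ 2 * L * ∑' n : ℕ, ENNReal.ofReal ((64 / 81) ^ n)
    + ENNReal.ofReal (eLpNorm G 2 volume).toReal ^ 4 * C4 with hDdef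
  have hD : D ≠ ∞ := by
    refine ENNReal.add_ne_top.2 ⟨ENNReal.mul_ne_top (ENNReal.mul_ne_top (by simp) hL)
      tsum_ofReal_geometric_ne_top, ENNReal.mul_ne_top (ENNReal.pow_ne_top ENNReal.ofReal_ne_top)
        lintegral_gaussianReal_pow_four_lt_top.ne⟩
  set T : ℕ → Ω → ℝ≥0∞ := fun a ω => edgeSum (X ω) a b 1 + ‖X ω (dyad 0 a b)‖ₑ ^ 4 with hT
  have hTm : ∀ a, AEMeasurable (T a) P := fun a => by
    have := hmom.aemeasurable (dyad 0 a b)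
    exact (hmom.aemeasurable_edgeSum a b 1).add (by fun_prop)
  have hTint : ∀ a, ∫⁻ ω, T a ω ∂P ≤ D := by
    intro a
    rw [lintegral_add_left' (hmom.aemeasurable_edgeSum a b 1)]
    refine add_le_add (hmom.lintegral_edgeSum_le a b 1) ?_
    have e : ∫⁻ ω, ‖X ω (dyad 0 a b)‖ₑ ^ 4 ∂P = ∫⁻ ω, ‖W (shiftLp h0 (dyad 0 a b)) ω‖ₑ ^ 4 ∂P := by
      refine lintegral_congr_ae ?_
      filter_upwards [hX (dyad 0 a b)] with ω h
      rw [h]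
    rw [e, hW.lintegral_pow_four]
    refine mul_le_mul_left (pow_le_pow_left₀ zero_le ?_ 4) _
    rw [← ofReal_norm]
    exact ENNReal.ofReal_le_ofReal (norm_toLp_comp_sub_left_le hG.continuous h0 le_rfl _
      (h0.comp_sub_left _).coeFn_toLp)
  set c : ℕ → ℝ≥0∞ := fun a => ENNReal.ofReal (1 / ((a : ℝ) + 1) ^ 2) with hc
  have hcs : ∑' a, c a ≠ ∞ := by
    have : Summable fun a : ℕ => 1 / ((a : ℝ) + 1) ^ 2 := by
      have := (summable_nat_add_iff 1).2 (Real.summable_one_div_nat_pow.2 one_lt_two)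
      simpa using this
    rw [hc, ← ENNReal.ofReal_tsum_of_nonneg (fun n => by positivity) this]
    exact ENNReal.ofReal_ne_top
  have hfin : ∫⁻ ω, ∑' a, c a * T a ω ∂P ≠ ∞ := by
    rw [lintegral_tsum (fun a => (hTm a).const_mul _)]
    refine ne_top_of_le_ne_top (ENNReal.mul_ne_top hcs hD) ?_
    rw [← ENNReal.tsum_mul_right]
    refine ENNReal.tsum_le_tsum fun a => ?_
    rw [lintegral_const_mul'' _ (hTm a)]
    exact mul_le_mul_right (hTint a) _
  filter_upwards [ae_lt_top' (AEMeasurable.tsum fun a => (hTm a).const_mul _) hfin, hXc]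
    with ω hω hcont
  have hto := ENNReal.tendsto_atTop_zero_of_tsum_ne_top hω.ne
  filter_upwards [hto.eventually (gt_mem_nhds one_pos)] with a ha z hz
  have ha0 : (0 : ℝ) < (a : ℝ) + 1 := by positivity
  set M := √((a : ℝ) + 1) with hM
  have hM4 : M ^ 4 = ((a : ℝ) + 1) ^ 2 := by
    rw [show (4 : ℕ) = 2 * 2 by norm_num, pow_mul, Real.sq_sqrt ha0.le]
  have hTa : T a ω ≤ ENNReal.ofReal (M ^ 4) := by
    rw [hM4]
    have e1 : ENNReal.ofReal (((a : ℝ) + 1) ^ 2) * c a = 1 := by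
      rw [hc, ← ENNReal.ofReal_mul (by positivity), mul_one_div_cancel (by positivity),
        ENNReal.ofReal_one]
    calc T a ω = ENNReal.ofReal (((a : ℝ) + 1) ^ 2) * (c a * T a ω) := by
          rw [← mul_assoc, e1, one_mul]
      _ ≤ ENNReal.ofReal (((a : ℝ) + 1) ^ 2) * 1 := mul_le_mul_right ha.le _
      _ = _ := mul_one _
  have hedge : EdgeBound (X ω) a b 1 M :=
    edgeBound_of_edgeSum_le (Real.sqrt_nonneg _) (le_self_add.trans hTa)
  have hcorner : |X ω (dyad 0 a b)| ≤ M := by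
    have h := le_add_self.trans hTa
    rw [← ofReal_norm, ← ENNReal.ofReal_pow (norm_nonneg _),
      ENNReal.ofReal_le_ofReal_iff (by positivity), Real.norm_eq_abs] at h
    exact le_of_pow_le_pow_left₀ (n := 4) (by norm_num) (Real.sqrt_nonneg _) h
  have h := hedge.abs_sub_le_of_tendsto (Real.sqrt_nonneg _) hz
    ((hcont.tendsto z).comp (tendsto_dyadFloor z)) 0
  have hfl : dyadFloor 0 z = dyad 0 a b := by
    have e0 : ⌊z 0⌋ = (a : ℤ) := by
      rw [Int.floor_eq_iff]; exact ⟨hz.1, by simpa using hz.2.1⟩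
    have e1 : ⌊z 1⌋ = b := by
      rw [Int.floor_eq_iff]; exact ⟨hz.2.2.1, by simpa using hz.2.2.2⟩
    simp [dyadFloor, e0, e1]
  rw [hfl, pow_zero, mul_one] at h
  rw [abs_le] at h hcorner ⊢
  constructor <;> linarith

/-- Finitely many rows of unit boxes cover |y| ≤ K, and the growth √x is absorbed by half of the
slope ℓx. -/
theorem IsVersion.ae_decay [IsFiniteMeasure P] (hW : IsWhiteNoise P W) {h0 : MemLp G 2 volume}
    (hX : IsVersion P W h0 X) (hG : ContDiff ℝ 1 G) (h1 : ∀ i, MemLp (_root_.partialD i G) 2 volume)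
    (hXc : ∀ᵐ ω ∂P, Continuous (X ω)) {l : ℝ} (hl : 0 < l) :
    ∀ᵐ ω ∂P, ∀ K : ℝ, ∃ c > 0, ∃ R, ∀ x ≥ R, ∀ y, |y| ≤ K → X ω (pt x y) - l * x ≤ -c * x := by
  filter_upwards [hX.ae_growth hW hG h1 hXc] with ω hω K
  have hev : ∀ᶠ a : ℕ in atTop, ∀ b ∈ Finset.Icc (-⌈K⌉ - 1) ⌈K⌉, ∀ z ∈ gridBox a b 1,
      |X ω z| ≤ 7 * √(a + 1) := (Finset.eventually_all _).2 fun b _ => hω b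
  obtain ⟨N, hN⟩ := eventually_atTop.1 hev
  -- 392 = 2 · 14²: as ⌊x⌋ + 1 ≤ 2x for x ≥ 1, the bound 7√(2x) ≤ ℓx/2 amounts to x ≥ 392/ℓ².
  refine ⟨l / 2, by positivity, max (max N 1) (392 / l ^ 2), fun x hx y hy => ?_⟩
  have hx1 : (1 : ℝ) ≤ x := (le_max_right _ _).trans ((le_max_left _ _).trans hx)
  have hxN : (N : ℝ) ≤ x := (le_max_left _ _).trans ((le_max_left _ _).trans hx)
  have hxl : 392 / l ^ 2 ≤ x := (le_max_right _ _).trans hx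
  have hx0 : 0 ≤ x := by linarith
  rw [abs_le] at hy
  have h := hN ⌊x⌋₊ (Nat.le_floor hxN) ⌊y⌋ (by
    rw [Finset.mem_Icc]
    constructor
    · rw [Int.le_floor]; push_cast; linarith [Int.le_ceil K]
    · exact_mod_cast (Int.floor_le y).trans (hy.2.trans (Int.le_ceil K))) (pt x y)
    ⟨by simpa using Nat.floor_le hx0, by simpa using Nat.lt_floor_add_one x,
      by simpa using Int.floor_le y, by simp⟩
  have hs : 7 * √((⌊x⌋₊ : ℝ) + 1) ≤ l / 2 * x := by
    have h1 : √((⌊x⌋₊ : ℝ) + 1) ≤ l / 14 * x := by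
      refine Real.sqrt_le_iff.2 ⟨by positivity, ?_⟩
      have := Nat.floor_le hx0
      rw [div_le_iff₀ (by positivity)] at hxl
      nlinarith
    linarith
  linarith [le_abs_self (X ω (pt x y))]

end Fields

/-! ### Small ball estimates -/

theorem gaussianReal_closedBall_le {v : NNReal} {c : ℝ} (hc : 0 < c) (hv : c ^ 2 ≤ v) (s r : ℝ) :
    gaussianReal 0 v (Metric.closedBall s r) ≤ ENNReal.ofReal (2 * r / c) := by
  have hv0 : v ≠ 0 := by
    rintro rfl
    have : 0 < c ^ 2 := by positivity
    simp at hv; linarith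
  rw [gaussianReal_apply 0 hv0]
  have hb : ∀ x, gaussianPDF 0 v x ≤ ENNReal.ofReal (1 / c) := by
    intro x
    refine ENNReal.ofReal_le_ofReal ?_
    rw [gaussianPDFReal, one_div]
    have h1 : c ≤ √(2 * Real.pi * v) := by
      refine Real.le_sqrt_of_sq_le (hv.trans ?_)
      have := Real.pi_gt_three
      have hv' : (0 : ℝ) ≤ v := v.2
      nlinarith
    refine (mul_le_of_le_one_right (by positivity) ?_).trans (inv_anti₀ hc h1)
    rw [Real.exp_le_one_iff]
    exact div_nonpos_of_nonpos_of_nonneg (by nlinarith [sq_nonneg (x - 0)]) (by positivity)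
  refine (lintegral_mono hb).trans ?_
  rw [lintegral_const, Measure.restrict_apply_univ, Real.volume_closedBall,
    ← ENNReal.ofReal_mul (by positivity)]
  exact ENNReal.ofReal_le_ofReal (by rw [one_div_mul_eq_div])

section SmallBall
variable {Ω : Type*} [MeasurableSpace Ω] {P : Measure Ω} {W : PlaneL2 → Ω → ℝ}

theorem IsWhiteNoise.indepFun_of_inner_eq_zero (hW : IsWhiteNoise P W) {k : ℕ} {u : PlaneL2}
    {l : Fin k → PlaneL2} (h : ∀ j, inner ℝ u (l j) = 0) :
    IndepFun (W u) (fun ω j => W (l j) ω) P := by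
  have hP := hW.gaussian.isProbabilityMeasure
  have hg : IsGaussianProcess (Sum.elim (fun _ : Unit => W u) (fun j => W (l j))) P := by
    have := hW.gaussian.comp_right (Sum.elim (fun _ : Unit => u) l)
    rwa [Sum.comp_elim] at this
  have hi := hg.indepFun_of_covariance_eq_zero (fun _ => hW.aemeasurable u)
    (fun j => hW.aemeasurable (l j)) (fun _ j => by
      rw [covariance_eq_sub (hW.memLp_two _) (hW.memLp_two _), hW.centered, zero_mul, sub_zero]
      exact (hW.covariance _ _).trans (h j))
  exact hi.comp (φ := fun x : Unit → ℝ => x ()) (ψ := id) (by fun_prop) measurable_id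

/-- Induction on k: the part u of the first kernel orthogonal to the others gives a Gaussian W(u)
independent of the rest, with standard deviation at least c. Once the other values are fixed, the
first constraint puts W(u) in an interval of length 2r₀. -/
theorem IsWhiteNoise.measure_forall_abs_sub_le (hW : IsWhiteNoise P W) {c : ℝ} (hc : 0 < c) :
    ∀ {k : ℕ} (l : Fin k → PlaneL2), (∀ a : Fin k → ℝ, c * ‖a‖ ≤ ‖∑ j, a j • l j‖) →
    ∀ m r : Fin k → ℝ, P {ω | ∀ j, |W (l j) ω - m j| ≤ r j} ≤ ∏ j, ENNReal.ofReal (2 * r j / c) := by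
  have hP := hW.gaussian.isProbabilityMeasure
  intro k
  induction k with
  | zero => intro l _ m r; simp
  | succ k ih =>
    intro l hl m r
    set l' : Fin k → PlaneL2 := fun j => l j.succ with hl'
    have htail : ∀ a : Fin k → ℝ, c * ‖a‖ ≤ ‖∑ j, a j • l' j‖ := by
      intro a
      have := hl (Fin.cons 0 a)
      rw [Fin.sum_univ_succ] at this
      simp only [Fin.cons_zero, zero_smul, zero_add, Fin.cons_succ] at this
      refine le_trans (mul_le_mul_of_nonneg_left ?_ hc.le) this
      refine (pi_norm_le_iff_of_nonneg (norm_nonneg _)).2 fun j => ?_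
      simpa using norm_le_pi_norm (Fin.cons 0 a : Fin (k + 1) → ℝ) j.succ
    set V : Submodule ℝ PlaneL2 := Submodule.span ℝ (range l') with hV
    have : FiniteDimensional ℝ V := FiniteDimensional.span_of_finite ℝ (finite_range l')
    obtain ⟨b, hb⟩ := (Submodule.mem_span_range_iff_exists_fun ℝ).1
      (V.starProjection_apply_mem (l 0))
    set u : PlaneL2 := l 0 - ∑ j, b j • l' j with hu
    have horth : ∀ j, inner ℝ u (l' j) = 0 := by
      intro j
      rw [hu, hb]
      exact V.starProjection_inner_eq_zero (l 0) (l' j) (Submodule.subset_span ⟨j, rfl⟩)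
    -- The coefficient vector (1, −b) has supremum norm at least 1.
    have hun : c ≤ ‖u‖ := by
      have := hl (Fin.cons 1 (fun j => -b j))
      rw [Fin.sum_univ_succ] at this
      simp only [Fin.cons_zero, one_smul, Fin.cons_succ, neg_smul, Finset.sum_neg_distrib,
        ← sub_eq_add_neg] at this
      refine le_trans (le_mul_of_one_le_right hc.le ?_) this
      simpa using norm_le_pi_norm (Fin.cons 1 (fun j => -b j) : Fin (k + 1) → ℝ) 0
    set Y : Ω → Fin k → ℝ := fun ω j => W (l' j) ω with hY
    have hYm : AEMeasurable Y P := aemeasurable_pi_lambda _ fun j => hW.aemeasurable (l' j)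
    set B : Set (Fin k → ℝ) := {y | ∀ j, |y j - m j.succ| ≤ r j.succ} with hB
    have hBm : MeasurableSet B := by
      rw [hB, ofPred_forall]
      exact MeasurableSet.iInter fun j => measurableSet_le (by fun_prop) (by fun_prop)
    set E : Set (ℝ × (Fin k → ℝ)) := {p | |p.1 + ∑ j, b j * p.2 j - m 0| ≤ r 0 ∧ p.2 ∈ B} with hE
    have hEm : MeasurableSet E :=
      MeasurableSet.inter (s₁ := {p : ℝ × (Fin k → ℝ) | |p.1 + ∑ j, b j * p.2 j - m 0| ≤ r 0})
        (measurableSet_le (by fun_prop) (by fun_prop)) (measurable_snd hBm)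
    have hPB : P (Y ⁻¹' B) ≤ ∏ j : Fin k, ENNReal.ofReal (2 * r j.succ / c) :=
      ih l' htail (fun j => m j.succ) (fun j => r j.succ)
    have hle : P {ω | ∀ j, |W (l j) ω - m j| ≤ r j} ≤ P ((fun ω => (W u ω, Y ω)) ⁻¹' E) := by
      refine measure_mono_ae ?_
      filter_upwards [hW.sub_ae_eq (l 0) (∑ j, b j • l' j), hW.sum_ae_eq Finset.univ b l']
        with ω h1 h2 h
      refine ⟨?_, fun j => h j.succ⟩
      have := h 0
      simp only [hY]
      rwa [h1, h2, sub_add_cancel]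
    refine hle.trans ?_
    rw [← Measure.map_apply_of_aemeasurable ((hW.aemeasurable u).prodMk hYm) hEm,
      (indepFun_iff_map_prod_eq_prod_map_map (hW.aemeasurable u) hYm).1
        (hW.indepFun_of_inner_eq_zero horth), hW.map_eq]
    have : IsProbabilityMeasure (P.map Y) := Measure.isProbabilityMeasure_map hYm
    rw [Measure.prod_apply_symm hEm, Fin.prod_univ_succ]
    have hpt : ∀ y, gaussianReal 0 (‖u‖₊ ^ 2) ((fun x => (x, y)) ⁻¹' E) ≤
        B.indicator (fun _ => ENNReal.ofReal (2 * r 0 / c)) y := by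
      intro y
      by_cases hy : y ∈ B
      · rw [indicator_of_mem hy]
        refine le_trans (measure_mono fun x hx => ?_) (gaussianReal_closedBall_le hc ?_
          (m 0 - ∑ j, b j * y j) (r 0))
        · rw [Metric.mem_closedBall, Real.dist_eq]
          have := hx.1
          simp only at this
          rwa [← sub_add, add_sub_right_comm] at *
        · push_cast
          exact pow_le_pow_left₀ hc.le hun 2
      · rw [indicator_of_notMem hy]
        refine le_of_eq (measure_mono_null (fun x hx => hy hx.2) measure_empty)
    refine (lintegral_mono hpt).trans ?_
    rw [lintegral_indicator hBm, lintegral_const, Measure.restrict_apply_univ,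
      Measure.map_apply_of_aemeasurable hYm hBm]
    exact mul_le_mul_right hPB _

/-- Independence at p₀ is a quantitative lower bound, and half of it survives a small perturbation
of the vectors. This makes the small ball constant uniform near p₀. -/
theorem exists_eventually_mul_norm_le {T : Type*} [TopologicalSpace T] {k : ℕ}
    {l : T → Fin k → PlaneL2} {p₀ : T} (hl : ContinuousAt l p₀)
    (hind : LinearIndependent ℝ (l p₀)) :
    ∃ c > 0, ∀ᶠ p in 𝓝 p₀, ∀ a : Fin k → ℝ, c * ‖a‖ ≤ ‖∑ j, a j • l p j‖ := by
  have hinj : LinearMap.ker (Fintype.linearCombination ℝ (l p₀)) = ⊥ := by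
    rw [LinearMap.ker_eq_bot]
    exact hind.fintypeLinearCombination_injective
  obtain ⟨K, hK, hanti⟩ := LinearMap.exists_antilipschitzWith _ hinj
  have hlow : ∀ a : Fin k → ℝ, (K : ℝ)⁻¹ * ‖a‖ ≤ ‖∑ j, a j • l p₀ j‖ := by
    intro a
    have := hanti.le_mul_dist a 0
    simp only [dist_zero_right, map_zero, Fintype.linearCombination_apply] at this
    rwa [inv_mul_le_iff₀ (by exact_mod_cast hK)]
  have hK' : (0 : ℝ) < K := by exact_mod_cast hK
  set ε : ℝ := (K : ℝ)⁻¹ / (2 * (k + 1)) with hε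
  have hε0 : 0 < ε := by positivity
  refine ⟨(K : ℝ)⁻¹ / 2, by positivity, ?_⟩
  filter_upwards [Metric.continuousAt_iff'.1 hl ε hε0] with p hp a
  have hd : ‖∑ j, a j • l p₀ j - ∑ j, a j • l p j‖ ≤ (K : ℝ)⁻¹ / 2 * ‖a‖ := by
    rw [← Finset.sum_sub_distrib]
    refine (norm_sum_le _ _).trans ?_
    have hj : ∀ j ∈ Finset.univ, ‖a j • l p₀ j - a j • l p j‖ ≤ ‖a‖ * ε := by
      intro j _
      rw [← smul_sub, norm_smul]
      refine mul_le_mul (norm_le_pi_norm a j) ?_ (norm_nonneg _) (norm_nonneg _)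
      rw [norm_sub_rev, ← dist_eq_norm]
      exact (dist_le_pi_dist (l p) (l p₀) j).trans hp.le
    refine (Finset.sum_le_sum hj).trans ?_
    rw [Finset.sum_const, Finset.card_univ, Fintype.card_fin, nsmul_eq_mul, hε]
    have : (k : ℝ) / (k + 1) ≤ 1 := by rw [div_le_one (by positivity)]; linarith
    calc (k : ℝ) * (‖a‖ * ((K : ℝ)⁻¹ / (2 * (k + 1)))) = (K : ℝ)⁻¹ / 2 * ‖a‖ * (k / (k + 1)) := by
          field_simp
      _ ≤ _ := mul_le_of_le_one_right (by positivity) this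
  have := hlow a
  have h3 := norm_sub_norm_le (∑ j, a j • l p₀ j) (∑ j, a j • l p j)
  linarith

end SmallBall

/-! ### Absence of common zeros -/

section CommonZeros
variable {Ω : Type*} [MeasurableSpace Ω] {P : Measure Ω} {d : ℕ}
  {F : Fin d → Ω → (Fin d → ℝ) → ℝ} {κ : Ω → (Fin d → ℝ) → ℝ}

/-- The half-open cube of half-side `ε` centred at `p₀`. -/
def halfOpenCube (p₀ : Fin d → ℝ) (ε : ℝ) : Set (Fin d → ℝ) :=
  {p | ∀ i, p₀ i - ε ≤ p i ∧ p i < p₀ i + ε}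

/-- The points of a regular grid of `N ^ d` points in a cube. -/
noncomputable def cubeGrid (p₀ : Fin d → ℝ) (ε : ℝ) (N : ℕ) (k : Fin d → Fin N) : Fin d → ℝ :=
  fun i => p₀ i - ε + 2 * ε * (k i : ℕ) / N

theorem cubeGrid_mem_closedBall (p₀ : Fin d → ℝ) {ε : ℝ} (hε : 0 < ε) {N : ℕ}
    (k : Fin d → Fin N) : cubeGrid p₀ ε N k ∈ Metric.closedBall p₀ ε := by
  rw [Metric.mem_closedBall, dist_pi_le_iff hε.le]
  intro i
  have hk := (k i).2
  have hN : (0 : ℝ) < N := by exact_mod_cast (Nat.zero_le _).trans_lt hk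
  have h1 : 2 * ε * ((k i : ℕ) : ℝ) / N ≤ 2 * ε := by
    rw [div_le_iff₀ hN]
    have : ((k i : ℕ) : ℝ) ≤ N := by exact_mod_cast hk.le
    exact mul_le_mul_of_nonneg_left this (by positivity)
  have h0 : 0 ≤ 2 * ε * ((k i : ℕ) : ℝ) / N := by positivity
  rw [Real.dist_eq, cubeGrid, abs_le]
  constructor <;> linarith

theorem exists_norm_cubeGrid_sub_le {p₀ : Fin d → ℝ} {ε : ℝ} (hε : 0 < ε) {N : ℕ} (hN : 0 < N)
    {p : Fin d → ℝ} (hp : p ∈ halfOpenCube p₀ ε) :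
    ∃ k : Fin d → Fin N, ‖cubeGrid p₀ ε N k - p‖ ≤ 2 * ε / N := by
  have hN' : (0 : ℝ) < N := by exact_mod_cast hN
  have h0 : ∀ i, 0 ≤ (p i - p₀ i + ε) * N / (2 * ε) := fun i => by
    have := (hp i).1
    have : 0 ≤ p i - p₀ i + ε := by linarith
    positivity
  refine ⟨fun i => ⟨⌊(p i - p₀ i + ε) * N / (2 * ε)⌋₊, ?_⟩, ?_⟩
  · rw [Nat.floor_lt (h0 i), div_lt_iff₀ (by positivity), mul_comm]
    have := (hp i).2
    exact mul_lt_mul_of_pos_left (by linarith) hN'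
  · refine (pi_norm_le_iff_of_nonneg (by positivity)).2 fun i => ?_
    set s := (p i - p₀ i + ε) * N / (2 * ε) with hs
    have e : p i = p₀ i - ε + 2 * ε * s / N := by rw [hs]; field_simp; ring
    have e2 : (cubeGrid p₀ ε N (fun i => ⟨⌊(p i - p₀ i + ε) * N / (2 * ε)⌋₊, by
        rw [Nat.floor_lt (h0 i), div_lt_iff₀ (by positivity), mul_comm]
        have := (hp i).2
        exact mul_lt_mul_of_pos_left (by linarith) hN'⟩) - p) i = 2 * ε / N * (⌊s⌋₊ - s) := by
      rw [Pi.sub_apply, e, cubeGrid]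
      ring
    rw [e2, Real.norm_eq_abs, abs_mul, abs_of_nonneg (by positivity : 0 ≤ 2 * ε / N)]
    refine mul_le_of_le_one_right (by positivity) ?_
    rw [abs_le]
    constructor <;> linarith [Nat.floor_le (h0 i), Nat.lt_floor_add_one s]

/-- Union bound over a grid of N^d points of mesh at most s. Each point costs C(2nε/N)^d δ, so N
cancels: the bound does not depend on s and the factor δ survives. -/
theorem measure_exists_small_le {p₀ : Fin d → ℝ} {ε : ℝ} (hε : 0 < ε) {C : ℝ≥0∞}
    (hsb : ∀ p ∈ Metric.closedBall p₀ ε, ∀ ρ δ : ℝ, 0 ≤ ρ → 0 ≤ δ →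
      P {ω | (∀ i, |F i ω p| ≤ ρ) ∧ |κ ω p| ≤ δ} ≤ C * ENNReal.ofReal (ρ ^ d) * ENNReal.ofReal δ)
    (n : ℕ) {s δ : ℝ} (hs : 0 < s) (hδ : 0 ≤ δ) :
    P {ω | ∃ p ∈ halfOpenCube p₀ ε, ∀ p', ‖p' - p‖ ≤ s →
      (∀ i, |F i ω p'| ≤ n * ‖p' - p‖) ∧ |κ ω p'| ≤ δ} ≤
      C * ENNReal.ofReal ((n * (2 * ε)) ^ d) * ENNReal.ofReal δ := by
  obtain ⟨N, hN⟩ := exists_nat_gt (2 * ε / s)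
  have hN0 : (0 : ℝ) < N := lt_trans (by positivity) hN
  have hNpos : 0 < N := by exact_mod_cast hN0
  have hNs : 2 * ε / N ≤ s := by
    rw [div_lt_comm₀ (by positivity) (by positivity)] at hN
    exact hN.le
  calc P {ω | ∃ p ∈ halfOpenCube p₀ ε, ∀ p', ‖p' - p‖ ≤ s →
        (∀ i, |F i ω p'| ≤ n * ‖p' - p‖) ∧ |κ ω p'| ≤ δ}
      ≤ P (⋃ k : Fin d → Fin N, {ω | (∀ i, |F i ω (cubeGrid p₀ ε N k)| ≤ n * (2 * ε / N)) ∧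
          |κ ω (cubeGrid p₀ ε N k)| ≤ δ}) := by
        refine measure_mono fun ω => ?_
        rintro ⟨p, hp, h⟩
        obtain ⟨k, hk⟩ := exists_norm_cubeGrid_sub_le hε hNpos hp
        obtain ⟨h1, h2⟩ := h _ (hk.trans hNs)
        refine mem_iUnion.2 ⟨k, fun i => (h1 i).trans ?_, h2⟩
        exact mul_le_mul_of_nonneg_left hk (Nat.cast_nonneg n)
    _ ≤ ∑ k : Fin d → Fin N, C * ENNReal.ofReal ((n * (2 * ε / N)) ^ d) * ENNReal.ofReal δ := by
        refine (measure_iUnion_fintype_le _ _).trans (Finset.sum_le_sum fun k _ => ?_)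
        exact hsb _ (cubeGrid_mem_closedBall p₀ hε k) _ _ (by positivity) hδ
    _ = C * ENNReal.ofReal ((n * (2 * ε)) ^ d) * ENNReal.ofReal δ := by
        rw [Finset.sum_const, Finset.card_univ, Fintype.card_fun, Fintype.card_fin,
          Fintype.card_fin, nsmul_eq_mul]
        have : ((N ^ d : ℕ) : ℝ≥0∞) = ENNReal.ofReal ((N : ℝ) ^ d) := by
          rw [← ENNReal.ofReal_natCast]; push_cast; rfl
        rw [this, ← mul_assoc, mul_left_comm, ← ENNReal.ofReal_mul (by positivity), ← mul_pow]
        congr 4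
        field_simp

/-- Bulinskaya's lemma, local version: `d` differentiable functions and one continuous function of
`d` real parameters have almost surely no common zero. -/
theorem exists_nhds_ae_not_common_zero {p₀ : Fin d → ℝ}
    (hF : ∀ᵐ ω ∂P, ∀ i p, (fun p' => F i ω p' - F i ω p) =O[𝓝 p] fun p' => p' - p)
    (hκ : ∀ᵐ ω ∂P, Continuous (κ ω)) {C : ℝ≥0∞} (hC : C ≠ ∞)
    (hsb : ∀ᶠ p in 𝓝 p₀, ∀ ρ δ : ℝ, 0 ≤ ρ → 0 ≤ δ →
      P {ω | (∀ i, |F i ω p| ≤ ρ) ∧ |κ ω p| ≤ δ} ≤ C * ENNReal.ofReal (ρ ^ d) * ENNReal.ofReal δ) :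
    ∃ U ∈ 𝓝 p₀, ∀ᵐ ω ∂P, ∀ p ∈ U, (∀ i, F i ω p = 0) → κ ω p ≠ 0 := by
  obtain ⟨ε, hε, hball⟩ := Metric.nhds_basis_closedBall.mem_iff.1 hsb
  refine ⟨halfOpenCube p₀ ε, ?_, ?_⟩
  · refine mem_of_superset (Metric.ball_mem_nhds p₀ hε) fun p hp i => ?_
    have := (dist_le_pi_dist p p₀ i).trans_lt hp
    rw [Real.dist_eq, abs_lt] at this
    constructor <;> linarith
  -- n bounds the local Lipschitz constants at the zero, 1/(j+1) the size of κ, and 1/(m+1) is the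
  -- radius where both hold. A common zero puts ω, for some n, in ⋃ₘ Z n j m for every j.
  set Z : ℕ → ℕ → ℕ → Set Ω := fun n j m => {ω | ∃ p ∈ halfOpenCube p₀ ε, ∀ p',
    ‖p' - p‖ ≤ 1 / ((m : ℝ) + 1) → (∀ i, |F i ω p'| ≤ n * ‖p' - p‖) ∧ |κ ω p'| ≤ 1 / ((j : ℝ) + 1)}
  have hmono : ∀ n j, Monotone (Z n j) := by
    rintro n j m m' hm ω ⟨p, hp, h⟩
    refine ⟨p, hp, fun p' hp' => h p' (hp'.trans ?_)⟩
    exact one_div_le_one_div_of_le (by positivity) (by exact_mod_cast Nat.succ_le_succ hm)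
  have hnull : ∀ n, P (⋂ j, ⋃ m, Z n j m) = 0 := by
    intro n
    have hb : ∀ j : ℕ, P (⋂ j, ⋃ m, Z n j m) ≤
        C * ENNReal.ofReal ((n * (2 * ε)) ^ d) * ENNReal.ofReal (1 / ((j : ℝ) + 1)) := by
      intro j
      refine (measure_mono (iInter_subset _ j)).trans ?_
      -- Continuity from below along a monotone family requires no measurability of the sets.
      rw [(hmono n j).measure_iUnion]
      exact iSup_le fun m => measure_exists_small_le hε hball n (by positivity) (by positivity)
    have hlim : Tendsto (fun j : ℕ => C * ENNReal.ofReal ((n * (2 * ε)) ^ d) *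
        ENNReal.ofReal (1 / ((j : ℝ) + 1))) atTop (𝓝 0) := by
      have h1 := ENNReal.tendsto_ofReal (tendsto_one_div_add_atTop_nhds_zero_nat (𝕜 := ℝ))
      rw [ENNReal.ofReal_zero] at h1
      have h2 := ENNReal.Tendsto.const_mul (a := C * ENNReal.ofReal ((n * (2 * ε)) ^ d)) h1
        (Or.inr (ENNReal.mul_ne_top hC ENNReal.ofReal_ne_top))
      rwa [mul_zero] at h2
    exact le_antisymm (ge_of_tendsto' hlim hb) (zero_le (a := P _))
  have hnull' : ∀ᵐ ω ∂P, ∀ n, ω ∉ ⋂ j, ⋃ m, Z n j m := by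
    rw [ae_all_iff]
    exact fun n => measure_eq_zero_iff_ae_notMem.1 (hnull n)
  filter_upwards [hF, hκ, hnull'] with ω h1 h2 h3 p hp hz hk
  have hO : ∃ n : ℕ, ∀ᶠ p' in 𝓝 p, ∀ i, |F i ω p'| ≤ n * ‖p' - p‖ := by
    choose c hc using fun i => (h1 i p).bound
    obtain ⟨n, hn⟩ := exists_nat_ge (∑ i, |c i|)
    refine ⟨n, (eventually_all.2 hc).mono fun p' h i => ?_⟩
    have := h i
    rw [hz i, sub_zero, Real.norm_eq_abs] at this
    refine this.trans (mul_le_mul_of_nonneg_right ?_ (norm_nonneg _))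
    exact (le_abs_self _).trans ((Finset.single_le_sum (f := fun i => |c i|)
      (fun _ _ => abs_nonneg _) (Finset.mem_univ i)).trans hn)
  obtain ⟨n, hn⟩ := hO
  refine h3 n (mem_iInter.2 fun j => ?_)
  have hkj : ∀ᶠ p' in 𝓝 p, |κ ω p'| ≤ 1 / ((j : ℝ) + 1) := by
    have : |κ ω p| < 1 / ((j : ℝ) + 1) := by rw [hk, abs_zero]; positivity
    exact (h2.abs.continuousAt.eventually (gt_mem_nhds this)).mono fun _ h => h.le
  obtain ⟨s, hs, hsub⟩ := Metric.nhds_basis_closedBall.mem_iff.1 (hn.and hkj)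
  obtain ⟨m, hm⟩ := exists_nat_one_div_lt hs
  refine mem_iUnion.2 ⟨m, p, hp, fun p' hp' => ?_⟩
  exact hsub (by rw [Metric.mem_closedBall, dist_eq_norm]; exact hp'.trans hm.le)

end CommonZeros

/-- A family of `d + 1` Gaussian functions of `d` real parameters, `d` of which are differentiable,
has almost surely no common zero on an open set where it is nondegenerate. -/
theorem IsWhiteNoise.ae_not_common_zero {Ω : Type*} [MeasurableSpace Ω] {P : Measure Ω}
    {W : PlaneL2 → Ω → ℝ} (hW : IsWhiteNoise P W) {d : ℕ} {F : Fin (d + 1) → Ω → (Fin d → ℝ) → ℝ}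
    {l : (Fin d → ℝ) → Fin (d + 1) → PlaneL2} {m : (Fin d → ℝ) → Fin (d + 1) → ℝ}
    (hl : Continuous l) (hver : ∀ p i, ∀ᵐ ω ∂P, F i ω p = W (l p i) ω - m p i)
    (hF : ∀ᵐ ω ∂P, ∀ (i : Fin d) p,
      (fun p' => F i.castSucc ω p' - F i.castSucc ω p) =O[𝓝 p] fun p' => p' - p)
    (hκ : ∀ᵐ ω ∂P, Continuous (F (Fin.last d) ω)) {V : Set (Fin d → ℝ)}
    (hV : ∀ p ∈ V, LinearIndependent ℝ (l p)) :
    ∀ᵐ ω ∂P, ∀ p ∈ V, ∃ i, F i ω p ≠ 0 := by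
  have hloc : ∀ p₀ ∈ V, ∃ U ∈ 𝓝 p₀, ∀ᵐ ω ∂P, ∀ p ∈ U, (∀ i : Fin d, F i.castSucc ω p = 0) →
      F (Fin.last d) ω p ≠ 0 := by
    intro p₀ hp₀
    obtain ⟨c, hc, hev⟩ := exists_eventually_mul_norm_le hl.continuousAt (hV p₀ hp₀)
    refine exists_nhds_ae_not_common_zero (C := ENNReal.ofReal (2 / c) ^ (d + 1)) hF hκ
      (ENNReal.pow_ne_top ENNReal.ofReal_ne_top) ?_
    filter_upwards [hev] with p hp ρ δ hρ hδ
    have h := hW.measure_forall_abs_sub_le hc (l p) hp (m p) (Fin.snoc (fun _ => ρ) δ)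
    rw [Fin.prod_univ_castSucc] at h
    simp only [Fin.snoc_castSucc, Fin.snoc_last, Finset.prod_const, Finset.card_univ,
      Fintype.card_fin] at h
    refine le_trans (measure_mono_ae ?_) (h.trans (le_of_eq ?_))
    · filter_upwards [ae_all_iff.2 (hver p)] with ω hω hin j
      rw [← hω j]
      induction j using Fin.lastCases with
      | last => simpa using hin.2
      | cast i => simpa using hin.1 i
    · rw [mul_div_right_comm, mul_div_right_comm, ENNReal.ofReal_mul (by positivity),
        ENNReal.ofReal_mul (by positivity), mul_pow, ENNReal.ofReal_pow hρ]
      ring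
  choose! U hU hUae using hloc
  -- Countably many local neighbourhoods cover V, so their null sets can be united.
  obtain ⟨t, htV, htc, hcov⟩ := TopologicalSpace.countable_cover_nhdsWithin
    (fun p hp => mem_nhdsWithin_of_mem_nhds (hU p hp) : ∀ p ∈ V, U p ∈ 𝓝[V] p)
  filter_upwards [(ae_ball_iff htc).2 fun p hp => hUae p (htV hp)] with ω hω p hp
  obtain ⟨p₀, hp₀, hpU⟩ := mem_iUnion₂.1 (hcov hp)
  by_contra! hcon
  exact hω p₀ hp₀ p hpU (fun i => hcon _) (hcon _)

/-! ### Exponential polynomials -/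

theorem tendsto_eval_mul_exp_neg (p : Polynomial ℂ) {c : ℝ} (hc : 0 < c) :
    Tendsto (fun τ : ℝ => p.eval (-Complex.I * τ) * Complex.exp (-(c * τ : ℝ))) atTop (𝓝 0) := by
  have hterm : ∀ n : ℕ, Tendsto (fun τ : ℝ => p.coeff n * (-Complex.I * τ) ^ n *
      Complex.exp (-(c * τ : ℝ))) atTop (𝓝 0) := by
    intro n
    rw [tendsto_zero_iff_norm_tendsto_zero]
    have h1 := (isLittleO_pow_exp_pos_mul_atTop n hc).tendsto_div_nhds_zero
    have h2 := h1.const_mul ‖p.coeff n‖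
    rw [mul_zero] at h2
    refine h2.congr' ?_
    filter_upwards [eventually_ge_atTop 0] with τ hτ
    rw [norm_mul, norm_mul, norm_pow, norm_mul, norm_neg, Complex.norm_I, one_mul,
      Complex.norm_real, Real.norm_of_nonneg hτ, ← Complex.ofReal_neg, Complex.norm_exp_ofReal,
      Real.exp_neg, mul_assoc, div_eq_mul_inv]
  have := tendsto_finsetSum (Finset.range (p.natDegree + 1)) fun n _ => hterm n
  simp only [Finset.sum_const_zero] at this
  refine this.congr fun τ => ?_
  rw [Polynomial.eval_eq_sum_range, Finset.sum_mul]

theorem polynomial_eq_zero_of_tendsto {p : Polynomial ℂ}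
    (h : Tendsto (fun τ : ℝ => p.eval (-Complex.I * τ)) atTop (𝓝 0)) : p = 0 := by
  by_cases hd : 0 < p.degree
  · have hz : Tendsto (fun τ : ℝ => ‖-Complex.I * (τ : ℂ)‖) atTop atTop := by
      refine tendsto_abs_atTop_atTop.congr fun τ => ?_
      rw [norm_mul, norm_neg, Complex.norm_I, one_mul, Complex.norm_real, Real.norm_eq_abs]
    exact absurd h.norm (not_tendsto_nhds_of_tendsto_atTop (p.tendsto_norm_atTop hd hz) _)
  · rw [Polynomial.eq_C_of_degree_le_zero (not_lt.1 hd)] at h ⊢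
    simp only [Polynomial.eval_C] at h
    rw [tendsto_nhds_unique tendsto_const_nhds h, map_zero]

/-- Divided by the fastest exponential, all other terms tend to 0; the polynomial in front of it
tends to 0 along a ray, so it vanishes. Induction removes the exponents from the largest down. -/
theorem polynomial_eq_zero_of_sum_exp_eq_zero {ι : Type*} {a : ι → ℝ} (ha : a.Injective)
    {p : ι → Polynomial ℂ} (s : Finset ι)
    (h : ∀ τ : ℝ, ∑ i ∈ s, (p i).eval (-Complex.I * τ) * Complex.exp (a i * τ : ℝ) = 0) :
    ∀ i ∈ s, p i = 0 := by
  classical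
  induction s using Finset.induction_on_max_value a with
  | empty => simp
  | insert i s hi hmax ih =>
    have hlt : ∀ j ∈ s, 0 < a i - a j := fun j hj => sub_pos.2 <|
      lt_of_le_of_ne (hmax j hj) fun e => hi (ha e ▸ hj)
    have hpi : p i = 0 := by
      refine polynomial_eq_zero_of_tendsto ?_
      have := tendsto_finsetSum s fun j hj => tendsto_eval_mul_exp_neg (p j) (hlt j hj)
      simp only [Finset.sum_const_zero] at this
      have h2 := this.neg
      rw [neg_zero] at h2
      refine h2.congr fun τ => ?_
      have hτ := h τ
      rw [Finset.sum_insert hi] at hτ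
      have hexp : ∀ j, Complex.exp (-((a i - a j) * τ : ℝ)) =
          Complex.exp (a j * τ : ℝ) * Complex.exp (-(a i * τ : ℝ)) := by
        intro j
        rw [← Complex.exp_add]; congr 1; push_cast; ring
      have hone : Complex.exp (a i * τ : ℝ) * Complex.exp (-(a i * τ : ℝ)) = 1 := by
        rw [← Complex.exp_add, add_neg_cancel, Complex.exp_zero]
      have hs : ∑ j ∈ s, (p j).eval (-Complex.I * τ) * Complex.exp (-((a i - a j) * τ : ℝ)) =
          (∑ j ∈ s, (p j).eval (-Complex.I * τ) * Complex.exp (a j * τ : ℝ)) *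
            Complex.exp (-(a i * τ : ℝ)) := by
        rw [Finset.sum_mul]
        exact Finset.sum_congr rfl fun j _ => by rw [hexp, mul_assoc]
      rw [hs, eq_neg_of_add_eq_zero_right hτ, neg_mul, neg_neg, mul_assoc, hone, mul_one]
    intro j hj
    rcases Finset.mem_insert.1 hj with rfl | hj
    · exact hpi
    · refine ih (fun τ => ?_) j hj
      have hτ := h τ
      rwa [Finset.sum_insert hi, hpi, Polynomial.eval_zero, zero_mul, zero_add] at hτ

/-- The sum is entire, so it vanishes identically as soon as it does near a real point. At −iτ the
oscillating exponentials become real ones with distinct growth rates. -/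
theorem polynomial_eq_zero_of_sum_cexp_eq_zero {ι : Type*} {a : ι → ℝ} (ha : a.Injective)
    {p : ι → Polynomial ℂ} (s : Finset ι) {t₀ : ℝ}
    (h : ∀ᶠ t : ℝ in 𝓝 t₀, ∑ i ∈ s, (p i).eval (t : ℂ) * Complex.exp (a i * t * Complex.I) = 0) :
    ∀ i ∈ s, p i = 0 := by
  refine polynomial_eq_zero_of_sum_exp_eq_zero ha s fun τ => ?_
  set Φ : ℂ → ℂ := fun w => ∑ i ∈ s, (p i).eval w * Complex.exp (a i * w * Complex.I) with hΦ
  have hdiff : Differentiable ℂ Φ := by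
    refine Differentiable.fun_sum fun i _ => ((p i).differentiable).mul ?_
    fun_prop
  have han : AnalyticOnNhd ℂ Φ univ := fun w _ => hdiff.analyticAt w
  have hfreq : ∃ᶠ w in 𝓝[≠] (t₀ : ℂ), Φ w = (fun _ => (0 : ℂ)) w := by
    have ht : Tendsto (fun t : ℝ => (t : ℂ)) (𝓝[≠] t₀) (𝓝[≠] (t₀ : ℂ)) := by
      refine tendsto_nhdsWithin_iff.2 ⟨?_, ?_⟩
      · exact (Complex.continuous_ofReal.tendsto t₀).mono_left nhdsWithin_le_nhds
      · filter_upwards [self_mem_nhdsWithin] with t ht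
        simpa using ht
    exact ht.frequently (h.filter_mono nhdsWithin_le_nhds).frequently
  have hzero := han.eq_of_frequently_eq analyticOnNhd_const hfreq
  have := congrFun hzero (-Complex.I * τ)
  simp only [hΦ] at this
  rw [← this]
  refine Finset.sum_congr rfl fun i _ => ?_
  congr 2
  push_cast
  linear_combination ((a i : ℂ) * τ) * Complex.I_mul_I

/-! ### Fourier transform of functions on the plane -/

open scoped FourierTransform

/-- The Fourier transform of a real function on the plane. -/
noncomputable def planeFourier (u : Plane → ℝ) : Plane → ℂ := 𝓕 fun x => (u x : ℂ)

theorem planeFourier_eq (u : Plane → ℝ) (ξ : Plane) :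
    planeFourier u ξ = ∫ x, (Real.fourierChar (-inner ℝ x ξ) : ℂ) * u x := by
  rw [planeFourier, Real.fourier_eq]
  rfl

theorem integrable_fourierChar_mul {u : Plane → ℝ} (hu : Integrable u) (ξ : Plane) :
    Integrable fun x => (Real.fourierChar (-inner ℝ x ξ) : ℂ) * u x :=
  (Real.fourierIntegral_convergent_iff ξ).2 hu.ofReal

theorem planeFourier_sum {ι : Type*} (s : Finset ι) (c : ι → ℝ) {u : ι → Plane → ℝ}
    (hu : ∀ i ∈ s, Integrable (u i)) (ξ : Plane) :
    planeFourier (fun x => ∑ i ∈ s, c i * u i x) ξ = ∑ i ∈ s, c i * planeFourier (u i) ξ := by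
  simp_rw [planeFourier_eq, ← integral_const_mul]
  rw [← integral_finsetSum s fun i hi => (integrable_fourierChar_mul (hu i hi) ξ).const_mul _]
  refine integral_congr_ae (ae_of_all _ fun x => ?_)
  simp only
  push_cast
  rw [Finset.mul_sum]
  exact Finset.sum_congr rfl fun i _ => by ring

theorem planeFourier_comp_add_left (u : Plane → ℝ) (a ξ : Plane) :
    planeFourier (fun x => u (a + x)) ξ = Real.fourierChar (inner ℝ a ξ) * planeFourier u ξ := by
  rw [planeFourier_eq, planeFourier_eq, ← integral_const_mul,
    ← integral_add_left_eq_self (μ := volume) (fun x => (Real.fourierChar (inner ℝ a ξ) : ℂ) *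
      ((Real.fourierChar (-inner ℝ x ξ) : ℂ) * u x)) a]
  refine integral_congr_ae (ae_of_all _ fun x => ?_)
  simp only
  rw [← mul_assoc, ← Circle.coe_mul, ← AddChar.map_add_eq_mul, inner_add_left]
  congr 4
  ring

theorem planeFourier_partialD {u : Plane → ℝ} (hu : Integrable u) (hd : Differentiable ℝ u)
    (h : ∀ i, Integrable (partialD i u)) (i : Fin 2) (ξ : Plane) :
    planeFourier (partialD i u) ξ = 2 * Real.pi * Complex.I * ξ i * planeFourier u ξ := by
  have hder : ∀ x, HasFDerivAt (fun x => (u x : ℂ)) (Complex.ofRealCLM ∘L fderiv ℝ u x) x :=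
    fun x => Complex.ofRealCLM.hasFDerivAt.comp x (hd x).hasFDerivAt
  have hfd : fderiv ℝ (fun x => (u x : ℂ)) = fun x => Complex.ofRealCLM ∘L fderiv ℝ u x :=
    funext fun x => (hder x).fderiv
  have hdec : fderiv ℝ u = fun x => partialD 0 u x • (EuclideanSpace.proj 0 : Plane →L[ℝ] ℝ)
      + partialD 1 u x • (EuclideanSpace.proj 1 : Plane →L[ℝ] ℝ) := by
    ext x v
    have hv : v = v 0 • basisVec 0 + v 1 • basisVec 1 := by
      ext k; fin_cases k <;> simp
    conv_lhs => rw [hv, map_add, map_smul, map_smul]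
    simp [partialD, mul_comm]
  have hint : Integrable (fderiv ℝ u) := by
    rw [hdec]
    have i0 : Integrable fun x => partialD 0 u x • (EuclideanSpace.proj 0 : Plane →L[ℝ] ℝ) :=
      (h 0).smul_const _
    have i1 : Integrable fun x => partialD 1 u x • (EuclideanSpace.proj 1 : Plane →L[ℝ] ℝ) :=
      (h 1).smul_const _
    exact MeasureTheory.Integrable.add (ε' := StrongDual ℝ Plane) i0 i1
  have hint' : Integrable (fderiv ℝ fun x => (u x : ℂ)) := by
    rw [hfd]
    exact (ContinuousLinearMap.compL ℝ Plane ℝ ℂ Complex.ofRealCLM).integrable_comp hint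
  have h1 := Real.fourier_fderiv (f := fun x => (u x : ℂ)) hu.ofReal
    (fun x => (hder x).differentiableAt) hint'
  have h2 := Real.fourier_continuousLinearMap_apply (v := ξ) (a := basisVec i) hint'
  rw [h1] at h2
  have h3 : planeFourier (partialD i u) ξ
      = 𝓕 (fun x => fderiv ℝ (fun x => (u x : ℂ)) x (basisVec i)) ξ := by
    rw [hfd]; rfl
  rw [h3, ← h2, VectorFourier.fourierSMulRight_apply, planeFourier]
  have h4 : innerSL ℝ ξ (basisVec i) = ξ i := by
    change inner ℝ ξ (basisVec i) = _
    simp [EuclideanSpace.inner_single_right]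
  simp [h4, mul_assoc]

theorem continuous_planeFourier {u : Plane → ℝ} (hu : Integrable u) : Continuous (planeFourier u) :=
  VectorFourier.fourierIntegral_continuous Real.continuous_fourierChar
    (by exact continuous_inner) hu.ofReal

theorem eq_zero_of_planeFourier_eq_zero {u : Plane → ℝ} (hu : Integrable u) (hc : Continuous u)
    (h : planeFourier u = 0) : u = 0 := by
  have h0 : 𝓕 (fun x => (u x : ℂ)) = 0 := h
  have := Continuous.fourierInv_fourier_eq (f := fun x => (u x : ℂ))
    (Complex.continuous_ofReal.comp hc) hu.ofReal (by rw [h0]; exact integrable_zero _ _ _)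
  ext x
  have hx := congrFun this x
  rw [h0] at hx
  rw [Real.fourierInv_eq] at hx
  simpa using hx.symm

/-! ### Nondegeneracy of the kernel -/

namespace KernelAssumption
variable {q : Plane → ℝ}

theorem contDiff_nat (hq : KernelAssumption q) : ContDiff ℝ (4 : ℕ) q := by
  exact_mod_cast hq.contDiff

theorem continuous_multiD (hq : KernelAssumption q) {a b : ℕ} (h : a + b ≤ 4) :
    Continuous (multiD a b q) :=
  (contDiff_multiD hq.contDiff_nat (m := 4 - (a + b)) (by omega)).continuous

/-- Continuity covers the unit disc. Only β > 2 is retained, which is what integrability on the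
plane requires. -/
theorem exists_abs_multiD_le (hq : KernelAssumption q) :
    ∃ β : ℝ, 2 < β ∧ ∀ a b : ℕ, a + b ≤ 2 → ∃ C, ∀ z, |multiD a b q z| ≤ C * (1 + ‖z‖) ^ (-β) := by
  obtain ⟨β, hβ, C, hC, hdec⟩ := hq.decay
  refine ⟨β, by linarith, fun a b hab => ?_⟩
  obtain ⟨B, hB⟩ := (isCompact_closedBall (0 : Plane) 1).exists_bound_of_continuousOn
    (hq.continuous_multiD (a := a) (b := b) (by omega)).continuousOn
  have h2 : ∀ z : Plane, (1 + ‖z‖) ^ (-β) = 1 / (1 + ‖z‖) ^ β := fun z => by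
    rw [Real.rpow_neg (by positivity), one_div]
  refine ⟨max B C * 2 ^ β, fun z => ?_⟩
  have hM : 0 ≤ max B C := hC.le.trans (le_max_right _ _)
  rw [h2, mul_one_div]
  rcases le_total ‖z‖ 1 with hz | hz
  · have := hB z (by simpa using hz)
    rw [Real.norm_eq_abs] at this
    refine (this.trans (le_max_left B C)).trans ?_
    rw [le_div_iff₀ (by positivity)]
    exact mul_le_mul_of_nonneg_left
      (Real.rpow_le_rpow (by positivity) (by linarith) (by linarith)) hM
  · refine (hdec a b hab z hz).trans ?_
    have hz0 : 0 < ‖z‖ := by linarith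
    rw [div_le_div_iff₀ (by positivity) (by positivity), mul_assoc,
      ← Real.mul_rpow (by norm_num) hz0.le]
    exact mul_le_mul (le_max_right _ _)
      (Real.rpow_le_rpow (by positivity) (by linarith) (by linarith)) (by positivity) hM

theorem integrable_multiD (hq : KernelAssumption q) {a b : ℕ} (h : a + b ≤ 2) :
    Integrable (multiD a b q) := by
  obtain ⟨β, hβ, hall⟩ := hq.exists_abs_multiD_le
  obtain ⟨C, hC⟩ := hall a b h
  refine Integrable.mono' ((integrable_one_add_norm (E := Plane) (μ := volume) (r := β)
    (by simpa using hβ)).const_mul C)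
    (hq.continuous_multiD (by omega)).aestronglyMeasurable (ae_of_all _ hC)

theorem tendsto_multiD (hq : KernelAssumption q) {a b : ℕ} (h : a + b ≤ 2) (z : Plane) :
    Tendsto (fun t : ℝ => multiD a b q (z + t • basisVec 0)) atTop (𝓝 0) := by
  obtain ⟨β, hβ, hall⟩ := hq.exists_abs_multiD_le
  obtain ⟨C, hC⟩ := hall a b h
  have hn : Tendsto (fun t : ℝ => 1 + ‖z + t • basisVec 0‖) atTop atTop := by
    refine tendsto_atTop_mono (f := fun t : ℝ => t + -‖z‖) (fun t => ?_)
      (tendsto_atTop_add_const_right _ _ tendsto_id)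
    have h1 := norm_sub_norm_le (t • basisVec 0) (-z)
    rw [norm_smul, norm_neg, sub_neg_eq_add, add_comm (t • _) z] at h1
    simp only [PiLp.norm_single, norm_one, mul_one] at h1
    have h2 := le_abs_self t
    rw [Real.norm_eq_abs] at h1
    linarith
  have h1 := ((tendsto_rpow_neg_atTop (by linarith : 0 < β)).comp hn).const_mul C
  rw [mul_zero] at h1
  exact squeeze_zero_norm (fun t => hC _) h1

theorem partialD_one_eq (hq : KernelAssumption q) {a b : ℕ} (h : a + b ≤ 3) :
    partialD 1 (multiD a b q) = multiD a (b + 1) q :=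
  partialD_one_multiD hq.contDiff_nat a b (by omega)

theorem contDiff_one_multiD (hq : KernelAssumption q) {a b : ℕ} (h : a + b ≤ 3) :
    ContDiff ℝ 1 (multiD a b q) :=
  (contDiff_multiD hq.contDiff_nat (m := 4 - (a + b)) (by omega)).of_le (by norm_cast; omega)

theorem contDiff_two_multiD (hq : KernelAssumption q) {a b : ℕ} (h : a + b ≤ 2) :
    ContDiff ℝ 2 (multiD a b q) :=
  (contDiff_multiD hq.contDiff_nat (m := 4 - (a + b)) (by omega)).of_le (by norm_cast; omega)

theorem planeFourier_multiD (hq : KernelAssumption q) {a b : ℕ} (h : a + b ≤ 2) (ξ : Plane) :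
    planeFourier (multiD a b q) ξ = (2 * Real.pi * Complex.I * ξ 0) ^ a *
      (2 * Real.pi * Complex.I * ξ 1) ^ b * planeFourier q ξ := by
  have step : ∀ a b, a + b ≤ 1 → ∀ i, planeFourier (partialD i (multiD a b q)) ξ =
      2 * Real.pi * Complex.I * ξ i * planeFourier (multiD a b q) ξ := by
    intro a b hab i
    refine planeFourier_partialD (hq.integrable_multiD (by omega))
      ((hq.contDiff_one_multiD (by omega)).differentiable one_ne_zero) (fun i => ?_) i ξ
    fin_cases i
    · change Integrable (partialD 0 (multiD a b q))
      rw [partialD_zero_multiD]; exact hq.integrable_multiD (by omega)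
    · change Integrable (partialD 1 (multiD a b q))
      rw [hq.partialD_one_eq (by omega)]; exact hq.integrable_multiD (by omega)
  induction a with
  | zero =>
    induction b with
    | zero => simp [multiD]
    | succ b ih =>
      rw [← hq.partialD_one_eq (by omega), step 0 b (by omega), ih (by omega), pow_succ]; ring
  | succ a ih =>
    rw [← partialD_zero_multiD, step a b (by omega), ih (by omega), pow_succ]; ring

/-- Otherwise q = 0 by Fourier inversion, against the positivity of (q ∗ q)(0). -/
theorem exists_planeFourier_ne_zero (hq : KernelAssumption q) : ∃ ξ, planeFourier q ξ ≠ 0 := by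
  by_contra! h
  have h0 : q = 0 := eq_zero_of_planeFourier_eq_zero
    (hq.integrable_multiD (a := 0) (b := 0) (by norm_num)) hq.contDiff.continuous (funext h)
  have := hq.conv_pos
  rw [h0] at this
  simp [convolution_zero] at this

/-- The orders in the first variable of the derivatives of the kernel combined at each point. -/
def jetX : Fin 5 → ℕ := ![0, 1, 0, 2, 1]

/-- The orders in the second variable of the derivatives of the kernel combined at each point. -/
def jetY : Fin 5 → ℕ := ![0, 0, 1, 0, 1]

theorem jet_le (k : Fin 5) : jetX k + jetY k ≤ 2 := by revert k; decide

theorem jet_coeff_eq_zero {d : Fin 5 → ℂ}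
    (h : ∑ k, Polynomial.C (d k) * Polynomial.X ^ jetX k = 0) :
    d 0 + d 2 = 0 ∧ d 1 + d 4 = 0 ∧ d 3 = 0 := by
  have e := fun n => congrArg (fun p => Polynomial.coeff p n) h
  simp only [Fin.sum_univ_five, Polynomial.coeff_add, Polynomial.coeff_C_mul,
    Polynomial.coeff_X_pow, Polynomial.coeff_zero, jetX] at e
  have e0 := e 0
  have e1 := e 1
  have e2 := e 2
  simp at e0 e1 e2
  exact ⟨e0, e1, e2⟩

/-- The Fourier transform of the relation is that of q times an exponential polynomial in the
frequency. Near a point where the former does not vanish the latter must, and the abscissae being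
distinct separates the points. -/
theorem jet_eq_zero_of_sum_eq_zero (hq : KernelAssumption q) {n : ℕ} {a : Fin n → ℝ}
    (ha : a.Injective) (y : ℝ) {c : Fin n → Fin 5 → ℝ}
    (h : ∀ x, ∑ i, ∑ k, c i k * multiD (jetX k) (jetY k) q (pt (a i) y + x) = 0) : c = 0 := by
  set κ : ℂ := 2 * Real.pi * Complex.I with hκ
  have hκ0 : κ ≠ 0 := Complex.two_pi_I_ne_zero
  have hfour : ∀ ξ : Plane, planeFourier q ξ * ∑ i, (Real.fourierChar (inner ℝ (pt (a i) y) ξ) : ℂ) *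
      ∑ k, (c i k : ℂ) * ((κ * ξ 0) ^ jetX k * (κ * ξ 1) ^ jetY k) = 0 := by
    intro ξ
    have hi : ∀ (i : Fin n) (k : Fin 5),
        Integrable fun x => multiD (jetX k) (jetY k) q (pt (a i) y + x) :=
      fun i k => (hq.integrable_multiD (jet_le k)).comp_add_left _
    have h1 : planeFourier (fun x => ∑ p : Fin n × Fin 5, c p.1 p.2 *
        multiD (jetX p.2) (jetY p.2) q (pt (a p.1) y + x)) ξ = 0 := by
      have : (fun x => ∑ p : Fin n × Fin 5, c p.1 p.2 *
          multiD (jetX p.2) (jetY p.2) q (pt (a p.1) y + x)) = fun _ => 0 := by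
        ext x
        rw [← h x, Fintype.sum_prod_type]
      rw [this, planeFourier_eq]
      simp
    rw [planeFourier_sum _ (fun p : Fin n × Fin 5 => c p.1 p.2) fun p _ => hi p.1 p.2,
      Fintype.sum_prod_type] at h1
    rw [← h1, Finset.mul_sum]
    refine Finset.sum_congr rfl fun i _ => ?_
    rw [Finset.mul_sum, Finset.mul_sum]
    refine Finset.sum_congr rfl fun k _ => ?_
    simp only
    rw [planeFourier_comp_add_left, hq.planeFourier_multiD (jet_le k)]
    ring
  obtain ⟨ξ₀, hξ₀⟩ := hq.exists_planeFourier_ne_zero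
  have hcont : Continuous fun p : ℝ × ℝ => planeFourier q (pt p.1 p.2) :=
    (continuous_planeFourier (hq.integrable_multiD (a := 0) (b := 0) (by norm_num))).comp
      (by fun_prop)
  have hne : ∀ᶠ p : ℝ × ℝ in 𝓝 (ξ₀ 1, ξ₀ 0), planeFourier q (pt p.2 p.1) ≠ 0 := by
    refine (hcont.comp continuous_swap).continuousAt.eventually_ne ?_
    simpa [pt_eta] using hξ₀
  -- The second frequency η is frozen; in the first one the exponentials have the distinct rates
  -- 2πaᵢ and the jets at each point give a polynomial.
  have hpoly : ∀ᶠ η : ℝ in 𝓝 (ξ₀ 1), ∀ i, ∑ k, Polynomial.C ((c i k : ℂ) *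
      (κ ^ jetX k * (κ * η) ^ jetY k)) * Polynomial.X ^ jetX k = 0 := by
    rw [nhds_prod_eq] at hne
    filter_upwards [hne.curry] with η hη i
    have hinj : Function.Injective fun i => 2 * Real.pi * a i := fun i j hij =>
      ha (mul_left_cancel₀ (by positivity) hij)
    refine polynomial_eq_zero_of_sum_cexp_eq_zero hinj (p := fun i => ∑ k, Polynomial.C
      ((c i k : ℂ) * (κ ^ jetX k * (κ * η) ^ jetY k)) * Polynomial.X ^ jetX k)
      Finset.univ (t₀ := ξ₀ 0) ?_ i
      (Finset.mem_univ i)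
    filter_upwards [hη] with s hs
    have h1 := (mul_eq_zero.1 (hfour (pt s η))).resolve_left hs
    have hexp : ∀ i, (Real.fourierChar (inner ℝ (pt (a i) y) (pt s η)) : ℂ) =
        Complex.exp (((2 * Real.pi * a i : ℝ) : ℂ) * s * Complex.I) *
          Complex.exp (κ * (y * η)) := by
      intro i
      have : inner ℝ (pt (a i) y) (pt s η) = a i * s + y * η := by
        simp [PiLp.inner_apply, Fin.sum_univ_two, mul_comm]
      rw [this, Real.fourierChar_apply, ← Complex.exp_add]
      congr 1
      push_cast
      rw [hκ]
      ring
    have h2 : (∑ i, (∑ k, Polynomial.C ((c i k : ℂ) * (κ ^ jetX k * (κ * η) ^ jetY k)) *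
        Polynomial.X ^ jetX k).eval (s : ℂ) *
          Complex.exp (((2 * Real.pi * a i : ℝ) : ℂ) * s * Complex.I)) *
          Complex.exp (κ * (y * η)) = 0 := by
      rw [← h1, Finset.sum_mul]
      refine Finset.sum_congr rfl fun i _ => ?_
      rw [hexp, Polynomial.eval_finsetSum, mul_assoc, mul_comm]
      congr 1
      refine Finset.sum_congr rfl fun k _ => ?_
      simp only [Polynomial.eval_mul, Polynomial.eval_C, Polynomial.eval_pow, Polynomial.eval_X,
        pt_zero, pt_one]
      ring
    exact (mul_eq_zero.1 h2).resolve_right (Complex.exp_ne_zero _)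
  obtain ⟨ε, hε, hball⟩ := Metric.eventually_nhds_iff.1 hpoly
  -- In the first frequency alone, the value and ∂₂ have the same degree, and so do ∂₁ and ∂₁∂₂. Two
  -- values of η tell them apart.
  have hA := hball (y := ξ₀ 1) (by simpa using hε)
  have hB := hball (y := ξ₀ 1 + ε / 2) (by
    rw [Real.dist_eq, add_sub_cancel_left, abs_of_pos (by positivity)]; linarith)
  have hε' : (ε : ℂ) ≠ 0 := by exact_mod_cast hε.ne'
  funext i k
  have coefs : ∀ η : ℝ, ∑ k, Polynomial.C ((c i k : ℂ) *
      (κ ^ jetX k * (κ * η) ^ jetY k)) * Polynomial.X ^ jetX k = 0 →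
      (c i 0 : ℂ) + c i 2 * κ * η = 0 ∧ (c i 1 : ℂ) + c i 4 * κ * η = 0 ∧ (c i 3 : ℂ) = 0 := by
    intro η hη
    obtain ⟨e0, e1, e2⟩ := jet_coeff_eq_zero hη
    simp only [jetX, jetY, Matrix.cons_val, pow_zero, pow_one, mul_one, one_mul] at e0 e1 e2
    refine ⟨by rw [← e0]; ring, mul_left_cancel₀ hκ0 ?_, ?_⟩
    · rw [mul_zero, ← e1]; ring
    · exact (mul_eq_zero.1 e2).resolve_right (pow_ne_zero _ hκ0)
  obtain ⟨a0, a1, a3⟩ := coefs _ (hA i)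
  obtain ⟨b0, b1, -⟩ := coefs _ (hB i)
  push_cast at b0 b1
  have c2 : (c i 2 : ℂ) = 0 := by
    have : (c i 2 : ℂ) * (κ * ε) = 0 := by linear_combination 2 * (b0 - a0)
    exact (mul_eq_zero.1 this).resolve_right (mul_ne_zero hκ0 hε')
  have c4 : (c i 4 : ℂ) = 0 := by
    have : (c i 4 : ℂ) * (κ * ε) = 0 := by linear_combination 2 * (b1 - a1)
    exact (mul_eq_zero.1 this).resolve_right (mul_ne_zero hκ0 hε')
  rw [c2] at a0
  rw [c4] at a1
  norm_cast at a3 c2 c4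
  simp only [zero_mul, add_zero, Complex.ofReal_eq_zero] at a0 a1
  fin_cases k <;> simpa

end KernelAssumption

/-! ### Linear independence in L² of translated derivatives of the kernel. -/

theorem sum_smul_shiftLp_coeFn {ι : Type*} (s : Finset ι) (c : ι → ℝ) {G : ι → Plane → ℝ}
    (hG : ∀ i, MemLp (G i) 2 volume) (z : ι → Plane) :
    (∑ i ∈ s, c i • shiftLp (hG i) (z i) : PlaneL2) =ᵐ[volume]
      fun x => ∑ i ∈ s, c i * G i (z i - x) := by
  classical
  induction s using Finset.induction_on with
  | empty =>
    simp only [Finset.sum_empty]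
    exact Lp.coeFn_zero ℝ 2 (volume : Measure Plane)
  | insert i s hi ih =>
    rw [Finset.sum_insert hi]
    filter_upwards [ih, Lp.coeFn_add (c i • shiftLp (hG i) (z i))
      (∑ i ∈ s, c i • shiftLp (hG i) (z i)), Lp.coeFn_smul (c i) (shiftLp (hG i) (z i)),
      ((hG i).comp_sub_left (z i)).coeFn_toLp] with x h1 h2 h3 h4
    rw [h2, Pi.add_apply, h1, h3, Pi.smul_apply, Finset.sum_insert hi, shiftLp, h4, smul_eq_mul]

theorem sum_eq_zero_of_sum_smul_shiftLp_eq_zero {ι : Type*} (s : Finset ι) (c : ι → ℝ)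
    {G : ι → Plane → ℝ} (hG : ∀ i, MemLp (G i) 2 volume) (hc : ∀ i, Continuous (G i))
    (z : ι → Plane) (h : ∑ i ∈ s, c i • shiftLp (hG i) (z i) = 0) (x : Plane) :
    ∑ i ∈ s, c i * G i (z i + x) = 0 := by
  have hae : (fun x => ∑ i ∈ s, c i * G i (z i - x)) =ᵐ[volume] fun _ => 0 := by
    refine (sum_smul_shiftLp_coeFn s c hG z).symm.trans ?_
    rw [h]
    exact Lp.coeFn_zero ℝ 2 (volume : Measure Plane)
  have hcont : Continuous fun x => ∑ i ∈ s, c i * G i (z i - x) :=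
    continuous_finsetSum _ fun i _ => continuous_const.mul ((hc i).comp (by fun_prop))
  have := congrFun ((hcont.ae_eq_iff_eq volume continuous_const).1 hae) (-x)
  simpa using this

namespace KernelAssumption
variable {q : Plane → ℝ}

/-- The translates of the partial derivatives of `q` of order at most `2`, as elements of `L²`. -/
noncomputable def jet (hq : KernelAssumption q) (k : Fin 5) (z : Plane) : PlaneL2 :=
  shiftLp (hq.memLp (jetX k) (jetY k) ((jet_le k).trans (by norm_num))) z

/-- The translates of `∂₁³ q`, as elements of `L²`. -/
noncomputable def jetThird (hq : KernelAssumption q) (z : Plane) : PlaneL2 :=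
  shiftLp (hq.memLp 3 0 (by norm_num)) z

theorem memLp_partialD (hq : KernelAssumption q) {a b : ℕ} (h : a + b ≤ 3) (i : Fin 2) :
    MemLp (partialD i (multiD a b q)) 2 volume := by
  fin_cases i
  · change MemLp (partialD 0 (multiD a b q)) 2 volume
    rw [partialD_zero_multiD]
    exact hq.memLp (a + 1) b (by omega)
  · change MemLp (partialD 1 (multiD a b q)) 2 volume
    rw [hq.partialD_one_eq h]
    exact hq.memLp a (b + 1) (by omega)

theorem continuous_shiftLp_multiD (hq : KernelAssumption q) {a b : ℕ} (h : a + b ≤ 3) :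
    Continuous (shiftLp (hq.memLp a b (by omega))) :=
  continuous_shiftLp (hq.contDiff_one_multiD h) _ fun i => hq.memLp_partialD h i

@[fun_prop]
theorem continuous_jet (hq : KernelAssumption q) (k : Fin 5) : Continuous (hq.jet k) :=
  hq.continuous_shiftLp_multiD ((jet_le k).trans (by norm_num))

@[fun_prop]
theorem continuous_jetThird (hq : KernelAssumption q) : Continuous hq.jetThird :=
  hq.continuous_shiftLp_multiD (a := 3) (b := 0) (by norm_num)

theorem eq_zero_of_sum_smul_jet_eq_zero (hq : KernelAssumption q) {n : ℕ} {a : Fin n → ℝ}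
    (ha : a.Injective) (y : ℝ) (c : Fin n → Fin 5 → ℝ)
    (h : ∑ i, ∑ k, c i k • hq.jet k (pt (a i) y) = 0) : c = 0 := by
  refine hq.jet_eq_zero_of_sum_eq_zero ha y fun x => ?_
  rw [← Fintype.sum_prod_type'] at h ⊢
  exact sum_eq_zero_of_sum_smul_shiftLp_eq_zero Finset.univ (fun p : Fin n × Fin 5 => c p.1 p.2)
    (fun p => hq.memLp (jetX p.2) (jetY p.2) ((jet_le p.2).trans (by norm_num)))
    (fun p => hq.continuous_multiD ((jet_le p.2).trans (by norm_num))) (fun p => pt (a p.1) y) h x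

theorem linearIndependent_fold (hq : KernelAssumption q) (x y : ℝ) :
    LinearIndependent ℝ ![hq.jet 1 (pt x y), hq.jet 3 (pt x y), hq.jet 4 (pt x y)] := by
  rw [Fintype.linearIndependent_iff]
  intro g hg
  have := hq.eq_zero_of_sum_smul_jet_eq_zero (a := ![x]) (Function.injective_of_subsingleton _) y
    ![![0, g 0, 0, g 1, g 2]] (by
      rw [← hg]
      simp [Fin.sum_univ_three, Fin.sum_univ_five])
  have h0 := fun k => congrFun (congrFun this 0) k
  have h1 := h0 1
  have h2 := h0 3
  have h3 := h0 4
  simp at h1 h2 h3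
  intro i; fin_cases i <;> simpa

/-- The values at the three points carry the coefficients g₃, g₄ − g₃, −g₄, from which g₃ and g₄ are
recovered. -/
theorem linearIndependent_triple (hq : KernelAssumption q) {a b c : ℝ} (hab : a ≠ b) (hac : a ≠ c)
    (hbc : b ≠ c) (y : ℝ) :
    LinearIndependent ℝ ![hq.jet 1 (pt a y), hq.jet 1 (pt b y), hq.jet 1 (pt c y),
      hq.jet 0 (pt a y) - hq.jet 0 (pt b y), hq.jet 0 (pt b y) - hq.jet 0 (pt c y)] := by
  rw [Fintype.linearIndependent_iff]
  intro g hg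
  have hinj : Function.Injective ![a, b, c] := by
    intro i j h
    fin_cases i <;> fin_cases j <;> simp_all
  have := hq.eq_zero_of_sum_smul_jet_eq_zero hinj y
    ![![g 3, g 0, 0, 0, 0], ![g 4 - g 3, g 1, 0, 0, 0], ![-g 4, g 2, 0, 0, 0]] (by
      rw [← hg]
      simp only [Fin.sum_univ_three, Fin.sum_univ_five, Matrix.cons_val]
      module)
  have h0 := fun i k => congrFun (congrFun this i) k
  have h1 := h0 0 1
  have h2 := h0 1 1
  have h3 := h0 2 1
  have h4 := h0 0 0
  have h5 := h0 2 0
  simp at h1 h2 h3 h4 h5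
  intro i; fin_cases i <;> simpa

theorem linearIndependent_tangent (hq : KernelAssumption q) {a b : ℝ} (hab : a ≠ b) (y : ℝ) :
    LinearIndependent ℝ ![hq.jet 1 (pt a y), hq.jet 1 (pt b y),
      hq.jet 0 (pt a y) - hq.jet 0 (pt b y), hq.jet 2 (pt a y) - hq.jet 2 (pt b y)] := by
  rw [Fintype.linearIndependent_iff]
  intro g hg
  have hinj : Function.Injective ![a, b] := by
    intro i j h
    fin_cases i <;> fin_cases j <;> simp_all
  have := hq.eq_zero_of_sum_smul_jet_eq_zero hinj y
    ![![g 2, g 0, g 3, 0, 0], ![-g 2, g 1, -g 3, 0, 0]] (by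
      rw [← hg]
      simp only [Fin.sum_univ_two, Fin.sum_univ_four, Fin.sum_univ_five, Matrix.cons_val]
      module)
  have h0 := fun i k => congrFun (congrFun this i) k
  have h1 := h0 0 1
  have h2 := h0 1 1
  have h3 := h0 0 0
  have h4 := h0 0 2
  simp at h1 h2 h3 h4
  intro i; fin_cases i <;> simpa

theorem linearIndependent_double (hq : KernelAssumption q) {a b : ℝ} (hab : a ≠ b) (y : ℝ) :
    LinearIndependent ℝ ![hq.jet 1 (pt a y), hq.jet 1 (pt b y),
      hq.jet 0 (pt a y) - hq.jet 0 (pt b y), hq.jet 3 (pt a y)] := by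
  rw [Fintype.linearIndependent_iff]
  intro g hg
  have hinj : Function.Injective ![a, b] := by
    intro i j h
    fin_cases i <;> fin_cases j <;> simp_all
  have := hq.eq_zero_of_sum_smul_jet_eq_zero hinj y
    ![![g 2, g 0, 0, g 3, 0], ![-g 2, g 1, 0, 0, 0]] (by
      rw [← hg]
      simp only [Fin.sum_univ_two, Fin.sum_univ_four, Fin.sum_univ_five, Matrix.cons_val]
      module)
  have h0 := fun i k => congrFun (congrFun this i) k
  have h1 := h0 0 1
  have h2 := h0 1 1
  have h3 := h0 0 0
  have h4 := h0 0 3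
  simp at h1 h2 h3 h4
  intro i; fin_cases i <;> simpa

/-- The decay assumption stops at order 2, so the Fourier argument does not reach ∂₁³q. But a
relation between ∂₁q, ∂₁²q, ∂₁³q says ∂₁u = 0 for the same combination u of q, ∂₁q, ∂₁²q; u is
constant on horizontal lines and tends to 0 along them, so u = 0, and this is a relation between
jets. -/
theorem linearIndependent_cusp (hq : KernelAssumption q) (x y : ℝ) :
    LinearIndependent ℝ ![hq.jet 1 (pt x y), hq.jet 3 (pt x y), hq.jetThird (pt x y)] := by
  rw [Fintype.linearIndependent_iff]
  intro g hg
  set A : Fin 3 → ℕ := ![1, 2, 3] with hA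
  have hA3 : ∀ k, A k + 0 ≤ 4 := by intro k; fin_cases k <;> simp [hA]
  have hsum : ∀ z, ∑ k, g k * multiD (A k) 0 q (pt x y + z) = 0 :=
    sum_eq_zero_of_sum_smul_shiftLp_eq_zero Finset.univ g (fun k => hq.memLp (A k) 0 (hA3 k))
      (fun k => hq.continuous_multiD (hA3 k)) (fun _ => pt x y) (by
        rw [← hg, Fin.sum_univ_three, Fin.sum_univ_three]; rfl)
  set B : Fin 3 → ℕ := ![0, 1, 2] with hB
  have hB2 : ∀ k, B k + 0 ≤ 2 := by intro k; fin_cases k <;> simp [hB]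
  set u : Plane → ℝ := fun z => ∑ k, g k * multiD (B k) 0 q z with hu
  have hder : ∀ (z : Plane) (t : ℝ), HasDerivAt (fun t : ℝ => u (z + t • basisVec 0)) 0 t := by
    intro z t
    have h1 : HasDerivAt (fun t : ℝ => u (z + t • basisVec 0))
        (∑ k, g k * partialD 0 (multiD (B k) 0 q) (z + t • basisVec 0)) t := by
      refine HasDerivAt.fun_sum fun k _ => HasDerivAt.const_mul _ ?_
      exact HasDerivAt.of_partialD
        ((hq.contDiff_one_multiD ((hB2 k).trans (by norm_num))).differentiable one_ne_zero) 0 z t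
    refine h1.congr_deriv ?_
    have := hsum (z + t • basisVec 0 - pt x y)
    rw [add_sub_cancel] at this
    rw [← this, Fin.sum_univ_three, Fin.sum_univ_three]
    rfl
  have hu0 : ∀ z, u z = 0 := by
    intro z
    have hconst : ∀ t : ℝ, u (z + t • basisVec 0) = u z := by
      intro t
      have := is_const_of_deriv_eq_zero (fun t => (hder z t).differentiableAt)
        (fun t => (hder z t).deriv) t 0
      simpa using this
    have hlim : Tendsto (fun t : ℝ => u (z + t • basisVec 0)) atTop (𝓝 0) := by
      have := tendsto_finsetSum Finset.univ fun k (_ : k ∈ Finset.univ) =>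
        (hq.tendsto_multiD (hB2 k) z).const_mul (g k)
      simpa using this
    simp_rw [hconst] at hlim
    exact tendsto_nhds_unique tendsto_const_nhds hlim
  have := hq.jet_eq_zero_of_sum_eq_zero (a := ![x]) (Function.injective_of_subsingleton _) y
    (c := ![![g 0, g 1, 0, g 2, 0]]) (fun z => by
      refine Eq.trans ?_ (hu0 (pt x y + z))
      simp only [hu, Fin.sum_univ_three, Fin.sum_univ_five, Finset.univ_unique, Finset.sum_singleton]
      simp [hB, jetX, jetY])
  have h0 := fun k => congrFun (congrFun this 0) k
  have h1 := h0 0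
  have h2 := h0 1
  have h3 := h0 3
  simp at h1 h2 h3
  intro i; fin_cases i <;> simpa

end KernelAssumption

/-! ### Coordinate derivatives and pointwise Lipschitz bounds. -/

theorem pt_zero_add_smul (x y : ℝ) : pt 0 y + x • basisVec 0 = pt x y := by
  ext k; fin_cases k <;> simp

theorem pt_add_smul_one (x y : ℝ) : pt x 0 + y • basisVec 1 = pt x y := by
  ext k; fin_cases k <;> simp

theorem hasDerivAt_pt_left {F : Plane → ℝ} (hF : Differentiable ℝ F) (x y : ℝ) :
    HasDerivAt (fun x => F (pt x y)) (partialD 0 F (pt x y)) x := by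
  simpa only [pt_zero_add_smul] using HasDerivAt.of_partialD hF 0 (pt 0 y) x

theorem hasDerivAt_pt_right {F : Plane → ℝ} (hF : Differentiable ℝ F) (x y : ℝ) :
    HasDerivAt (fun y => F (pt x y)) (partialD 1 F (pt x y)) y := by
  simpa only [pt_add_smul_one] using HasDerivAt.of_partialD hF 1 (pt x 0) y

theorem isBigO_apply_sub {d : ℕ} (k : Fin d) (p : Fin d → ℝ) :
    (fun p' : Fin d → ℝ => p' k - p k) =O[𝓝 p] fun p' => p' - p :=
  Asymptotics.IsBigO.of_bound' (Eventually.of_forall fun p' => norm_le_pi_norm (p' - p) k)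

theorem isBigO_pt_sub {d : ℕ} (i j : Fin d) (p : Fin d → ℝ) :
    (fun p' : Fin d → ℝ => pt (p' i) (p' j) - pt (p i) (p j)) =O[𝓝 p] fun p' => p' - p := by
  refine Asymptotics.IsBigO.of_bound 2 (Eventually.of_forall fun p' => ?_)
  have h0 : pt (p' i) (p' j) - pt (p i) (p j) =
      (p' i - p i) • basisVec 0 + (p' j - p j) • basisVec 1 := by
    ext k; fin_cases k <;> simp
  rw [h0]
  refine (norm_add_le _ _).trans ?_
  rw [norm_smul, norm_smul, PiLp.norm_single, PiLp.norm_single, norm_one, mul_one, mul_one, two_mul]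
  exact add_le_add (norm_le_pi_norm (p' - p) i) (norm_le_pi_norm (p' - p) j)

theorem isBigO_comp_pt_sub {X : Plane → ℝ} (hX : ∀ z, (fun w => X w - X z) =O[𝓝 z] fun w => w - z)
    {d : ℕ} (i j : Fin d) (p : Fin d → ℝ) :
    (fun p' : Fin d → ℝ => X (pt (p' i) (p' j)) - X (pt (p i) (p j))) =O[𝓝 p] fun p' => p' - p := by
  have hc : Continuous fun p' : Fin d → ℝ => pt (p' i) (p' j) := by fun_prop
  exact ((hX _).comp_tendsto (hc.tendsto p)).trans (isBigO_pt_sub i j p)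

theorem isBigO_increment_sub {X : Plane → ℝ}
    (hX : ∀ z, (fun w => X w - X z) =O[𝓝 z] fun w => w - z) (l : ℝ)
    {d : ℕ} (i j k : Fin d) (p : Fin d → ℝ) :
    (fun p' : Fin d → ℝ => (X (pt (p' i) (p' k)) - X (pt (p' j) (p' k)) - l * (p' i - p' j)) -
      (X (pt (p i) (p k)) - X (pt (p j) (p k)) - l * (p i - p j))) =O[𝓝 p] fun p' => p' - p := by
  refine (((isBigO_comp_pt_sub hX i k p).sub (isBigO_comp_pt_sub hX j k p)).sub
    (((isBigO_apply_sub i p).sub (isBigO_apply_sub j p)).const_mul_left l)).congr_left fun p' => ?_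
  ring

/-- A function with continuous partial derivatives is pointwise Lipschitz. -/
theorem isBigO_sub_of_hasDerivAt {X : Plane → ℝ} {Y : Fin 2 → Plane → ℝ}
    (hY : ∀ i, Continuous (Y i)) (hX : ∀ i (z : Plane) (t : ℝ),
      HasDerivAt (fun t : ℝ => X (z + t • basisVec i)) (Y i (z + t • basisVec i)) t) (z : Plane) :
    (fun w => X w - X z) =O[𝓝 z] fun w => w - z := by
  set K := max (|Y 0 z|) (|Y 1 z|) + 1 with hK
  have hev : ∀ᶠ w in 𝓝 z, ∀ i, |Y i w| ≤ K := by
    rw [eventually_all]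
    intro i
    have : |Y i z| < K := by
      fin_cases i
      · exact (le_max_left _ _).trans_lt (lt_add_one _)
      · exact (le_max_right _ _).trans_lt (lt_add_one _)
    exact ((hY i).abs.continuousAt.eventually (gt_mem_nhds this)).mono fun _ h => h.le
  obtain ⟨ε, hε, hball⟩ := Metric.eventually_nhds_iff.1 hev
  have hmv : ∀ (i : Fin 2) (v : Plane) (t : ℝ), (∀ s : ℝ, |s| ≤ |t| → dist (v + s • basisVec i) z < ε) →
      |X (v + t • basisVec i) - X v| ≤ K * |t| := by
    intro i v t h
    have h1 := Convex.norm_image_sub_le_of_norm_hasDerivWithin_le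
      (f := fun t : ℝ => X (v + t • basisVec i)) (s := Icc (-|t|) |t|) (C := K) (x := 0) (y := t)
      (fun s _ => (hX i v s).hasDerivWithinAt) (fun s hs => hball (h s (abs_le.2 hs)) i)
      (convex_Icc _ _) ⟨by simp, by simp⟩ ⟨neg_abs_le t, le_abs_self t⟩
    simpa using h1
  refine Asymptotics.IsBigO.of_bound (2 * K) ?_
  filter_upwards [Metric.ball_mem_nhds z (half_pos hε)] with w hw
  rw [Metric.mem_ball, dist_eq_norm] at hw
  have n0 : |(w - z) 0| ≤ ‖w - z‖ := PiLp.norm_apply_le (w - z) 0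
  have n1 : |(w - z) 1| ≤ ‖w - z‖ := PiLp.norm_apply_le (w - z) 1
  have hw2 : w = (z + (w - z) 0 • basisVec 0) + (w - z) 1 • basisVec 1 := by
    ext i; fin_cases i <;> simp
  have hK0 : 0 ≤ K := by positivity
  have e0 := hmv 0 z ((w - z) 0) fun s hs => by
    rw [dist_eq_norm, add_sub_cancel_left, norm_smul, PiLp.norm_single, norm_one, mul_one,
      Real.norm_eq_abs]
    linarith
  have e1 := hmv 1 (z + (w - z) 0 • basisVec 0) ((w - z) 1) fun s hs => by
    rw [dist_eq_norm, add_assoc, add_sub_cancel_left]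
    refine (norm_add_le _ _).trans_lt ?_
    rw [norm_smul, norm_smul, PiLp.norm_single, PiLp.norm_single, norm_one, mul_one, mul_one,
      Real.norm_eq_abs, Real.norm_eq_abs]
    linarith
  rw [← hw2] at e1
  have h3 := abs_sub_le (X w) (X (z + (w - z) 0 • basisVec 0)) (X z)
  rw [Real.norm_eq_abs]
  have m0 := mul_le_mul_of_nonneg_left n0 hK0
  have m1 := mul_le_mul_of_nonneg_left n1 hK0
  linarith

/-! ### Almost sure genericity of the field. -/

section Field
variable {Ω : Type*} [MeasurableSpace Ω] {P : Measure Ω} {q : Plane → ℝ}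
  {hq : KernelAssumption q} {W : PlaneL2 → Ω → ℝ} {f : Ω → Plane → ℝ}

namespace IsSmoothConvolutionField

theorem isVersion (hf : IsSmoothConvolutionField P hq W f) : IsVersion P W hq.memLp_self f := by
  intro z
  rw [← hq.translate_eq_shiftLp]
  exact hf.eq_whiteNoise z

theorem isVersion_partialD [IsFiniteMeasure P] (hW : IsWhiteNoise P W)
    (hf : IsSmoothConvolutionField P hq W f) (i : Fin 2) :
    IsVersion P W (hq.memLp_partialD (a := 0) (b := 0) (by norm_num) i)
      (fun ω => partialD i (f ω)) := by
  refine IsVersion.partialD hW (h0 := hq.memLp_self) hf.isVersion (hq.contDiff.of_le (by norm_num)) i _ ?_ ?_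
  · fin_cases i
    · exact hq.memLp 2 0 (by norm_num)
    · exact hq.memLp 0 2 (by norm_num)
  · filter_upwards [hf.smooth] with ω h using h.differentiable two_ne_zero

theorem isVersion_partialD_partialD [IsFiniteMeasure P] (hW : IsWhiteNoise P W)
    (hf : IsSmoothConvolutionField P hq W f) {i : Fin 2}
    (h1 : MemLp (partialD i q) 2 volume) (h2 : MemLp (partialD 0 (partialD i q)) 2 volume)
    (h3 : MemLp (partialD 0 (partialD 0 (partialD i q))) 2 volume) :
    IsVersion P W h2 (fun ω => partialD 0 (partialD i (f ω))) := by
  refine IsVersion.partialD hW (h0 := h1) (hf.isVersion_partialD hW i)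
    (contDiff_partialD (n := 2) (hq.contDiff.of_le (by norm_num)) i) 0 h2 h3 ?_
  filter_upwards [hf.smooth] with ω h
    using (contDiff_partialD (n := 1) h i).differentiable one_ne_zero

theorem ae_eq_jet [IsFiniteMeasure P] (hW : IsWhiteNoise P W)
    (hf : IsSmoothConvolutionField P hq W f) (z : Plane) :
    ∀ᵐ ω ∂P, f ω z = W (hq.jet 0 z) ω ∧ partialD 0 (f ω) z = W (hq.jet 1 z) ω ∧
      partialD 1 (f ω) z = W (hq.jet 2 z) ω ∧
      partialD 0 (partialD 0 (f ω)) z = W (hq.jet 3 z) ω ∧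
      partialD 0 (partialD 1 (f ω)) z = W (hq.jet 4 z) ω := by
  filter_upwards [hf.isVersion z, hf.isVersion_partialD hW 0 z, hf.isVersion_partialD hW 1 z,
    hf.isVersion_partialD_partialD hW (i := 0) (hq.memLp 1 0 (by norm_num))
      (hq.memLp 2 0 (by norm_num)) (hq.memLp 3 0 (by norm_num)) z,
    hf.isVersion_partialD_partialD hW (i := 1) (hq.memLp 0 1 (by norm_num))
      (hq.memLp 1 1 (by norm_num)) (hq.memLp 2 1 (by norm_num)) z] with ω a b c d e
  exact ⟨a, b, c, d, e⟩

/-- The third order derivatives of the field which involve `∂₁²`. -/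
theorem exists_third [IsFiniteMeasure P] (hW : IsWhiteNoise P W)
    (hf : IsSmoothConvolutionField P hq W f) :
    ∃ T : Ω → Plane → ℝ, (∀ z, ∀ᵐ ω ∂P, T ω z = W (hq.jetThird z) ω) ∧
      ∀ᵐ ω ∂P, Continuous (T ω) ∧
        (∀ x y, HasDerivAt (fun x => partialD 0 (partialD 0 (f ω)) (pt x y)) (T ω (pt x y)) x) ∧
        ∀ z, (fun w => partialD 0 (partialD 0 (f ω)) w - partialD 0 (partialD 0 (f ω)) z)
          =O[𝓝 z] fun w => w - z := by
  have hV := hf.isVersion_partialD_partialD hW (i := 0) (hq.memLp 1 0 (by norm_num))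
    (hq.memLp 2 0 (by norm_num)) (hq.memLp 3 0 (by norm_num))
  have hVc : ∀ᵐ ω ∂P, Continuous (partialD 0 (partialD 0 (f ω))) := by
    filter_upwards [hf.smooth] with ω h
    exact (contDiff_partialD (n := 0) (contDiff_partialD (n := 1) h 0) 0).continuous
  have hG : ContDiff ℝ 2 (partialD 0 (partialD 0 q)) :=
    hq.contDiff_two_multiD (a := 2) (b := 0) (by norm_num)
  -- Both first derivatives of ∂₁²f are produced: the horizontal one is T, the vertical one only
  -- serves to make ∂₁²f pointwise Lipschitz.
  have key : ∀ i : Fin 2, ∃ T : Ω → Plane → ℝ,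
      IsVersion P W (hq.memLp_partialD (a := 2) (b := 0) (by norm_num) i) T ∧
      ∀ᵐ ω ∂P, Continuous (T ω) ∧ ∀ (z : Plane) (t : ℝ),
        HasDerivAt (fun t : ℝ => partialD 0 (partialD 0 (f ω)) (z + t • basisVec i))
          (T ω (z + t • basisVec i)) t := by
    intro i
    obtain ⟨a, b, hab, he⟩ : ∃ a b, a + b = 3 ∧ partialD i (multiD 2 0 q) = multiD a b q := by
      fin_cases i
      · exact ⟨3, 0, rfl, partialD_zero_multiD q 2 0⟩
      · exact ⟨2, 1, rfl, hq.partialD_one_eq (by norm_num)⟩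
    have hpp : ∀ j, MemLp (partialD j (partialD i (multiD 2 0 q))) 2 volume := fun j => by
      rw [he]; exact hq.memLp_partialD hab.le j
    obtain ⟨T, hT, hTc⟩ := exists_continuous_version hW
      (hq.memLp_partialD (a := 2) (b := 0) (by norm_num) i)
      (by rw [he]; exact hq.contDiff_one_multiD hab.le) hpp
    refine ⟨T, hT, ?_⟩
    filter_upwards [hTc, IsVersion.ae_hasDerivAt hW hG (hpp i) hV hT hVc hTc] with ω h1 h2
      using ⟨h1, h2⟩
  choose T hT hTae using key
  refine ⟨T 0, hT 0, ?_⟩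
  filter_upwards [hTae 0, hTae 1] with ω h0 h1
  refine ⟨h0.1, fun x y => ?_, ?_⟩
  · simpa only [pt_zero_add_smul] using h0.2 (pt 0 y) x
  · refine isBigO_sub_of_hasDerivAt (Y := fun i => T i ω) ?_ ?_
    · intro i; fin_cases i
      · exact h0.1
      · exact h1.1
    · intro i; fin_cases i
      · exact h0.2
      · exact h1.2

theorem ae_isBigO_sub (hf : IsSmoothConvolutionField P hq W f) :
    ∀ᵐ ω ∂P, (∀ z, (fun w => f ω w - f ω z) =O[𝓝 z] fun w => w - z) ∧
      ∀ (i : Fin 2) (z : Plane),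
        (fun w => partialD i (f ω) w - partialD i (f ω) z) =O[𝓝 z] fun w => w - z := by
  filter_upwards [hf.smooth] with ω h
  exact ⟨fun z => (h.differentiable two_ne_zero z).isBigO_sub, fun i z =>
    ((contDiff_partialD (n := 1) h i).differentiable one_ne_zero z).isBigO_sub⟩

/-- Three equations in the two unknowns x, y. The order counts: all but the last function must be
pointwise Lipschitz, which `exists_third` supplies for ∂₁²f, while continuity is enough for ∂₁∂₂f.
-/
theorem ae_ne_fold [IsFiniteMeasure P] (hW : IsWhiteNoise P W)
    (hf : IsSmoothConvolutionField P hq W f) (l : ℝ) :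
    ∀ᵐ ω ∂P, ∀ x y, partialD 0 (f ω) (pt x y) - l = 0 →
      partialD 0 (partialD 0 (f ω)) (pt x y) = 0 → partialD 0 (partialD 1 (f ω)) (pt x y) ≠ 0 := by
  obtain ⟨T, -, hT⟩ := hf.exists_third hW
  have h := hW.ae_not_common_zero (d := 2) (V := univ)
    (F := fun i ω p => ![partialD 0 (f ω) (pt (p 0) (p 1)) - l,
      partialD 0 (partialD 0 (f ω)) (pt (p 0) (p 1)),
      partialD 0 (partialD 1 (f ω)) (pt (p 0) (p 1))] i)
    (l := fun p => ![hq.jet 1 (pt (p 0) (p 1)), hq.jet 3 (pt (p 0) (p 1)), hq.jet 4 (pt (p 0) (p 1))])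
    (m := fun _ => ![l, 0, 0]) ?_ ?_ ?_ ?_ (fun p _ => hq.linearIndependent_fold _ _)
  · filter_upwards [h] with ω hω x y h1 h2 h3
    obtain ⟨i, hi⟩ := hω ![x, y] (mem_univ _)
    fin_cases i <;> simp_all
  · refine continuous_pi fun i => ?_
    fin_cases i
    · exact (hq.continuous_jet 1).comp (by fun_prop)
    · exact (hq.continuous_jet 3).comp (by fun_prop)
    · exact (hq.continuous_jet 4).comp (by fun_prop)
  · intro p i
    filter_upwards [hf.ae_eq_jet hW (pt (p 0) (p 1))] with ω hω
    fin_cases i <;> simp [hω]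
  · filter_upwards [hT, hf.ae_isBigO_sub] with ω hω h2 i p
    fin_cases i
    · simpa using isBigO_comp_pt_sub (h2.2 0) 0 1 p
    · simpa using isBigO_comp_pt_sub hω.2.2 0 1 p
  · filter_upwards [hf.smooth] with ω hω
    have : Continuous (partialD 0 (partialD 1 (f ω))) :=
      (contDiff_partialD (n := 0) (contDiff_partialD (n := 1) hω 1) 0).continuous
    exact this.comp (by fun_prop : Continuous fun p : Fin 2 → ℝ => pt (p 0) (p 1))

/-- T is only known to be continuous, hence its last place in the system. -/
theorem ae_ne_cusp [IsFiniteMeasure P] (hW : IsWhiteNoise P W)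
    (hf : IsSmoothConvolutionField P hq W f) (l : ℝ) {T : Ω → Plane → ℝ}
    (hTW : ∀ z, ∀ᵐ ω ∂P, T ω z = W (hq.jetThird z) ω) (hTc : ∀ᵐ ω ∂P, Continuous (T ω)) :
    ∀ᵐ ω ∂P, ∀ x y, partialD 0 (f ω) (pt x y) - l = 0 →
      partialD 0 (partialD 0 (f ω)) (pt x y) = 0 → T ω (pt x y) ≠ 0 := by
  obtain ⟨T', -, hT'⟩ := hf.exists_third hW
  have h := hW.ae_not_common_zero (d := 2) (V := univ)
    (F := fun i ω p => ![partialD 0 (f ω) (pt (p 0) (p 1)) - l,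
      partialD 0 (partialD 0 (f ω)) (pt (p 0) (p 1)), T ω (pt (p 0) (p 1))] i)
    (l := fun p => ![hq.jet 1 (pt (p 0) (p 1)), hq.jet 3 (pt (p 0) (p 1)), hq.jetThird (pt (p 0) (p 1))])
    (m := fun _ => ![l, 0, 0]) ?_ ?_ ?_ ?_ (fun p _ => hq.linearIndependent_cusp _ _)
  · filter_upwards [h] with ω hω x y h1 h2 h3
    obtain ⟨i, hi⟩ := hω ![x, y] (mem_univ _)
    fin_cases i <;> simp_all
  · refine continuous_pi fun i => ?_
    fin_cases i
    · exact (hq.continuous_jet 1).comp (by fun_prop)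
    · exact (hq.continuous_jet 3).comp (by fun_prop)
    · exact hq.continuous_jetThird.comp (by fun_prop)
  · intro p i
    filter_upwards [hf.ae_eq_jet hW (pt (p 0) (p 1)), hTW (pt (p 0) (p 1))] with ω hω hω'
    fin_cases i <;> simp [hω, hω']
  · filter_upwards [hT', hf.ae_isBigO_sub] with ω hω h2 i p
    fin_cases i
    · simpa using isBigO_comp_pt_sub (h2.2 0) 0 1 p
    · simpa using isBigO_comp_pt_sub hω.2.2 0 1 p
  · filter_upwards [hTc] with ω hω
    exact hω.comp (by fun_prop : Continuous fun p : Fin 2 → ℝ => pt (p 0) (p 1))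

/-- Five equations in the four unknowns a, b, c, y. Heights enter through differences, and ℓ only
affects the deterministic shift `m`. -/
theorem ae_ne_triple [IsFiniteMeasure P] (hW : IsWhiteNoise P W)
    (hf : IsSmoothConvolutionField P hq W f) (l : ℝ) :
    ∀ᵐ ω ∂P, ∀ a b c y, a ≠ b → a ≠ c → b ≠ c → partialD 0 (f ω) (pt a y) - l = 0 →
      partialD 0 (f ω) (pt b y) - l = 0 → partialD 0 (f ω) (pt c y) - l = 0 →
      f ω (pt a y) - l * a = f ω (pt b y) - l * b → f ω (pt b y) - l * b ≠ f ω (pt c y) - l * c := by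
  have h := hW.ae_not_common_zero (d := 4) (V := {p | p 0 ≠ p 1 ∧ p 0 ≠ p 2 ∧ p 1 ≠ p 2})
    (F := fun i ω p => ![partialD 0 (f ω) (pt (p 0) (p 3)) - l,
      partialD 0 (f ω) (pt (p 1) (p 3)) - l, partialD 0 (f ω) (pt (p 2) (p 3)) - l,
      (f ω (pt (p 0) (p 3)) - f ω (pt (p 1) (p 3))) - l * (p 0 - p 1),
      (f ω (pt (p 1) (p 3)) - f ω (pt (p 2) (p 3))) - l * (p 1 - p 2)] i)
    (l := fun p => ![hq.jet 1 (pt (p 0) (p 3)), hq.jet 1 (pt (p 1) (p 3)), hq.jet 1 (pt (p 2) (p 3)),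
      hq.jet 0 (pt (p 0) (p 3)) - hq.jet 0 (pt (p 1) (p 3)),
      hq.jet 0 (pt (p 1) (p 3)) - hq.jet 0 (pt (p 2) (p 3))])
    (m := fun p => ![l, l, l, l * (p 0 - p 1), l * (p 1 - p 2)]) ?_ ?_ ?_ ?_
    (fun p hp => hq.linearIndependent_triple hp.1 hp.2.1 hp.2.2 _)
  · filter_upwards [h] with ω hω a b c y hab hac hbc h1 h2 h3 h4 h5
    obtain ⟨i, hi⟩ := hω ![a, b, c, y] ⟨hab, hac, hbc⟩
    have h4' : f ω (pt a y) - f ω (pt b y) - l * (a - b) = 0 := by linarith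
    have h5' : f ω (pt b y) - f ω (pt c y) - l * (b - c) = 0 := by linarith
    fin_cases i
    · exact hi h1
    · exact hi h2
    · exact hi h3
    · exact hi h4'
    · exact hi h5'
  · have c0 := hq.continuous_jet 0
    have c1 := hq.continuous_jet 1
    refine continuous_pi fun i => ?_
    fin_cases i
    · exact c1.comp (by fun_prop)
    · exact c1.comp (by fun_prop)
    · exact c1.comp (by fun_prop)
    · exact (c0.comp (by fun_prop)).sub (c0.comp (by fun_prop))
    · exact (c0.comp (by fun_prop)).sub (c0.comp (by fun_prop))
  · intro p i
    filter_upwards [hf.ae_eq_jet hW (pt (p 0) (p 3)), hf.ae_eq_jet hW (pt (p 1) (p 3)),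
      hf.ae_eq_jet hW (pt (p 2) (p 3)),
      hW.sub_ae_eq (hq.jet 0 (pt (p 0) (p 3))) (hq.jet 0 (pt (p 1) (p 3))),
      hW.sub_ae_eq (hq.jet 0 (pt (p 1) (p 3))) (hq.jet 0 (pt (p 2) (p 3)))] with ω h1 h2 h3 h4 h5
    fin_cases i <;> simp [h1, h2, h3, h4, h5]
  · filter_upwards [hf.ae_isBigO_sub] with ω h2 i p
    fin_cases i
    · simpa using isBigO_comp_pt_sub (h2.2 0) 0 3 p
    · simpa using isBigO_comp_pt_sub (h2.2 0) 1 3 p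
    · simpa using isBigO_comp_pt_sub (h2.2 0) 2 3 p
    · exact isBigO_increment_sub h2.1 l 0 1 3 p
  · filter_upwards [hf.smooth] with ω hω
    have hc := hω.continuous
    have h1 : Continuous fun p : Fin 4 → ℝ => f ω (pt (p 1) (p 3)) := hc.comp (by fun_prop)
    have h2 : Continuous fun p : Fin 4 → ℝ => f ω (pt (p 2) (p 3)) := hc.comp (by fun_prop)
    exact (h1.sub h2).sub (by fun_prop)

/-- Four equations in the three unknowns a, b, y, restricted to a ≠ b, where the kernels are
independent. -/
theorem ae_ne_tangent [IsFiniteMeasure P] (hW : IsWhiteNoise P W)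
    (hf : IsSmoothConvolutionField P hq W f) (l : ℝ) :
    ∀ᵐ ω ∂P, ∀ a b y, a ≠ b → partialD 0 (f ω) (pt a y) - l = 0 →
      partialD 0 (f ω) (pt b y) - l = 0 → f ω (pt a y) - l * a = f ω (pt b y) - l * b →
      partialD 1 (f ω) (pt a y) ≠ partialD 1 (f ω) (pt b y) := by
  have h := hW.ae_not_common_zero (d := 3) (V := {p | p 0 ≠ p 1})
    (F := fun i ω p => ![partialD 0 (f ω) (pt (p 0) (p 2)) - l,
      partialD 0 (f ω) (pt (p 1) (p 2)) - l,
      (f ω (pt (p 0) (p 2)) - f ω (pt (p 1) (p 2))) - l * (p 0 - p 1),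
      partialD 1 (f ω) (pt (p 0) (p 2)) - partialD 1 (f ω) (pt (p 1) (p 2))] i)
    (l := fun p => ![hq.jet 1 (pt (p 0) (p 2)), hq.jet 1 (pt (p 1) (p 2)),
      hq.jet 0 (pt (p 0) (p 2)) - hq.jet 0 (pt (p 1) (p 2)),
      hq.jet 2 (pt (p 0) (p 2)) - hq.jet 2 (pt (p 1) (p 2))])
    (m := fun p => ![l, l, l * (p 0 - p 1), 0]) ?_ ?_ ?_ ?_
    (fun p hp => hq.linearIndependent_tangent hp _)
  · filter_upwards [h] with ω hω a b y hab h1 h2 h3 h4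
    obtain ⟨i, hi⟩ := hω ![a, b, y] hab
    have h3' : f ω (pt a y) - f ω (pt b y) - l * (a - b) = 0 := by linarith
    fin_cases i
    · exact hi h1
    · exact hi h2
    · exact hi h3'
    · exact hi (sub_eq_zero.2 h4)
  · have c0 := hq.continuous_jet 0
    have c1 := hq.continuous_jet 1
    have c2 := hq.continuous_jet 2
    refine continuous_pi fun i => ?_
    fin_cases i
    · exact c1.comp (by fun_prop)
    · exact c1.comp (by fun_prop)
    · exact (c0.comp (by fun_prop)).sub (c0.comp (by fun_prop))
    · exact (c2.comp (by fun_prop)).sub (c2.comp (by fun_prop))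
  · intro p i
    filter_upwards [hf.ae_eq_jet hW (pt (p 0) (p 2)), hf.ae_eq_jet hW (pt (p 1) (p 2)),
      hW.sub_ae_eq (hq.jet 0 (pt (p 0) (p 2))) (hq.jet 0 (pt (p 1) (p 2))),
      hW.sub_ae_eq (hq.jet 2 (pt (p 0) (p 2))) (hq.jet 2 (pt (p 1) (p 2)))] with ω h1 h2 h3 h4
    fin_cases i <;> simp [h1, h2, h3, h4]
  · filter_upwards [hf.ae_isBigO_sub] with ω h2 i p
    fin_cases i
    · simpa using isBigO_comp_pt_sub (h2.2 0) 0 2 p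
    · simpa using isBigO_comp_pt_sub (h2.2 0) 1 2 p
    · exact isBigO_increment_sub h2.1 l 0 1 2 p
  · filter_upwards [hf.smooth] with ω hω
    have hc := (contDiff_partialD (n := 1) hω 1).continuous
    have h1 : Continuous fun p : Fin 3 → ℝ => partialD 1 (f ω) (pt (p 0) (p 2)) :=
      hc.comp (by fun_prop)
    have h2 : Continuous fun p : Fin 3 → ℝ => partialD 1 (f ω) (pt (p 1) (p 2)) :=
      hc.comp (by fun_prop)
    exact h1.sub h2

theorem ae_ne_double [IsFiniteMeasure P] (hW : IsWhiteNoise P W)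
    (hf : IsSmoothConvolutionField P hq W f) (l : ℝ) :
    ∀ᵐ ω ∂P, ∀ a b y, a ≠ b → partialD 0 (f ω) (pt a y) - l = 0 →
      partialD 0 (f ω) (pt b y) - l = 0 → f ω (pt a y) - l * a = f ω (pt b y) - l * b →
      partialD 0 (partialD 0 (f ω)) (pt a y) ≠ 0 := by
  have h := hW.ae_not_common_zero (d := 3) (V := {p | p 0 ≠ p 1})
    (F := fun i ω p => ![partialD 0 (f ω) (pt (p 0) (p 2)) - l,
      partialD 0 (f ω) (pt (p 1) (p 2)) - l,
      (f ω (pt (p 0) (p 2)) - f ω (pt (p 1) (p 2))) - l * (p 0 - p 1),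
      partialD 0 (partialD 0 (f ω)) (pt (p 0) (p 2))] i)
    (l := fun p => ![hq.jet 1 (pt (p 0) (p 2)), hq.jet 1 (pt (p 1) (p 2)),
      hq.jet 0 (pt (p 0) (p 2)) - hq.jet 0 (pt (p 1) (p 2)), hq.jet 3 (pt (p 0) (p 2))])
    (m := fun p => ![l, l, l * (p 0 - p 1), 0]) ?_ ?_ ?_ ?_
    (fun p hp => hq.linearIndependent_double hp _)
  · filter_upwards [h] with ω hω a b y hab h1 h2 h3 h4
    obtain ⟨i, hi⟩ := hω ![a, b, y] hab
    have h3' : f ω (pt a y) - f ω (pt b y) - l * (a - b) = 0 := by linarith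
    fin_cases i
    · exact hi h1
    · exact hi h2
    · exact hi h3'
    · exact hi h4
  · have c0 := hq.continuous_jet 0
    have c1 := hq.continuous_jet 1
    have c3 := hq.continuous_jet 3
    refine continuous_pi fun i => ?_
    fin_cases i
    · exact c1.comp (by fun_prop)
    · exact c1.comp (by fun_prop)
    · exact (c0.comp (by fun_prop)).sub (c0.comp (by fun_prop))
    · exact c3.comp (by fun_prop)
  · intro p i
    filter_upwards [hf.ae_eq_jet hW (pt (p 0) (p 2)), hf.ae_eq_jet hW (pt (p 1) (p 2)),
      hW.sub_ae_eq (hq.jet 0 (pt (p 0) (p 2))) (hq.jet 0 (pt (p 1) (p 2)))] with ω h1 h2 h3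
    fin_cases i <;> simp [h1, h2, h3]
  · filter_upwards [hf.ae_isBigO_sub] with ω h2 i p
    fin_cases i
    · simpa using isBigO_comp_pt_sub (h2.2 0) 0 2 p
    · simpa using isBigO_comp_pt_sub (h2.2 0) 1 2 p
    · exact isBigO_increment_sub h2.1 l 0 1 2 p
  · filter_upwards [hf.smooth] with ω hω
    have hc : Continuous (partialD 0 (partialD 0 (f ω))) :=
      (contDiff_partialD (n := 0) (contDiff_partialD (n := 1) hω 0) 0).continuous
    exact hc.comp (by fun_prop : Continuous fun p : Fin 3 → ℝ => pt (p 0) (p 2))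

theorem ae_slopeData [IsFiniteMeasure P] (hW : IsWhiteNoise P W)
    (hf : IsSmoothConvolutionField P hq W f) {l : ℝ} (hl : 0 < l) :
    ∀ᵐ ω ∂P, ∃ gy h h1 h2 h11, SlopeData (fun x y => f ω (pt x y) - l * x) gy h h1 h2 h11 := by
  obtain ⟨T, hTW, hT⟩ := hf.exists_third hW
  have hdecay := hf.isVersion.ae_decay hW (hq.contDiff.of_le (by norm_num))
    (fun i => hq.memLp_partialD (a := 0) (b := 0) (by norm_num) i)
    (by filter_upwards [hf.smooth] with ω h using h.continuous) hl
  filter_upwards [hf.smooth, hT, hdecay, hf.ae_ne_fold hW l,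
    hf.ae_ne_cusp hW l hTW (by filter_upwards [hT] with ω h using h.1), hf.ae_ne_triple hW l,
    hf.ae_ne_tangent hW l, hf.ae_ne_double hW l]
    with ω hs hthird hdec hfold hcusp htriple htangent hdouble
  have hs1 : ∀ i, ContDiff ℝ 1 (partialD i (f ω)) := fun i => contDiff_partialD (n := 1) hs i
  have hc2 : ∀ i j, Continuous (partialD i (partialD j (f ω))) := fun i j =>
    (contDiff_partialD (n := 0) (hs1 j) i).continuous
  have hpt : Continuous fun p : ℝ × ℝ => pt p.1 p.2 := by fun_prop
  have hd := hs.differentiable two_ne_zero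
  have hd1 := fun i => (hs1 i).differentiable one_ne_zero
  refine ⟨fun x y => partialD 1 (f ω) (pt x y), fun x y => partialD 0 (f ω) (pt x y) - l,
    fun x y => partialD 0 (partialD 0 (f ω)) (pt x y),
    fun x y => partialD 0 (partialD 1 (f ω)) (pt x y), fun x y => T ω (pt x y), ?_⟩
  exact
    { cg := (hs.continuous.comp hpt).sub (by fun_prop)
      cgy := (hs1 1).continuous.comp hpt
      ch := ((hs1 0).continuous.comp hpt).sub continuous_const
      ch1 := (hc2 0 0).comp hpt
      ch2 := (hc2 0 1).comp hpt
      ch11 := hthird.1.comp hpt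
      dgx := fun x y => by
        have := (hasDerivAt_pt_left hd x y).sub ((hasDerivAt_id x).const_mul l)
        rw [mul_one] at this
        exact this
      dgy := fun x y => (hasDerivAt_pt_right hd x y).sub_const _
      dhx := fun x y => (hasDerivAt_pt_left (hd1 0) x y).sub_const _
      dhy := fun x y => by
        -- `h2` is ∂₁∂₂f, used both as the x-derivative of `gy` and as the y-derivative of `h`.
        rw [partialD_comm hs 0 1]
        exact (hasDerivAt_pt_right (hd1 0) x y).sub_const _
      dgyx := fun x y => hasDerivAt_pt_left (hd1 1) x y
      dh1x := hthird.2.1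
      decay := hdec
      ne_fold := hfold
      ne_cusp := hcusp
      ne_triple := htriple
      ne_tangent := htangent
      ne_double := hdouble }

end IsSmoothConvolutionField
end Field

theorem proposition2p5 {Ω : Type*} [MeasurableSpace Ω] (P : Measure Ω) [IsProbabilityMeasure P]
    (q : Plane → ℝ) (hq : KernelAssumption q)
    (W : Lp ℝ 2 (volume : Measure Plane) → Ω → ℝ) (hW : IsWhiteNoise P W)
    (f : Ω → Plane → ℝ) (hf : IsSmoothConvolutionField P hq W f)
    (l : ℝ) (hl : 0 < l) :
    ∀ᵐ ω ∂P, ∀ z₀ ∈ slopeLevelSet (f ω) l, ∃ r₀ : ℝ, 0 < r₀ ∧ ∃ γ : ℝ → Plane,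
      IsPiecewiseC1Param γ (slopeLevelSet (f ω) l ∩ Metric.ball z₀ r₀) z₀ := by
  filter_upwards [hf.ae_slopeData hW hl] with ω hω
  obtain ⟨gy, h, h1, h2, h11, H⟩ := hω
  exact slopeLevelSet_exists_param H
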